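/- For a measure space $I=\mathbb R$ or $I=\mathbb R_+=(0,\infty)$ with Lebesgue measure $m$, let $L_0(I)$ be the set of (classes of) measurable real functions $x$ on $I$ with $m(\{|x|>s\})<\infty$ for some $s>0$, and put $\mu(t,x)=\inf\{s\ge 0: m(\{|x|>s\})\le t\}$ for $t>0$. A symmetric Banach function space on $I$ is a linear space $E\subset L_0(I)$ with a complete norm such that (a) if $x\in E$, $y\in L_0(I)$ and $|y|\le|x|$ a.e., then $y\in E$ and $\|y\|_E\le\|x\|_E$; (b) if $x\in E$, $y\in L_0(I)$ and $\mu(y)=\mu(x)$, then $y\in E$ and $\|y\|_E=\|x\|_E$. For an increasing concave function $\varphi:[0,\infty)\to[0,\infty)$ with $\varphi(0+)=0$, let $$\Lambda_\varphi(I)=\Big\{x\in L_0(I):\ \|x\|_{\Lambda_\varphi(I)}:=\int_0^\infty\mu(s,x)\,d\varphi(s)<\infty\Big\},$$ let $\Lambda_{\log}(I)$ be this space for $\varphi(t)=\log(1+t)$, and let $\Lambda^0_\varphi(I)=\{x\in\Lambda_\varphi(I): \lim_{t\to\infty}\mu(t,x)=0\}$ with the same norm. The Hilbert transform is $$(\mathcal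 Hx)(s)=\mathrm{p.v.}\,\frac1\pi\int_{\mathbb R}\frac{x(\eta)}{s-\eta}\,d\eta .$$ Let $\phi:[0,\infty)\to[0,\infty)$ be an increasing concave function with $\phi(0+)=0$, and let $$\psi(u)=\inf_{w>1}\frac{\phi(uw)}{1+\log w},\qquad u\ge 0$$ (which is again increasing and concave with $\psi(0+)=0$). Suppose that $\lim_{t\to\infty}\psi(t)/t=0$, that $\Lambda_\phi(\mathbb R_+)\subset\Lambda_{\log}(\mathbb R_+)$, and that there is a constant $c$ (depending on $\phi$ and $\psi$) with $$\int_0^u\frac{\psi(t)}{t}\,dt+u\int_u^\infty\frac{\psi(t)}{t^2}\,dt\le c\,\phi(u),\qquad u>0.$$ Then $\Lambda_\psi(\mathbb R)$ is a symmetric Banach function space; for every $x\in\Lambda_\phi(\mathbb R)$ the principal value $\mathcal Hx$ exists almost everywhere, and $\mathcal H:\Lambda_\phi(\mathbb R)\to\Lambda_\psi(\mathbb R)$ is bounded. Moreover, if $\lim_{t\to\infty}\psi(t)=\infty$, then $\Lambda_\psi(\mathbb R)$ is the least symmetric Banach function space with this property, i.e. $\Lambda_\psi(\mathbb R)\subset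 G(\mathbb R)$ for every symmetric Banach function space $G(\mathbb R)$ such that $\mathcal H:\Lambda_\phi(\mathbb R)\to G(\mathbb R)$ is bounded. Without assuming $\lim_{t\to\infty}\psi(t)=\infty$, the least symmetric Banach function space $F(\mathbb R)$ such that $\mathcal H:\Lambda_\phi(\mathbb R)\to F(\mathbb R)$ is bounded is $\Lambda^0_\psi(\mathbb R)$ (which is all of $\Lambda_\psi(\mathbb R)$ when $\psi$ is unbounded). -/

import Mathlib

open MeasureTheory Set Filter Topology
open scoped ENNReal

noncomputable section

/-! ### Increasing concave functions on `[0, ∞)` with `φ(0+) = 0` -/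

/-- An increasing concave function `φ : [0, ∞) → [0, ∞)` with `φ(0+) = 0`. It is given by a function
on `ℝ`, whose values at negative arguments play no role. -/
structure OmegaFn where
  /-- The underlying function. -/
  toFun : ℝ → ℝ
  nonneg : ∀ t, 0 ≤ t → 0 ≤ toFun t
  mono : MonotoneOn toFun (Ici 0)
  concave : ConcaveOn ℝ (Ici 0) toFun
  tendsto_zero : Tendsto toFun (𝓝[>] 0) (𝓝 0)

instance : CoeFun OmegaFn (fun _ => ℝ → ℝ) := ⟨OmegaFn.toFun⟩

namespace OmegaFn

theorem map_zero (φ : OmegaFn) : φ 0 = 0 := by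
  refine le_antisymm ?_ (φ.nonneg 0 le_rfl)
  refine ge_of_tendsto φ.tendsto_zero ?_
  filter_upwards [self_mem_nhdsWithin] with t ht
  exact φ.mono (mem_Ici.2 le_rfl) (mem_Ici.2 (le_of_lt ht)) (le_of_lt ht)

theorem continuousOn (φ : OmegaFn) : ContinuousOn φ (Ici 0) := by
  intro t ht
  rcases eq_or_lt_of_le (mem_Ici.1 ht) with h | h
  · subst h
    rw [← continuousWithinAt_Ioi_iff_Ici, ContinuousWithinAt, φ.map_zero]
    exact φ.tendsto_zero
  · have h1 : ContinuousOn φ (Ioi 0) :=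
      (φ.concave.subset Ioi_subset_Ici_self (convex_Ioi 0)).continuousOn isOpen_Ioi
    exact (h1.continuousAt (Ioi_mem_nhds h)).continuousWithinAt

/-- The Stieltjes function of `φ`: it is `φ` on `[0, ∞)` and `φ(0) = 0` on `(-∞, 0)`. -/
def stieltjes (φ : OmegaFn) : StieltjesFunction ℝ where
  toFun t := φ (max t 0)
  mono' s t hst :=
    φ.mono (mem_Ici.2 (le_max_right _ _)) (mem_Ici.2 (le_max_right _ _)) (max_le_max_right 0 hst)
  right_continuous' t := by
    have h : Continuous fun t : ℝ => φ (max t 0) :=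
      φ.continuousOn.comp_continuous (continuous_id.max continuous_const)
        (fun t => mem_Ici.2 (le_max_right _ _))
    exact h.continuousWithinAt

/-- The function `t ↦ log (1 + t)`. -/
def log : OmegaFn where
  toFun t := Real.log (1 + t)
  nonneg t ht := Real.log_nonneg (by linarith)
  mono s hs t _ hst := Real.log_le_log (by have := mem_Ici.1 hs; linarith) (by linarith)
  concave := by
    have h := strictConcaveOn_log_Ioi.concaveOn.translate_right (1 : ℝ)
    refine h.subset ?_ (convex_Ici 0)
    intro t ht
    have := mem_Ici.1 ht
    simp only [mem_preimage, mem_Ioi]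
    linarith
  tendsto_zero := by
    have h : ContinuousAt (fun t : ℝ => Real.log (1 + t)) 0 :=
      ContinuousAt.log (by fun_prop) (by norm_num)
    have h' := h.tendsto
    simp only [add_zero, Real.log_one] at h'
    exact h'.mono_left nhdsWithin_le_nhds

theorem psi_aux_nonneg (φ : OmegaFn) {u : ℝ} (hu : 0 ≤ u) (w : Ioi (1 : ℝ)) :
    0 ≤ φ (u * w) / (1 + Real.log w) := by
  have hw : (1 : ℝ) < w := w.2
  have := Real.log_nonneg hw.le
  exact div_nonneg (φ.nonneg _ (by positivity)) (by linarith)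

theorem psi_aux_bddBelow (φ : OmegaFn) {u : ℝ} (hu : 0 ≤ u) :
    BddBelow (range fun w : Ioi (1 : ℝ) => φ (u * w) / (1 + Real.log w)) :=
  ⟨0, by rintro _ ⟨w, rfl⟩; exact φ.psi_aux_nonneg hu w⟩

/-- The function `ψ(u) = inf_{w > 1} φ(u w) / (1 + log w)`. -/
def psi (φ : OmegaFn) : OmegaFn where
  toFun u := ⨅ w : Ioi (1 : ℝ), φ (u * w) / (1 + Real.log w)
  nonneg u hu := Real.iInf_nonneg (φ.psi_aux_nonneg hu)
  mono := by
    intro s hs t ht hst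
    refine ciInf_mono (φ.psi_aux_bddBelow hs) fun w => ?_
    have hw : (1 : ℝ) < w := w.2
    have := Real.log_nonneg hw.le
    have hs' := mem_Ici.1 hs
    have ht' := mem_Ici.1 ht
    refine div_le_div_of_nonneg_right (φ.mono (mem_Ici.2 ?_) (mem_Ici.2 ?_) ?_) (by linarith)
    · positivity
    · positivity
    · exact mul_le_mul_of_nonneg_right hst (by linarith)
  concave := by
    refine ⟨convex_Ici 0, fun s hs t ht a b ha hb hab => ?_⟩
    have : Nonempty (Ioi (1 : ℝ)) := ⟨⟨2, by norm_num⟩⟩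
    have hs' := mem_Ici.1 hs
    have ht' := mem_Ici.1 ht
    refine le_ciInf fun w => ?_
    have hw : (1 : ℝ) < w := w.2
    have hl := Real.log_nonneg hw.le
    have h1 := mul_le_mul_of_nonneg_left (ciInf_le (φ.psi_aux_bddBelow hs') w) ha
    have h2 := mul_le_mul_of_nonneg_left (ciInf_le (φ.psi_aux_bddBelow ht') w) hb
    have h3 := φ.concave.2 (x := s * w) (y := t * w) (mem_Ici.2 (by positivity))
      (mem_Ici.2 (by positivity)) ha hb hab
    simp only [smul_eq_mul] at h3 ⊢
    refine (add_le_add h1 h2).trans ?_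
    rw [← mul_div_assoc, ← mul_div_assoc, ← add_div]
    refine div_le_div_of_nonneg_right ?_ (by linarith)
    convert h3 using 2
    ring
  tendsto_zero := by
    have h2 : (1 : ℝ) < 2 := by norm_num
    have hl := Real.log_nonneg h2.le
    have hlim : Tendsto (fun u : ℝ => φ (u * 2) / (1 + Real.log 2)) (𝓝[>] 0) (𝓝 0) := by
      have : Tendsto (fun u : ℝ => u * 2) (𝓝[>] 0) (𝓝[>] 0) := by
        refine tendsto_nhdsWithin_iff.2 ⟨?_, ?_⟩
        · have h : Tendsto (fun u : ℝ => u * 2) (𝓝 0) (𝓝 (0 * 2)) :=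
            (continuous_id.mul continuous_const).tendsto 0
          rw [zero_mul] at h
          exact h.mono_left nhdsWithin_le_nhds
        · filter_upwards [self_mem_nhdsWithin] with u hu
          exact mul_pos (mem_Ioi.1 hu) two_pos
      simpa using (φ.tendsto_zero.comp this).div_const (1 + Real.log 2)
    refine squeeze_zero' ?_ ?_ hlim
    · filter_upwards [self_mem_nhdsWithin] with u hu
      exact Real.iInf_nonneg (φ.psi_aux_nonneg (le_of_lt hu))
    · filter_upwards [self_mem_nhdsWithin] with u hu
      exact ciInf_le (φ.psi_aux_bddBelow (le_of_lt hu)) ⟨2, h2⟩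

end OmegaFn

/-! ### Decreasing rearrangements and symmetric Banach function spaces -/

section Spaces

variable {α : Type*} [MeasurableSpace α]

/-- The decreasing rearrangement `μ(t, x) = inf {s ≥ 0 : m {|x| > s} ≤ t}`, with values in
`[0, ∞]`. -/
def decRearr {m : Measure α} (x : α →ₘ[m] ℝ) (t : ℝ) : ℝ≥0∞ :=
  sInf {s : ℝ≥0∞ | m {a | s < ‖x a‖ₑ} ≤ ENNReal.ofReal t}

/-- The space `L₀` of all (classes of) measurable real functions `x` such that `m {|x| > s}` is
finite for some `s > 0`. -/
def LZero (m : Measure α) : Set (α →ₘ[m] ℝ) :=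
  {x | ∃ s : ℝ, 0 < s ∧ m {a | s < |x a|} < ∞}

/-- `E ⊆ L₀` with the norm `N` (only its values on `E` matter) is a symmetric Banach function
space. -/
structure IsSymmetricBanach (m : Measure α) (E : Set (α →ₘ[m] ℝ)) (N : (α →ₘ[m] ℝ) → ℝ) :
    Prop where
  subset_LZero : E ⊆ LZero m
  zero_mem : 0 ∈ E
  add_mem : ∀ x ∈ E, ∀ y ∈ E, x + y ∈ E
  smul_mem : ∀ (c : ℝ), ∀ x ∈ E, c • x ∈ E
  norm_nonneg : ∀ x ∈ E, 0 ≤ N x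
  norm_eq_zero_iff : ∀ x ∈ E, (N x = 0 ↔ x = 0)
  norm_smul : ∀ (c : ℝ), ∀ x ∈ E, N (c • x) = |c| * N x
  norm_add_le : ∀ x ∈ E, ∀ y ∈ E, N (x + y) ≤ N x + N y
  complete : ∀ u : ℕ → α →ₘ[m] ℝ, (∀ n, u n ∈ E) →
    (∀ ε > 0, ∃ n₀, ∀ n ≥ n₀, ∀ k ≥ n₀, N (u n - u k) < ε) →
    ∃ x ∈ E, Tendsto (fun n => N (u n - x)) atTop (𝓝 0)
  ideal : ∀ x ∈ E, ∀ y ∈ LZero m, (∀ᵐ a ∂m, |y a| ≤ |x a|) → y ∈ E ∧ N y ≤ N x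
  symmetric : ∀ x ∈ E, ∀ y ∈ LZero m, (∀ t > 0, decRearr y t = decRearr x t) →
    y ∈ E ∧ N y = N x

/-- The value `∫₀^∞ μ(s, x) dφ(s) ∈ [0, ∞]`. -/
def lorentzENorm (φ : OmegaFn) {m : Measure α} (x : α →ₘ[m] ℝ) : ℝ≥0∞ :=
  ∫⁻ s in Ioi (0 : ℝ), decRearr x s ∂φ.stieltjes.measure

/-- The Lorentz space `Λ_φ`. -/
def lorentzSpace (φ : OmegaFn) (m : Measure α) : Set (α →ₘ[m] ℝ) :=
  {x | x ∈ LZero m ∧ lorentzENorm φ x < ∞}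

/-- The norm of the Lorentz space `Λ_φ`. -/
def lorentzNorm (φ : OmegaFn) {m : Measure α} (x : α →ₘ[m] ℝ) : ℝ :=
  (lorentzENorm φ x).toReal

/-- The subspace of those `x ∈ Λ_φ` with `μ(t, x) → 0` as `t → ∞`. It is all of `Λ_φ` if `φ` is
unbounded. -/
def lorentzSpaceVanishing (φ : OmegaFn) (m : Measure α) : Set (α →ₘ[m] ℝ) :=
  {x | x ∈ lorentzSpace φ m ∧ Tendsto (decRearr x) atTop (𝓝 0)}

end Spaces

/-! ### The Hilbert transform -/

/-- `y` is the Hilbert transform of `x`: for almost every `s` the principal value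
`(1 / π) p.v. ∫ x(η) / (s - η) dη` exists and equals `y(s)`. -/
def IsHilbertTransform (x y : ℝ →ₘ[volume] ℝ) : Prop :=
  ∀ᵐ s : ℝ, (∀ ε > 0, IntegrableOn (fun η : ℝ => x η / (s - η)) {η | ε < |s - η|}) ∧
    Tendsto (fun ε : ℝ => 1 / Real.pi * ∫ η in {η : ℝ | ε < |s - η|}, x η / (s - η))
      (𝓝[>] 0) (𝓝 (y s))

/-- The Hilbert transform is defined on all of `E` and bounded from `(E, NE)` to `(F, NF)`. -/
def HilbertBounded (E : Set (ℝ →ₘ[volume] ℝ)) (NE : (ℝ →ₘ[volume] ℝ) → ℝ)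
    (F : Set (ℝ →ₘ[volume] ℝ)) (NF : (ℝ →ₘ[volume] ℝ) → ℝ) : Prop :=
  ∃ C : ℝ, ∀ x ∈ E, ∃ y ∈ F, IsHilbertTransform x y ∧ NF y ≤ C * NE x

/-- `(F, NF)` is the least symmetric Banach function space on `ℝ` into which the Hilbert transform
is bounded from `(E, NE)`. -/
def IsOptimalSymmetricRange (E : Set (ℝ →ₘ[volume] ℝ)) (NE : (ℝ →ₘ[volume] ℝ) → ℝ)
    (F : Set (ℝ →ₘ[volume] ℝ)) (NF : (ℝ →ₘ[volume] ℝ) → ℝ) : Prop :=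
  IsSymmetricBanach volume F NF ∧ HilbertBounded E NE F NF ∧
    ∀ (G : Set (ℝ →ₘ[volume] ℝ)) (NG : (ℝ →ₘ[volume] ℝ) → ℝ),
      IsSymmetricBanach volume G NG → HilbertBounded E NE G NG → F ⊆ G

end

noncomputable section

/-! ### Level sets of logarithms of rational functions with interlacing zeros and poles -/

section Boole

variable {ι : Type*}

/-! Boundedness rests on a bound for the distribution function of the maximal truncated Hilbert
transform that decays exponentially in the level. For a finite union of intervals `(aᵢ, bᵢ)` with
gaps between them, Boole's argument applies: the set where `∑ log |(t - aᵢ)/(t - bᵢ)|` exceeds `l`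
is governed by the roots of `A - cB` and `A + cB`, where `A = ∏ (t - aᵢ)`, `B = ∏ (t - bᵢ)`, `c =
e^l`, and Vieta's formula turns the roots into the total length `∑ (bᵢ - aᵢ) / sinh l`
(`volume_lt_logSum_le`). Discretisation and a covering argument carry this to maximal truncations of
functions with values in `[-1, 1]`, with the bound `40 ‖f‖₁ / sinh (l / 16)`
(`volume_lt_maxHilbert_le`).

Insert this bound into `∫ ψ(|{T*f > l}|) dl`. Small levels, where `sinh x` behaves like `x`, produce
`u ∫_u^∞ ψ(t)/t² dt`; large levels, where it behaves like `e^x`, produce `∫_0^u ψ(t)/t dt`. The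
hypothesis on `φ` and `ψ` therefore bounds the functional by a multiple of `φ(‖f‖₁)`
(`lorentzFunctional_maxHilbert_le`). Slicing by dyadic height extends the estimate to `Λ_φ`, because
the Lorentz functional is countably subadditive: a concave function is a mixture of the functions
`min v r`, and for these the functional is an infimum of subadditive expressions
(`lorentzFunctional_add_le`).

The inclusion into `Λ_log` is equivalent, for the present purpose, to `log (1 + t) ≤ C φ(t)`
(`exists_log_le_mul`). This makes the truncated integrals absolutely convergent, `φ` unbounded and
`ψ` positive. The weak type bound on each slice also shows that the image consists of functions with
level sets of finite measure, so it lies in `Λ⁰_ψ` even when `ψ` is bounded.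

For optimality, the transform of the indicator of `(0, vw)` has size at least a constant times `1 +
log w` on `(0, v)`. Hence in any admissible range the indicator of `(0, v)` has norm at most a
constant times `φ(vw) / (1 + log w)`, and the infimum over `w` is `ψ(v)` (`indicator_norm_le_psi`).
An element `x` of `Λ⁰_ψ` is dominated by `∑ 2^(n+1) 1_{|x| > 2^n}`, whose norms are summable;
completeness and the ideal property put `x` in the range. -/

theorem coeff_prod_X_sub_C_of_card_le (S : Finset ι) (f : ι → ℝ) {m : ℕ} (hm : S.card ≤ m) :
    (∏ i ∈ S, (Polynomial.X - Polynomial.C (f i))).coeff m = if m = S.card then 1 else 0 := by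
  have hmon := Polynomial.monic_prod_X_sub_C f S
  have hdeg : (∏ i ∈ S, (Polynomial.X - Polynomial.C (f i))).natDegree = S.card :=
    Polynomial.natDegree_finsetProd_X_sub_C_eq_card S f
  split_ifs with h
  · rw [h, ← hdeg]; exact hmon
  · exact Polynomial.coeff_eq_zero_of_natDegree_lt (by omega)

/-- A pencil of two monic real-rooted polynomials of the same degree, with prescribed distinct
zeros, is determined by its zeros. -/
theorem pencil_eq_prod_of_roots (S : Finset ι) (a b x : ι → ℝ) (k : ℝ) (hx : Set.InjOn x S)
    (h0 : ∀ i ∈ S, ∏ j ∈ S, (x i - a j) - k * ∏ j ∈ S, (x i - b j) = 0) :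
    (∀ t : ℝ, ∏ j ∈ S, (t - a j) - k * ∏ j ∈ S, (t - b j) = (1 - k) * ∏ j ∈ S, (t - x j)) ∧
      (1 - k) * ∑ i ∈ S, x i = ∑ i ∈ S, a i - k * ∑ i ∈ S, b i := by
  classical
  set D : Polynomial ℝ := ∏ i ∈ S, (Polynomial.X - Polynomial.C (a i)) -
    Polynomial.C k * ∏ i ∈ S, (Polynomial.X - Polynomial.C (b i)) -
    Polynomial.C (1 - k) * ∏ i ∈ S, (Polynomial.X - Polynomial.C (x i)) with hD
  have heval : ∀ t : ℝ, D.eval t = ∏ j ∈ S, (t - a j) - k * ∏ j ∈ S, (t - b j) -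
      (1 - k) * ∏ j ∈ S, (t - x j) := fun t => by
    simp [hD, Polynomial.eval_prod]
  -- The leading coefficients cancel, so `D` has degree below `S.card`, yet it vanishes at the
  -- `S.card` distinct points `x i`.
  have hD0 : D = 0 := by
    have hcard : (S.image x).card = S.card := Finset.card_image_of_injOn hx
    refine Polynomial.eq_zero_of_degree_lt_of_eval_finset_eq_zero (S.image x) ?_ ?_
    · rw [hcard, Polynomial.degree_lt_iff_coeff_zero]
      intro m hm
      simp only [hD, Polynomial.coeff_sub, Polynomial.coeff_C_mul,
        coeff_prod_X_sub_C_of_card_le S _ hm]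
      split_ifs <;> ring
    · intro t ht
      obtain ⟨i, hi, rfl⟩ := Finset.mem_image.1 ht
      rw [heval, h0 i hi, Finset.prod_eq_zero hi (sub_self _)]
      simp
  refine ⟨fun t => ?_, ?_⟩
  · have := heval t
    rw [hD0, Polynomial.eval_zero] at this
    linarith
  · rcases S.eq_empty_or_nonempty with rfl | hS
    · simp
    have hc := congrArg (fun p => Polynomial.coeff p (S.card - 1)) hD0
    simp only [hD, Polynomial.coeff_sub, Polynomial.coeff_C_mul,
      Polynomial.prod_X_sub_C_coeff_card_pred S _ hS.card_pos, Polynomial.coeff_zero] at hc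
    linarith

theorem exists_zero_of_mul_neg {f : ℝ → ℝ} (hf : Continuous f) {u v : ℝ} (huv : u < v)
    (h : f u * f v < 0) : ∃ x ∈ Ioo u v, f x = 0 := by
  rcases mul_neg_iff.1 h with ⟨h1, h2⟩ | ⟨h1, h2⟩
  · exact intermediate_value_Ioo' huv.le hf.continuousOn ⟨h2, h1⟩
  · exact intermediate_value_Ioo huv.le hf.continuousOn ⟨h1, h2⟩

/-- The sum `∑ᵢ log |(x - aᵢ) / (x - bᵢ)|`, which is `p.v. ∫ dη / (x - η)` over the union of the
intervals `(aᵢ, bᵢ)`. -/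
def logSum (S : Finset ι) (a b : ι → ℝ) (x : ℝ) : ℝ :=
  ∑ i ∈ S, (Real.log (x - a i) - Real.log (x - b i))

/-- With `A = ∏ (t - aⱼ)` and `B = ∏ (t - bⱼ)`, sign changes give a root `xᵢ` of `A - cB` in the gap
to the right of each `bᵢ`, and a root `yᵢ` of `A + cB` in each `(aᵢ, bᵢ)`. These are all the roots
by degree, so multiplying the two factorisations yields `A² - c²B²`, and the subleading coefficients
yield the sums. -/
theorem exists_interlacing_roots (S : Finset ι) (a b : ι → ℝ) (hab : ∀ i ∈ S, a i < b i)
    (hdisj : ∀ i ∈ S, ∀ j ∈ S, i ≠ j → b i < a j ∨ b j < a i) {c : ℝ} (hc : 1 < c) :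
    ∃ x y : ι → ℝ, (∀ i ∈ S, y i < x i) ∧
      (∀ t : ℝ, (∏ j ∈ S, (t - a j)) ^ 2 - c ^ 2 * (∏ j ∈ S, (t - b j)) ^ 2 =
        (1 - c ^ 2) * ∏ j ∈ S, ((t - x j) * (t - y j))) ∧
      (c ^ 2 - 1) * ∑ i ∈ S, (x i - y i) = 2 * c * ∑ i ∈ S, (b i - a i) := by
  classical
  have hP : ∀ k : ℝ, Continuous fun t : ℝ =>
      ∏ j ∈ S, (t - a j) - k * ∏ j ∈ S, (t - b j) := fun k => by fun_prop
  have hroot1 : ∀ i ∈ S, ∃ t, b i < t ∧ (∀ j ∈ S, b i < a j → t < a j) ∧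
      ∏ j ∈ S, (t - a j) - c * ∏ j ∈ S, (t - b j) = 0 := by
    intro i hi
    -- The gap to the right of `b i` is bounded exactly when some interval lies beyond it.
    set N := S.filter fun j => b i < a j with hN
    rcases N.eq_empty_or_nonempty with hE | hE
    · have hall : ∀ j ∈ S, a j < b i ∧ b j ≤ b i := by
        intro j hj
        by_cases hij : i = j
        · exact hij ▸ ⟨hab i hi, le_rfl⟩
        · rcases hdisj i hi j hj hij with h | h
          · exact absurd (Finset.mem_filter.2 ⟨hj, h⟩) (by rw [← hN, hE]; simp)
          · exact ⟨(hab j hj).trans (h.trans (hab i hi)), (h.trans (hab i hi)).le⟩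
      -- On the unbounded gap `A - cB` is positive at `b i`, and it becomes negative because `A / B
      -- → 1 < c`.
      have hlim : Tendsto (fun t : ℝ => ∏ j ∈ S, ((t - a j) / (t - b j))) atTop (𝓝 1) := by
        have h1 : ∀ j ∈ S, Tendsto (fun t : ℝ => (t - a j) / (t - b j)) atTop (𝓝 1) := by
          intro j _
          have h2 : Tendsto (fun t : ℝ => 1 + (b j - a j) / (t - b j)) atTop (𝓝 (1 + 0)) :=
            tendsto_const_nhds.add (Tendsto.div_atTop tendsto_const_nhds
              (tendsto_atTop_add_const_right _ _ tendsto_id))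
          rw [add_zero] at h2
          refine h2.congr' ?_
          filter_upwards [eventually_gt_atTop (b j)] with t ht
          have : t - b j ≠ 0 := by linarith
          field_simp
          ring
        simpa using tendsto_finsetProd S h1
      obtain ⟨M, hM1, hM2⟩ := ((hlim.eventually_lt_const hc).and
        (eventually_gt_atTop (b i))).exists
      have hQ : 0 < ∏ j ∈ S, (M - b j) := Finset.prod_pos fun j hj => by
        linarith [(hall j hj).2]
      have hneg : ∏ j ∈ S, (M - a j) - c * ∏ j ∈ S, (M - b j) < 0 := by
        rw [Finset.prod_div_distrib, div_lt_iff₀ hQ] at hM1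
        linarith
      have hpos : 0 < ∏ j ∈ S, (b i - a j) - c * ∏ j ∈ S, (b i - b j) := by
        rw [Finset.prod_eq_zero (f := fun j => b i - b j) hi (sub_self (b i)), mul_zero, sub_zero]
        exact Finset.prod_pos fun j hj => by linarith [(hall j hj).1]
      obtain ⟨t, ht, ht0⟩ := exists_zero_of_mul_neg (hP c) hM2 (mul_neg_of_pos_of_neg hpos hneg)
      refine ⟨t, ht.1, fun j hj hj' => ?_, ht0⟩
      exact absurd hj' (by linarith [(hall j hj).1])
    · obtain ⟨l, hl, hmin⟩ := N.exists_min_image a hE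
      obtain ⟨hlS, hil⟩ := Finset.mem_filter.1 hl
      -- The two values are `A(b i)` and `-c B(a l)`. The numbers `A(b i)` and `B(a l)` have the
      -- same sign, factor by factor, since no interval lies between `b i` and `a l`.
      have hneg : (∏ j ∈ S, (b i - a j) - c * ∏ j ∈ S, (b i - b j)) *
          (∏ j ∈ S, (a l - a j) - c * ∏ j ∈ S, (a l - b j)) < 0 := by
        rw [Finset.prod_eq_zero (f := fun j => b i - b j) hi (sub_self (b i)),
          Finset.prod_eq_zero (f := fun j => a l - a j) hlS (sub_self (a l))]
        have : 0 < ∏ j ∈ S, ((b i - a j) * (a l - b j)) := by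
          refine Finset.prod_pos fun j hj => ?_
          by_cases hij : b i < a j
          · have := hmin j (Finset.mem_filter.2 ⟨hj, hij⟩)
            exact mul_pos_of_neg_of_neg (by linarith) (by linarith [hab j hj])
          · have hb : b j ≤ b i := by
              by_cases hij' : i = j
              · exact hij' ▸ le_rfl
              · rcases hdisj i hi j hj hij' with h | h
                · exact absurd h hij
                · exact (h.trans (hab i hi)).le
            exact mul_pos (by linarith [hab j hj]) (by linarith)
        rw [Finset.prod_mul_distrib] at this
        nlinarith
      obtain ⟨t, ht, ht0⟩ := exists_zero_of_mul_neg (hP c) hil hneg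
      exact ⟨t, ht.1, fun j hj hj' => ht.2.trans_le (hmin j (Finset.mem_filter.2 ⟨hj, hj'⟩)), ht0⟩
  have hroot2 : ∀ i ∈ S, ∃ t, a i < t ∧ t < b i ∧
      ∏ j ∈ S, (t - a j) - (-c) * ∏ j ∈ S, (t - b j) = 0 := by
    intro i hi
    -- The two values are `c B(a i)` and `A(b i)`; in their product only the factor `j = i` is
    -- negative.
    have hneg : (∏ j ∈ S, (a i - a j) - (-c) * ∏ j ∈ S, (a i - b j)) *
        (∏ j ∈ S, (b i - a j) - (-c) * ∏ j ∈ S, (b i - b j)) < 0 := by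
      rw [Finset.prod_eq_zero (f := fun j => b i - b j) hi (sub_self (b i)),
        Finset.prod_eq_zero (f := fun j => a i - a j) hi (sub_self (a i))]
      have : ∏ j ∈ S, ((a i - b j) * (b i - a j)) < 0 := by
        rw [← Finset.mul_prod_erase S _ hi]
        refine mul_neg_of_neg_of_pos
          (mul_neg_of_neg_of_pos (by linarith [hab i hi]) (by linarith [hab i hi])) ?_
        refine Finset.prod_pos fun j hj => ?_
        obtain ⟨hji, hjS⟩ := Finset.mem_erase.1 hj
        rcases hdisj i hi j hjS (Ne.symm hji) with h | h
        · exact mul_pos_of_neg_of_neg (by linarith [hab i hi, hab j hjS]) (by linarith)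
        · exact mul_pos (by linarith) (by linarith [hab i hi, hab j hjS])
      rw [Finset.prod_mul_distrib] at this
      nlinarith
    obtain ⟨t, ht, ht0⟩ := exists_zero_of_mul_neg (hP (-c)) (hab i hi) hneg
    exact ⟨t, ht.1, ht.2, ht0⟩
  choose! x hx1 hx2 hx3 using hroot1
  choose! y hy1 hy2 hy3 using hroot2
  have hxinj : Set.InjOn x S := by
    intro i hi j hj hij
    by_contra hne
    rcases hdisj i hi j hj hne with h | h
    · linarith [hx2 i hi j hj h, hab j hj, hx1 j hj]
    · linarith [hx2 j hj i hi h, hab i hi, hx1 i hi]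
  have hyinj : Set.InjOn y S := by
    intro i hi j hj hij
    by_contra hne
    rcases hdisj i hi j hj hne with h | h
    · linarith [hy2 i hi, hy1 j hj]
    · linarith [hy2 j hj, hy1 i hi]
  obtain ⟨hX1, hX2⟩ := pencil_eq_prod_of_roots S a b x c hxinj hx3
  obtain ⟨hY1, hY2⟩ := pencil_eq_prod_of_roots S a b y (-c) hyinj hy3
  refine ⟨x, y, fun i hi => (hy2 i hi).trans (hx1 i hi), fun t => ?_, ?_⟩
  · rw [Finset.prod_mul_distrib]
    linear_combination (∏ j ∈ S, (t - a j) - (-c) * ∏ j ∈ S, (t - b j)) * hX1 t +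
      (1 - c) * (∏ j ∈ S, (t - x j)) * hY1 t
  · rw [Finset.sum_sub_distrib, Finset.sum_sub_distrib]
    linear_combination -(1 + c) * hX2 - (c - 1) * hY2

/-- Where the sum exceeds `l` one has `A² - e^{2l} B² > 0`. The leading coefficient `1 - e^{2l}` is
negative, so some `(t - xᵢ)(t - yᵢ)` must be negative, which puts `t` in `(yᵢ, xᵢ)`. The total
length is `2c / (c² - 1) = 1 / sinh l` times `∑ (bᵢ - aᵢ)`, for `c = e^l`. The end points, where
`Real.log 0 = 0` breaks the product formula, form a null set. -/
theorem volume_lt_logSum_le (S : Finset ι) (a b : ι → ℝ) (hab : ∀ i ∈ S, a i < b i)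
    (hdisj : ∀ i ∈ S, ∀ j ∈ S, i ≠ j → b i < a j ∨ b j < a i) {l : ℝ} (hl : 0 < l) :
    volume {t | l < logSum S a b t} ≤ ENNReal.ofReal ((∑ i ∈ S, (b i - a i)) / Real.sinh l) := by
  classical
  have hc : 1 < Real.exp l := Real.one_lt_exp_iff.2 hl
  obtain ⟨x, y, hyx, hprod, hsum⟩ := exists_interlacing_roots S a b hab hdisj hc
  have hsub : {t | l < logSum S a b t} ⊆
      (⋃ i ∈ S, Ioo (y i) (x i)) ∪ ((S.image a ∪ S.image b : Finset ℝ) : Set ℝ) := by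
    intro t ht
    by_cases hE : t ∈ S.image a ∪ S.image b
    · exact Or.inr hE
    left
    simp only [Finset.mem_union, Finset.mem_image, not_or, not_exists, not_and] at hE
    have hA : ∀ i ∈ S, t - a i ≠ 0 := fun i hi h => hE.1 i hi (by linarith)
    have hB : ∀ i ∈ S, t - b i ≠ 0 := fun i hi h => hE.2 i hi (by linarith)
    have hA' := Finset.prod_ne_zero_iff.2 hA
    have hB' := Finset.prod_ne_zero_iff.2 hB
    have h1 : l < Real.log (∏ i ∈ S, (t - a i)) - Real.log (∏ i ∈ S, (t - b i)) := by
      rw [Real.log_prod hA, Real.log_prod hB, ← Finset.sum_sub_distrib]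
      exact ht
    have h2 : Real.exp l * |∏ i ∈ S, (t - b i)| < |∏ i ∈ S, (t - a i)| := by
      rw [← Real.log_abs (∏ i ∈ S, (t - a i)), ← Real.log_abs (∏ i ∈ S, (t - b i))] at h1
      have h3 := Real.exp_lt_exp.2 (lt_sub_iff_add_lt.1 h1)
      rwa [Real.exp_add, Real.exp_log (abs_pos.2 hA'), Real.exp_log (abs_pos.2 hB')] at h3
    have h3 : 0 < (∏ j ∈ S, (t - a j)) ^ 2 - Real.exp l ^ 2 * (∏ j ∈ S, (t - b j)) ^ 2 := by
      have := pow_lt_pow_left₀ h2 (by positivity) two_ne_zero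
      rw [mul_pow, sq_abs, sq_abs] at this
      linarith
    rw [hprod t] at h3
    have h4 : ¬ ∀ i ∈ S, 0 ≤ (t - x i) * (t - y i) := by
      intro hall
      have h5 : 0 ≤ Real.exp l ^ 2 - 1 := by nlinarith
      linarith [mul_nonneg h5 (Finset.prod_nonneg hall)]
    push Not at h4
    obtain ⟨i, hi, hneg⟩ := h4
    refine mem_biUnion hi ?_
    have := hyx i hi
    rcases mul_neg_iff.1 hneg with h | h
    · exact absurd h.2 (by linarith [h.1])
    · exact ⟨by linarith [h.2], by linarith [h.1]⟩
  have hval : ∑ i ∈ S, (x i - y i) = (∑ i ∈ S, (b i - a i)) / Real.sinh l := by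
    have hs : 0 < Real.sinh l := Real.sinh_pos_iff.2 hl
    rw [eq_div_iff hs.ne', Real.sinh_eq, Real.exp_neg]
    have : Real.exp l ≠ 0 := (Real.exp_pos l).ne'
    field_simp
    linarith
  calc volume {t | l < logSum S a b t}
      ≤ volume (⋃ i ∈ S, Ioo (y i) (x i)) +
          volume ((S.image a ∪ S.image b : Finset ℝ) : Set ℝ) :=
        (measure_mono hsub).trans (measure_union_le _ _)
    _ ≤ ∑ i ∈ S, ENNReal.ofReal (x i - y i) + 0 := by
        gcongr
        · refine (measure_biUnion_finset_le S _).trans (Finset.sum_le_sum fun i _ => ?_)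
          rw [Real.volume_Ioo]
        · exact (Set.Finite.measure_zero (Finset.finite_toSet _) _).le
    _ = _ := by
        rw [add_zero, ← ENNReal.ofReal_sum_of_nonneg, hval]
        intro i hi
        linarith [hyx i hi]

/-- The reflection `t ↦ -t` changes the sign of the sum, so negative values obey the same bound. -/
theorem volume_lt_abs_logSum_le (S : Finset ι) (a b : ι → ℝ) (hab : ∀ i ∈ S, a i < b i)
    (hdisj : ∀ i ∈ S, ∀ j ∈ S, i ≠ j → b i < a j ∨ b j < a i) {l : ℝ} (hl : 0 < l) :
    volume {t | l < |logSum S a b t|} ≤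
      ENNReal.ofReal (2 * ((∑ i ∈ S, (b i - a i)) / Real.sinh l)) := by
  have h1 := volume_lt_logSum_le S a b hab hdisj hl
  have h2 := volume_lt_logSum_le S (fun i => -b i) (fun i => -a i)
    (fun i hi => neg_lt_neg (hab i hi))
    (fun i hi j hj hij => (hdisj i hi j hj hij).symm.imp neg_lt_neg neg_lt_neg) hl
  have hneg : ∀ t, logSum S (fun i => -b i) (fun i => -a i) (-t) = -logSum S a b t := by
    intro t
    simp only [logSum, ← Finset.sum_neg_distrib]
    refine Finset.sum_congr rfl fun i _ => ?_
    rw [show -t - -b i = -(t - b i) by ring, show -t - -a i = -(t - a i) by ring,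
      Real.log_neg_eq_log, Real.log_neg_eq_log]
    ring
  have h3 : volume {t | l < -logSum S a b t} ≤
      ENNReal.ofReal ((∑ i ∈ S, (b i - a i)) / Real.sinh l) := by
    have : {t | l < -logSum S a b t} =
        Neg.neg ⁻¹' {t | l < logSum S (fun i => -b i) (fun i => -a i) t} := by
      ext t
      simp only [mem_ofPred_eq, mem_preimage, hneg]
    rw [this, Measure.measure_preimage_neg]
    refine h2.trans_eq ?_
    congr 3
    ext i
    ring
  have hsub : {t | l < |logSum S a b t|} ⊆
      {t | l < logSum S a b t} ∪ {t | l < -logSum S a b t} := fun t ht => by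
    simpa only [mem_union, mem_ofPred_eq, lt_abs] using ht
  have hnn : 0 ≤ (∑ i ∈ S, (b i - a i)) / Real.sinh l :=
    div_nonneg (Finset.sum_nonneg fun i hi => by linarith [hab i hi])
      (Real.sinh_pos_iff.2 hl).le
  rw [two_mul, ENNReal.ofReal_add hnn hnn]
  exact (measure_mono hsub).trans ((measure_union_le _ _).trans (add_le_add h1 h3))

end Boole

/-! ### Truncated Hilbert transforms -/

/-- A covering lemma: if every point of `U` is the centre of a ball whose radius is at most its
`ν`-measure, then the measure of `U` is controlled by the mass of `ν`. -/
theorem volume_le_of_forall_closedBall (ν : Measure ℝ) (hν : ν univ ≠ ∞) (U : Set ℝ)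
    (h : ∀ s ∈ U, ∃ r : ℝ, 0 < r ∧ ENNReal.ofReal r ≤ ν (Metric.closedBall s r)) :
    volume U ≤ 10 * ν univ := by
  choose! r hr0 hr using h
  have hrR : ∀ s ∈ U, r s ≤ (ν univ).toReal := fun s hs =>
    (ENNReal.ofReal_le_iff_le_toReal hν).1 ((hr s hs).trans (measure_mono (subset_univ _)))
  -- The balls of the disjoint subfamily cover `U` after enlargement by `5`, and a ball of radius
  -- `5r` has length `10r`; this is the constant `10`.
  obtain ⟨u, huU, hdisj, hcov⟩ := Vitali.exists_disjoint_subfamily_covering_enlargement_closedBall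
    U (fun s => s) r _ hrR 5 (by norm_num)
  have hcount : u.Countable := by
    refine hdisj.countable_of_nonempty_interior fun s hs => ?_
    rw [interior_closedBall _ (hr0 s (huU hs)).ne']
    exact ⟨s, Metric.mem_ball_self (hr0 s (huU hs))⟩
  calc volume U ≤ volume (⋃ s ∈ u, Metric.closedBall s (5 * r s)) := by
        refine measure_mono fun s hs => ?_
        obtain ⟨b, hb, hsub⟩ := hcov s hs
        exact mem_biUnion hb (hsub (Metric.mem_closedBall_self (hr0 s hs).le))
    _ ≤ ∑' s : u, volume (Metric.closedBall (s : ℝ) (5 * r s)) := measure_biUnion_le _ hcount _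
    _ ≤ ∑' s : u, 10 * ν (Metric.closedBall (s : ℝ) (r s)) := by
        refine ENNReal.tsum_le_tsum fun s => ?_
        rw [Real.volume_closedBall, show 2 * (5 * r s) = 10 * r s by ring,
          ENNReal.ofReal_mul (by norm_num)]
        gcongr
        · norm_num
        · exact hr _ (huU s.2)
    _ = 10 * ν (⋃ s ∈ u, Metric.closedBall (s : ℝ) (r s)) := by
        rw [ENNReal.tsum_mul_left, measure_biUnion hcount hdisj
          fun s _ => Metric.isClosed_closedBall.measurableSet]
    _ ≤ 10 * ν univ := by gcongr; exact subset_univ _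

/-- The truncated singular integral `∫_{|s - η| > ε} f(η) / (s - η) dη`. -/
def truncHilbert (f : ℝ → ℝ) (ε s : ℝ) : ℝ :=
  ∫ η in {η : ℝ | ε < |s - η|}, f η / (s - η)

theorem measurableSet_far (ε s : ℝ) : MeasurableSet {η : ℝ | ε < |s - η|} :=
  measurableSet_lt measurable_const (by fun_prop)

theorem integrableOn_div_sub {f : ℝ → ℝ} (hf : Integrable f) {ε : ℝ} (hε : 0 < ε) (s : ℝ) :
    IntegrableOn (fun η => f η / (s - η)) {η : ℝ | ε < |s - η|} := by
  refine Integrable.mono' (hf.norm.div_const ε).integrableOn ?_ ?_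
  · exact (hf.aemeasurable.div (by fun_prop)).aestronglyMeasurable.restrict
  · filter_upwards [ae_restrict_mem (measurableSet_far ε s)] with η hη
    rw [norm_div]
    exact div_le_div_of_nonneg_left (norm_nonneg _) hε (le_of_lt hη)

/-! ### Discretisation of the truncated integral -/

theorem abs_inv_sub_inv_le {s u v ε : ℝ} (hε : 0 < ε) (hu : ε ≤ |s - u|) (hv : ε ≤ |s - v|) :
    |1 / (s - u) - 1 / (s - v)| ≤ |u - v| / ε ^ 2 := by
  have hu0 : s - u ≠ 0 := abs_pos.1 (hε.trans_le hu)
  have hv0 : s - v ≠ 0 := abs_pos.1 (hε.trans_le hv)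
  have : 1 / (s - u) - 1 / (s - v) = (u - v) / ((s - u) * (s - v)) := by
    field_simp
    ring
  rw [this, abs_div, abs_mul, sq]
  gcongr

theorem abs_log_sub_log_sub_le {a b s ε δ : ℝ} (hab : a < b) (hbδ : b - a ≤ δ) (hε : 0 < ε)
    (h : ∀ η ∈ Icc a b, ε ≤ |s - η|) :
    |(Real.log (s - a) - Real.log (s - b)) - (b - a) * (1 / (s - a))| ≤
      (b - a) * (δ / ε ^ 2) := by
  have hne : ∀ η ∈ Icc a b, s - η ≠ 0 := fun η hη => abs_pos.1 (hε.trans_le (h η hη))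
  have hd : ∀ η ∈ Icc a b, HasDerivAt (fun t => -Real.log (s - t)) (1 / (s - η)) η := by
    intro η hη
    have h1 : HasDerivAt (fun t => s - t) (-1) η := by
      simpa using (hasDerivAt_id η).const_sub s
    have h2 : HasDerivAt (fun t => -Real.log (s - t)) (-(-1 / (s - η))) η :=
      (h1.log (hne η hη)).neg
    rwa [neg_div, neg_neg] at h2
  obtain ⟨ξ, hξ, hξ'⟩ := exists_hasDerivAt_eq_slope _ _ hab
    (fun η hη => (hd η hη).continuousAt.continuousWithinAt)
    (fun η hη => hd η (Ioo_subset_Icc_self hη))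
  have hba : 0 < b - a := sub_pos.2 hab
  rw [eq_div_iff hba.ne'] at hξ'
  have h3 : (Real.log (s - a) - Real.log (s - b)) - (b - a) * (1 / (s - a)) =
      (b - a) * (1 / (s - ξ) - 1 / (s - a)) := by linarith
  rw [h3, abs_mul, abs_of_pos hba]
  refine mul_le_mul_of_nonneg_left ?_ hba.le
  refine (abs_inv_sub_inv_le hε (h ξ (Ioo_subset_Icc_self hξ)) (h a (left_mem_Icc.2 hab.le))).trans
    ?_
  gcongr
  rw [abs_of_pos (by linarith [hξ.1])]
  linarith [hξ.2]

/-- The quotient `(t - a) / (t - b) = 1 + (b - a) / (t - b)` is positive and decreasing on either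
side of `[a, b]`. This monotonicity takes the place of smoothness estimates for the kernel in the
maximal inequality. -/
theorem log_sub_log_antitone {a b x y : ℝ} (hab : a < b) (hxy : x ≤ y)
    (h : y < a ∨ b < x) :
    Real.log (y - a) - Real.log (y - b) ≤ Real.log (x - a) - Real.log (x - b) := by
  have h1 : 0 < (y - a) * (x - b) := by
    rcases h with h | h
    · exact mul_pos_of_neg_of_neg (by linarith) (by linarith)
    · exact mul_pos (by linarith) (by linarith)
  have h2 : (y - a) * (x - b) ≤ (x - a) * (y - b) := by
    nlinarith [mul_nonneg (sub_nonneg.2 hxy) (sub_pos.2 hab).le]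
  have h3 := Real.log_le_log h1 h2
  have h4 : 0 < (x - a) * (y - b) := h1.trans_le h2
  rw [Real.log_mul (left_ne_zero_of_mul h1.ne') (right_ne_zero_of_mul h1.ne'),
    Real.log_mul (left_ne_zero_of_mul h4.ne') (right_ne_zero_of_mul h4.ne')] at h3
  linarith

theorem abs_setIntegral_div_sub_sub_le {f : ℝ → ℝ} (hf : Integrable f) (hf0 : ∀ η, 0 ≤ f η)
    {a δ s ε : ℝ} (hδ : 0 < δ) (hε : 0 < ε) (h : ∀ η ∈ Ico a (a + δ), ε < |s - η|) :
    |(∫ η in Ico a (a + δ), f η / (s - η)) - (∫ η in Ico a (a + δ), f η) * (1 / (s - a))| ≤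
      (∫ η in Ico a (a + δ), f η) * (δ / ε ^ 2) := by
  have hi : IntegrableOn (fun η => f η / (s - η)) (Ico a (a + δ)) :=
    (integrableOn_div_sub hf hε s).mono_set h
  rw [← integral_mul_const, ← integral_sub hi (hf.integrableOn.mul_const _), ← integral_mul_const]
  rw [← Real.norm_eq_abs]
  refine norm_integral_le_of_norm_le (hf.integrableOn.mul_const _) ?_
  filter_upwards [ae_restrict_mem measurableSet_Ico] with η hη
  rw [div_eq_mul_one_div, ← mul_sub, norm_mul, Real.norm_of_nonneg (hf0 η)]
  refine mul_le_mul_of_nonneg_left ?_ (hf0 η)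
  refine (abs_inv_sub_inv_le hε (h η hη).le (h a (left_mem_Ico.2 (by linarith))).le).trans ?_
  gcongr
  rw [abs_of_nonneg (by linarith [hη.1])]
  linarith [hη.2]

/-- The cell `[k δ, (k + 1) δ)` of the grid of mesh `δ`. -/
def gridCell (δ : ℝ) (k : ℤ) : Set ℝ := Ico (k * δ) (k * δ + δ)

theorem pairwise_disjoint_gridCell {δ : ℝ} (hδ : 0 < δ) :
    Pairwise (Function.onFun Disjoint (gridCell δ)) := by
  intro k l hkl
  rw [Function.onFun, Set.disjoint_left]
  rintro x ⟨h1, h2⟩ ⟨h3, h4⟩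
  rcases lt_or_gt_of_ne hkl with h | h
  · have h5 : (k : ℝ) + 1 ≤ l := by exact_mod_cast h
    nlinarith
  · have h5 : (l : ℝ) + 1 ≤ k := by exact_mod_cast h
    nlinarith

theorem iUnion_gridCell {δ : ℝ} (hδ : 0 < δ) : ⋃ k, gridCell δ k = univ := by
  refine eq_univ_of_forall fun x => mem_iUnion.2 ⟨⌊x / δ⌋, ?_, ?_⟩
  · exact (le_div_iff₀ hδ).1 (Int.floor_le _)
  · have := (div_lt_iff₀ hδ).1 (Int.lt_floor_add_one (x / δ))
    linarith

theorem measurableSet_gridCell (δ : ℝ) (k : ℤ) : MeasurableSet (gridCell δ k) := measurableSet_Ico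

/-- Finitely many cells carry almost all the mass. Cells without mass are dropped, since they would
give degenerate intervals in the logarithmic sum. -/
theorem exists_finset_setIntegral_compl_lt {f : ℝ → ℝ} (hf : Integrable f) (hf0 : ∀ η, 0 ≤ f η)
    {δ τ : ℝ} (hδ : 0 < δ) (hτ : 0 < τ) :
    ∃ S : Finset ℤ, (∀ k ∈ S, 0 < ∫ η in gridCell δ k, f η) ∧
      ∫ η in (⋃ k ∈ S, gridCell δ k)ᶜ, f η < τ := by
  classical
  have h1 : HasSum (fun k => ∫ η in gridCell δ k, f η) (∫ η, f η) := by
    have := hasSum_integral_iUnion (μ := volume) (f := f) (measurableSet_gridCell δ)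
      (pairwise_disjoint_gridCell hδ) hf.integrableOn
    rwa [iUnion_gridCell hδ, setIntegral_univ] at this
  obtain ⟨S, hS⟩ := (h1.eventually (lt_mem_nhds (sub_lt_self _ hτ))).exists
  refine ⟨S.filter fun k => 0 < ∫ η in gridCell δ k, f η,
    fun k hk => (Finset.mem_filter.1 hk).2, ?_⟩
  have h2 := integral_add_compl (μ := volume) (f := f)
    (s := ⋃ k ∈ S.filter fun k => 0 < ∫ η in gridCell δ k, f η, gridCell δ k)
    (Finset.measurableSet_biUnion _ fun k _ => measurableSet_gridCell δ k) hf
  rw [integral_biUnion_finset _ (fun k _ => measurableSet_gridCell δ k)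
    (fun k _ l _ hkl => pairwise_disjoint_gridCell hδ hkl) (fun k _ => hf.integrableOn),
    Finset.sum_filter_of_ne (fun k _ hk => lt_of_le_of_ne
      (integral_nonneg hf0) (Ne.symm hk))] at h2
  linarith

theorem setIntegral_Ico_le {f : ℝ → ℝ} (hf : Integrable f) (hf1 : ∀ η, f η ≤ 1) {a b : ℝ}
    (hab : a ≤ b) : ∫ η in Ico a b, f η ≤ b - a := by
  refine (setIntegral_mono_on hf.integrableOn (integrableOn_const (C := (1 : ℝ)) (by simp))
    measurableSet_Ico fun η _ => hf1 η).trans ?_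
  simp [hab]

theorem setIntegral_union_le_add {f : ℝ → ℝ} (hf : Integrable f) (hf0 : ∀ η, 0 ≤ f η)
    {A B : Set ℝ} (hB : MeasurableSet B) :
    ∫ η in A ∪ B, f η ≤ (∫ η in A, f η) + ∫ η in B, f η := by
  rw [← sdiff_union_self, setIntegral_union disjoint_sdiff_left hB hf.integrableOn hf.integrableOn]
  refine add_le_add_left ?_ _
  exact setIntegral_mono_set hf.integrableOn (ae_of_all _ hf0) sdiff_subset.eventuallyLE

/-- The truncated Hilbert transform of a function with values in `[0, 1]` is close to twice a
logarithmic sum over the cells which do not meet the truncated interval. -/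
theorem abs_truncHilbert_sub_logSum_le {f : ℝ → ℝ} (hf : Integrable f) (hf0 : ∀ η, 0 ≤ f η)
    (hf1 : ∀ η, f η ≤ 1) {δ τ ε s : ℝ} (hδ : 0 < δ) (hε : 0 < ε) (S O : Finset ℤ)
    (hS : ∀ k ∈ S, 0 < ∫ η in gridCell δ k, f η)
    (hτ : ∫ η in (⋃ k ∈ S, gridCell δ k)ᶜ, f η < τ)
    (hO : ∀ k, k ∈ O ↔ k ∈ S ∧ gridCell δ k ⊆ {η | ε < |s - η|}) :
    |truncHilbert f ε s - 2 * logSum O (fun k => k * δ)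
        (fun k => k * δ + (∫ η in gridCell δ k, f η) / 2) s| ≤
      (τ + 2 * δ) / ε + 2 * (∫ η, f η) * (δ / ε ^ 2) := by
  classical
  have hOS : ∀ k ∈ O, k ∈ S := fun k hk => ((hO k).1 hk).1
  have hOfar : ∀ k ∈ O, gridCell δ k ⊆ {η | ε < |s - η|} := fun k hk => ((hO k).1 hk).2
  set w : ℤ → ℝ := fun k => ∫ η in gridCell δ k, f η with hw
  have hwδ : ∀ k, w k ≤ δ := fun k => by
    refine (setIntegral_Ico_le hf hf1 (by linarith)).trans (by linarith)
  set U : Set ℝ := ⋃ k ∈ O, gridCell δ k with hU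
  have hUm : MeasurableSet U := Finset.measurableSet_biUnion _ fun k _ => measurableSet_gridCell δ k
  have hUfar : U ⊆ {η | ε < |s - η|} := iUnion₂_subset hOfar
  have hint := integrableOn_div_sub hf hε s
  have hsplit : truncHilbert f ε s = (∫ η in U, f η / (s - η)) +
      ∫ η in {η | ε < |s - η|} \ U, f η / (s - η) := by
    rw [setIntegral_sdiff hUm hint hUfar, truncHilbert]
    ring
  have hUsum : ∫ η in U, f η / (s - η) = ∑ k ∈ O, ∫ η in gridCell δ k, f η / (s - η) :=
    integral_biUnion_finset _ (fun k _ => measurableSet_gridCell δ k)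
      (fun k _ l _ hkl => pairwise_disjoint_gridCell hδ hkl)
      (fun k hk => hint.mono_set (hOfar k hk))
  have hwsum : ∑ k ∈ O, w k ≤ ∫ η, f η := by
    rw [hw, ← integral_biUnion_finset _ (fun k _ => measurableSet_gridCell δ k)
      (fun k _ l _ hkl => pairwise_disjoint_gridCell hδ hkl) (fun k _ => hf.integrableOn)]
    exact setIntegral_le_integral hf (ae_of_all _ hf0)
  -- An interval of length half the mass `w k ≤ δ` stays well inside its cell, which leaves the gaps
  -- that Boole's argument needs; the factor `2` restores the mass.
  have hcell : ∀ k ∈ O, |(∫ η in gridCell δ k, f η / (s - η)) -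
      2 * (Real.log (s - k * δ) - Real.log (s - (k * δ + w k / 2)))| ≤
        2 * (w k * (δ / ε ^ 2)) := by
    intro k hk
    have hwk : 0 < w k := hS k (hOS k hk)
    have h1 := abs_setIntegral_div_sub_sub_le hf hf0 hδ hε (a := k * δ) (s := s) (hOfar k hk)
    have h2 := abs_log_sub_log_sub_le (a := k * δ) (b := k * δ + w k / 2) (s := s) (δ := δ)
      (by linarith) (by linarith [hwδ k]) hε (fun η hη => le_of_lt (hOfar k hk
        ⟨hη.1, by linarith [hη.2, hwδ k]⟩))
    rw [show k * δ + w k / 2 - k * δ = w k / 2 by ring] at h2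
    change |(∫ η in gridCell δ k, f η / (s - η)) - w k * _| ≤ w k * _ at h1
    rw [abs_le] at h1 h2 ⊢
    constructor <;> linarith [h1.1, h1.2, h2.1, h2.2]
  have hrest : |∫ η in {η | ε < |s - η|} \ U, f η / (s - η)| ≤ (τ + 2 * δ) / ε := by
    -- A far point of a retained cell outside `U` shares its cell with a point at distance at most
    -- `ε` from `s`, so it lies within `δ` of the boundary of the truncated interval.
    have hsub : {η | ε < |s - η|} \ U ⊆ (⋃ k ∈ S, gridCell δ k)ᶜ ∪
        (Ico (s - ε - δ) (s - ε) ∪ Ico (s + ε) (s + ε + δ)) := by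
      rintro η ⟨hη, hηU⟩
      by_cases hηS : η ∈ ⋃ k ∈ S, gridCell δ k
      · right
        obtain ⟨k, hk, hηk⟩ := mem_iUnion₂.1 hηS
        have hkO : k ∉ O := fun h => hηU (mem_biUnion h hηk)
        rw [hO, not_and] at hkO
        obtain ⟨ζ, hζ, hζ'⟩ := not_subset.1 (hkO hk)
        have hζ2 : |s - ζ| ≤ ε := not_lt.1 hζ'
        rw [abs_le] at hζ2
        have hη2 : ε < |s - η| := hη
        have := hηk.1; have := hηk.2; have := hζ.1; have := hζ.2
        rcases lt_abs.1 hη2 with h | h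
        · left
          constructor <;> linarith
        · right
          constructor <;> linarith
      · exact Or.inl hηS
    rw [← Real.norm_eq_abs]
    have hm1 : MeasurableSet ((⋃ k ∈ S, gridCell δ k)ᶜ) :=
      (Finset.measurableSet_biUnion _ fun k _ => measurableSet_gridCell δ k).compl
    calc ‖∫ η in {η | ε < |s - η|} \ U, f η / (s - η)‖
        ≤ ∫ η in {η | ε < |s - η|} \ U, f η / ε := by
          refine norm_integral_le_of_norm_le (hf.div_const ε).integrableOn ?_
          filter_upwards [ae_restrict_mem ((measurableSet_far ε s).diff hUm)] with η hη
          rw [norm_div, Real.norm_of_nonneg (hf0 η)]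
          exact div_le_div_of_nonneg_left (hf0 η) hε (le_of_lt hη.1)
      _ = (∫ η in {η | ε < |s - η|} \ U, f η) / ε := integral_div _ _
      _ ≤ (τ + 2 * δ) / ε := by
          gcongr
          refine (setIntegral_mono_set hf.integrableOn (ae_of_all _ hf0)
            hsub.eventuallyLE).trans ?_
          have e1 := setIntegral_union_le_add hf hf0 (A := (⋃ k ∈ S, gridCell δ k)ᶜ)
            (B := Ico (s - ε - δ) (s - ε) ∪ Ico (s + ε) (s + ε + δ))
            (measurableSet_Ico.union measurableSet_Ico)
          have e2 := setIntegral_union_le_add hf hf0 (A := Ico (s - ε - δ) (s - ε))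
            (B := Ico (s + ε) (s + ε + δ)) measurableSet_Ico
          have e3 := setIntegral_Ico_le hf hf1 (a := s - ε - δ) (b := s - ε) (by linarith)
          have e4 := setIntegral_Ico_le hf hf1 (a := s + ε) (b := s + ε + δ) (by linarith)
          linarith
  rw [hsplit, hUsum, logSum, Finset.mul_sum]
  have hfin : |∑ k ∈ O, (∫ η in gridCell δ k, f η / (s - η)) -
      ∑ k ∈ O, 2 * (Real.log (s - k * δ) - Real.log (s - (k * δ + w k / 2)))| ≤
      2 * (∫ η, f η) * (δ / ε ^ 2) := by
    rw [← Finset.sum_sub_distrib]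
    refine (Finset.abs_sum_le_sum_abs _ _).trans ((Finset.sum_le_sum hcell).trans ?_)
    rw [← Finset.mul_sum, ← Finset.sum_mul, mul_assoc]
    gcongr
  rw [abs_le] at hfin hrest ⊢
  constructor <;> linarith [hfin.1, hfin.2, hrest.1, hrest.2]

/-- A cell all of whose points are farther than `ε` from `s` lies on one side of `[s - ε, s + ε]`,
so each of its logarithmic terms is decreasing there. -/
theorem logSum_filter_antitone {S O : Finset ℤ} {a b : ℤ → ℝ} {δ s ε x y : ℝ}
    (hab : ∀ k ∈ S, a k < b k) (hOS : ∀ k ∈ O, k ∈ S) (ha : ∀ k, a k = k * δ)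
    (hbδ : ∀ k ∈ S, b k < k * δ + δ) (hO : ∀ k ∈ O, gridCell δ k ⊆ {η | ε < |s - η|})
    (hε : 0 < ε) (hx : s - ε ≤ x) (hxy : x ≤ y) (hy : y ≤ s + ε) :
    logSum O a b y ≤ logSum O a b x := by
  refine Finset.sum_le_sum fun k hk => log_sub_log_antitone (hab k (hOS k hk)) hxy ?_
  have hab' := hab k (hOS k hk)
  have hb' := hbδ k (hOS k hk)
  have hak := ha k
  by_contra hcon
  push Not at hcon
  -- If the interval met `[x, y]`, this point of the cell would be within `ε` of `s`.
  have hmem : max (a k) (s - ε) ∈ gridCell δ k := by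
    refine ⟨by rw [← hak]; exact le_max_left _ _, max_lt (by linarith) (by linarith)⟩
  have h1 : ε < |s - max (a k) (s - ε)| := hO k hk hmem
  have h2 : |s - max (a k) (s - ε)| ≤ ε := by
    rw [abs_le]
    exact ⟨by linarith [max_le (show a k ≤ s + ε by linarith) (show s - ε ≤ s + ε by linarith)],
      by linarith [le_max_right (a k) (s - ε)]⟩
  linarith

/-- If `|T_ε f(s)| > l`, the sum over the far cells is large at `s` and, being monotone, large on
one half of `(s - ε, s + ε)`. It is the full sum minus the sum over the near cells. Boole's estimate
bounds the level set of the full sum globally, and that of the near sum by the mass of `f` near `s`.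
Thus `ε` is at most the `ν₀`-measure of the ball of radius `2ε`, and the covering lemma applies. The
lower bound `e₀` on `ε` allows a single mesh `δ` for all truncations. -/
theorem volume_exists_lt_abs_truncHilbert_le {f : ℝ → ℝ} (hf : Integrable f)
    (hf0 : ∀ η, 0 ≤ f η) (hf1 : ∀ η, f η ≤ 1) {l e₀ : ℝ} (hl : 0 < l) (he₀ : 0 < e₀) :
    volume {s | ∃ ε, e₀ ≤ ε ∧ l < |truncHilbert f ε s|} ≤
      ENNReal.ofReal (40 * ((∫ η, f η) / Real.sinh (l / 8))) := by
  classical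
  set I := ∫ η, f η with hI
  have hI0 : 0 ≤ I := integral_nonneg hf0
  have hsinh : 0 < Real.sinh (l / 8) := Real.sinh_pos_iff.2 (by linarith)
  -- The last two bounds on `δ` keep the discretisation error below `l / 4` for every `ε ≥ e₀`; the
  -- bound `δ ≤ e₀` keeps the near cells inside the ball of radius `2ε`.
  obtain ⟨δ, hδ, hδ1, hδ2, hδ3⟩ : ∃ δ : ℝ, 0 < δ ∧ δ ≤ e₀ ∧ δ ≤ l * e₀ / 32 ∧
      δ ≤ l * e₀ ^ 2 / (16 * (I + 1)) :=
    ⟨min e₀ (min (l * e₀ / 32) (l * e₀ ^ 2 / (16 * (I + 1)))), by positivity, min_le_left _ _,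
      (min_le_right _ _).trans (min_le_left _ _), (min_le_right _ _).trans (min_le_right _ _)⟩
  obtain ⟨S, hS, hτ⟩ := exists_finset_setIntegral_compl_lt hf hf0 hδ
    (show 0 < l * e₀ / 16 by positivity)
  set a : ℤ → ℝ := fun k => k * δ with ha
  set b : ℤ → ℝ := fun k => k * δ + (∫ η in gridCell δ k, f η) / 2 with hb
  have hwδ : ∀ k, ∫ η in gridCell δ k, f η ≤ δ := fun k =>
    (setIntegral_Ico_le hf hf1 (by linarith)).trans (by linarith)
  have hab : ∀ k ∈ S, a k < b k := fun k hk => by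
    have := hS k hk
    simp only [ha, hb]
    linarith
  have hbδ : ∀ k, b k < k * δ + δ := fun k => by
    have := hwδ k
    simp only [hb]
    linarith
  have hdisj : ∀ i ∈ S, ∀ j ∈ S, i ≠ j → b i < a j ∨ b j < a i := by
    intro i _ j _ hij
    rcases lt_or_gt_of_ne hij with h | h
    · left
      have h5 : (i : ℝ) + 1 ≤ j := by exact_mod_cast h
      have := hbδ i
      simp only [ha]
      nlinarith
    · right
      have h5 : (j : ℝ) + 1 ≤ i := by exact_mod_cast h
      have := hbδ j
      simp only [ha]
      nlinarith
  have hsumw : ∀ T : Finset ℤ, ∑ k ∈ T, (b k - a k) = (∫ η in ⋃ k ∈ T, gridCell δ k, f η) / 2 := by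
    intro T
    rw [integral_biUnion_finset _ (fun k _ => measurableSet_gridCell δ k)
      (fun k _ l _ hkl => pairwise_disjoint_gridCell hδ hkl) (fun k _ => hf.integrableOn),
      Finset.sum_div]
    exact Finset.sum_congr rfl fun k _ => by simp [ha, hb]
  set G : Set ℝ := {t | l / 8 < |logSum S a b t|} with hG
  set κ : ℝ≥0∞ := ENNReal.ofReal (1 / Real.sinh (l / 8)) with hκ
  set ν₀ : Measure ℝ := volume.restrict G +
    κ • volume.withDensity (fun η => ENNReal.ofReal (f η)) with hν₀
  have hdens : ∀ A, MeasurableSet A →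
      (κ • volume.withDensity (fun η => ENNReal.ofReal (f η))) A =
        ENNReal.ofReal ((∫ η in A, f η) / Real.sinh (l / 8)) := by
    intro A hA
    rw [Measure.smul_apply, withDensity_apply _ hA,
      ← ofReal_integral_eq_lintegral_ofReal hf.integrableOn (ae_of_all _ hf0), smul_eq_mul, hκ,
      ← ENNReal.ofReal_mul (by positivity)]
    congr 1
    ring
  have hνuniv : ν₀ univ ≤ ENNReal.ofReal (2 * (I / Real.sinh (l / 8))) := by
    have h1 : volume G ≤ ENNReal.ofReal (I / Real.sinh (l / 8)) := by
      refine (volume_lt_abs_logSum_le S a b hab hdisj (by linarith)).trans ?_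
      refine ENNReal.ofReal_le_ofReal ?_
      rw [hsumw, ← mul_div_assoc]
      have : ∫ η in ⋃ k ∈ S, gridCell δ k, f η ≤ I := setIntegral_le_integral hf (ae_of_all _ hf0)
      gcongr
      linarith
    rw [hν₀, Measure.add_apply, hdens _ MeasurableSet.univ, setIntegral_univ,
      Measure.restrict_apply_univ, two_mul, ENNReal.ofReal_add (by positivity) (by positivity)]
    gcongr
  have hmain : volume {s | ∃ ε, e₀ ≤ ε ∧ l < |truncHilbert f ε s|} ≤
      10 * ((2 : ℝ≥0∞) • ν₀) univ := by
    refine volume_le_of_forall_closedBall _ ?_ _ ?_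
    · rw [Measure.smul_apply, smul_eq_mul]
      exact ENNReal.mul_ne_top (by norm_num) (hνuniv.trans_lt ENNReal.ofReal_lt_top).ne
    rintro s ⟨ε, hε₀, hlt⟩
    have hε : 0 < ε := he₀.trans_le hε₀
    refine ⟨2 * ε, by positivity, ?_⟩
    set O := S.filter fun k => gridCell δ k ⊆ {η | ε < |s - η|} with hO
    set N := S.filter fun k => ¬ gridCell δ k ⊆ {η | ε < |s - η|} with hN
    have hOmem : ∀ k, k ∈ O ↔ k ∈ S ∧ gridCell δ k ⊆ {η | ε < |s - η|} := fun k =>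
      Finset.mem_filter
    have hsplit : ∀ x, logSum S a b x = logSum O a b x + logSum N a b x := fun x =>
      (Finset.sum_filter_add_sum_filter_not S _ _).symm
    have happrox := abs_truncHilbert_sub_logSum_le hf hf0 hf1 hδ hε S O hS hτ hOmem
    have herr : (l * e₀ / 16 + 2 * δ) / ε + 2 * I * (δ / ε ^ 2) ≤ l / 4 := by
      have h1 : (l * e₀ / 16 + 2 * δ) / ε ≤ l / 8 := by
        rw [div_le_iff₀ hε]
        nlinarith
      have h2 : 2 * I * (δ / ε ^ 2) ≤ l / 8 := by
        rw [← mul_div_assoc, div_le_iff₀ (by positivity)]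
        rw [le_div_iff₀ (by positivity)] at hδ3
        have : l * e₀ ^ 2 ≤ l * ε ^ 2 := by gcongr
        nlinarith
      linarith
    have happ := happrox.trans herr
    rw [abs_le] at happ
    have hanti : ∀ x y, s - ε ≤ x → x ≤ y → y ≤ s + ε → logSum O a b y ≤ logSum O a b x :=
      fun x y hx hxy hy => logSum_filter_antitone hab (fun k hk => ((hOmem k).1 hk).1)
        (fun k => rfl) (fun k _ => hbδ k) (fun k hk => ((hOmem k).1 hk).2) hε hx hxy hy
    -- Twice the decreasing far sum differs from `T_ε f(s)` by at most `l / 4`, so its modulus at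
    -- `s` exceeds `l / 4`. A large positive value persists to the left of `s`, a large negative one
    -- to the right.
    obtain ⟨H, hHvol, hHm, hHball, hHlt⟩ : ∃ H : Set ℝ, volume H = ENNReal.ofReal ε ∧
        MeasurableSet H ∧ H ⊆ Metric.closedBall s (2 * ε) ∧
        ∀ x ∈ H, l / 4 < |logSum O a b x| := by
      rcases lt_abs.1 hlt with h | h
      · refine ⟨Ioo (s - ε) s, by rw [Real.volume_Ioo]; congr 1; ring, measurableSet_Ioo, ?_, ?_⟩
        · intro x hx
          rw [Real.closedBall_eq_Icc]
          constructor <;> linarith [hx.1, hx.2]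
        · intro x hx
          have := hanti x s hx.1.le hx.2.le (by linarith)
          exact lt_abs.2 (Or.inl (by linarith [happ.1, happ.2]))
      · refine ⟨Ioo s (s + ε), by rw [Real.volume_Ioo]; congr 1; ring, measurableSet_Ioo, ?_, ?_⟩
        · intro x hx
          rw [Real.closedBall_eq_Icc]
          constructor <;> linarith [hx.1, hx.2]
        · intro x hx
          have := hanti s x (by linarith) hx.1.le hx.2.le
          exact lt_abs.2 (Or.inr (by linarith [happ.1, happ.2]))
    have hHsub : H ⊆ (Metric.closedBall s (2 * ε) ∩ G) ∪ {t | l / 8 < |logSum N a b t|} := by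
      intro x hx
      by_cases hxG : x ∈ G
      · exact Or.inl ⟨hHball hx, hxG⟩
      · right
        have h1 : |logSum S a b x| ≤ l / 8 := not_lt.1 hxG
        have h2 := hHlt x hx
        have h3 := abs_sub (logSum S a b x) (logSum N a b x)
        rw [hsplit x, add_sub_cancel_right, ← hsplit x] at h3
        show l / 8 < |logSum N a b x|
        linarith
    have hNball : (⋃ k ∈ N, gridCell δ k) ⊆ Metric.closedBall s (2 * ε) := by
      refine iUnion₂_subset fun k hk x hx => ?_
      obtain ⟨ζ, hζ, hζ'⟩ := not_subset.1 (Finset.mem_filter.1 hk).2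
      have hζ2 : |s - ζ| ≤ ε := not_lt.1 hζ'
      rw [abs_le] at hζ2
      rw [Real.closedBall_eq_Icc]
      have := hx.1; have := hx.2; have := hζ.1; have := hζ.2
      constructor <;> linarith
    have hNS : ∀ k ∈ N, k ∈ S := fun k hk => (Finset.mem_filter.1 hk).1
    have hNvol : volume {t | l / 8 < |logSum N a b t|} ≤
        ENNReal.ofReal ((∫ η in Metric.closedBall s (2 * ε), f η) / Real.sinh (l / 8)) := by
      refine (volume_lt_abs_logSum_le N a b (fun k hk => hab k (hNS k hk))
        (fun i hi j hj => hdisj i (hNS i hi) j (hNS j hj)) (by linarith)).trans ?_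
      refine ENNReal.ofReal_le_ofReal ?_
      rw [hsumw, ← mul_div_assoc]
      have : ∫ η in ⋃ k ∈ N, gridCell δ k, f η ≤ ∫ η in Metric.closedBall s (2 * ε), f η :=
        setIntegral_mono_set hf.integrableOn (ae_of_all _ hf0) hNball.eventuallyLE
      gcongr
      linarith
    have hfinal : ENNReal.ofReal ε ≤ ν₀ (Metric.closedBall s (2 * ε)) := by
      rw [hν₀, Measure.add_apply, hdens _ Metric.isClosed_closedBall.measurableSet,
        Measure.restrict_apply Metric.isClosed_closedBall.measurableSet, ← hHvol]
      exact (measure_mono hHsub).trans ((measure_union_le _ _).trans (add_le_add le_rfl hNvol))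
    rw [ENNReal.ofReal_mul (by norm_num), ENNReal.ofReal_ofNat, Measure.smul_apply, smul_eq_mul]
    gcongr
  -- The constant is `40 = 10 · 2 · 2`: the covering lemma, the radius `2ε` against the length `ε`,
  -- and the two parts of `ν₀`.
  refine hmain.trans ?_
  rw [Measure.smul_apply, smul_eq_mul]
  calc 10 * (2 * ν₀ univ) ≤ 10 * (2 * ENNReal.ofReal (2 * (I / Real.sinh (l / 8)))) := by gcongr
    _ = _ := by
      rw [← ENNReal.ofReal_ofNat 10, ← ENNReal.ofReal_ofNat 2, ← ENNReal.ofReal_mul (by norm_num),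
        ← ENNReal.ofReal_mul (by norm_num)]
      congr 1
      ring

/-! ### Linearity and continuity of truncations, and the maximal operator -/

theorem truncHilbert_sub {f g : ℝ → ℝ} (hf : Integrable f) (hg : Integrable g) {ε : ℝ} (hε : 0 < ε)
    (s : ℝ) : truncHilbert (fun η => f η - g η) ε s = truncHilbert f ε s - truncHilbert g ε s := by
  rw [truncHilbert, truncHilbert, truncHilbert,
    ← integral_sub (integrableOn_div_sub hf hε s) (integrableOn_div_sub hg hε s)]
  simp only [sub_div]

theorem truncHilbert_const_mul (c : ℝ) (f : ℝ → ℝ) (ε s : ℝ) :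
    truncHilbert (fun η => c * f η) ε s = c * truncHilbert f ε s := by
  rw [truncHilbert, truncHilbert, ← integral_const_mul]
  simp only [mul_div_assoc]

/-- For fixed `s₀` the truncated kernel jumps only at the two points `η = s₀ ± ε`, so dominated
convergence applies. Continuity makes the uncountable supremum `maxHilbert` lower semicontinuous,
hence measurable. -/
theorem continuous_truncHilbert {f : ℝ → ℝ} (hf : Integrable f) {ε : ℝ} (hε : 0 < ε) :
    Continuous (truncHilbert f ε) := by
  have heq : truncHilbert f ε =
      fun s => ∫ η, {η : ℝ | ε < |s - η|}.indicator (fun η => f η / (s - η)) η := by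
    ext s
    rw [integral_indicator (measurableSet_far ε s), truncHilbert]
  rw [heq, continuous_iff_continuousAt]
  intro s₀
  refine continuousAt_of_dominated (bound := fun η => ‖f η‖ / ε) ?_ ?_ (hf.norm.div_const ε) ?_
  · exact Eventually.of_forall fun s =>
      ((integrableOn_div_sub hf hε s).integrable_indicator
        (measurableSet_far ε s)).aestronglyMeasurable
  · refine Eventually.of_forall fun s => ae_of_all _ fun η => ?_
    by_cases h : η ∈ {η : ℝ | ε < |s - η|}
    · rw [indicator_of_mem h, norm_div]
      exact div_le_div_of_nonneg_left (norm_nonneg _) hε (le_of_lt h)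
    · rw [indicator_of_notMem h, norm_zero]
      positivity
  · have hnull : volume ({s₀ - ε, s₀ + ε} : Set ℝ) = 0 := (Set.toFinite _).measure_zero _
    filter_upwards [measure_eq_zero_iff_ae_notMem.1 hnull] with η hη
    have hne : |s₀ - η| ≠ ε := by
      intro h
      apply hη
      rcases eq_or_eq_neg_of_abs_eq h with h | h
      · left; linarith
      · right; show η = s₀ + ε; linarith
    have hc : ContinuousAt (fun s => |s - η|) s₀ := by fun_prop
    rcases lt_or_gt_of_ne hne with h | h
    · have hev : ∀ᶠ s in 𝓝 s₀, {η : ℝ | ε < |s - η|}.indicator (fun η => f η / (s - η)) η = 0 := by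
        filter_upwards [hc.eventually_lt_const h] with s hs
        exact indicator_of_notMem (show η ∉ {η : ℝ | ε < |s - η|} from not_lt.2 (le_of_lt hs)) _
      exact continuousAt_const.congr (EventuallyEq.symm hev)
    · have hev : ∀ᶠ s in 𝓝 s₀, {η : ℝ | ε < |s - η|}.indicator (fun η => f η / (s - η)) η =
          f η / (s - η) := by
        filter_upwards [hc.eventually_const_lt h] with s hs
        exact indicator_of_mem (show η ∈ {η : ℝ | ε < |s - η|} from hs) _
      have h0 : s₀ - η ≠ 0 := abs_pos.1 (hε.trans h)
      have hcd : ContinuousAt (fun s => f η / (s - η)) s₀ :=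
        continuousAt_const.div (by fun_prop) h0
      exact hcd.congr (EventuallyEq.symm hev)

/-- The maximal truncated Hilbert transform. -/
def maxHilbert (f : ℝ → ℝ) (s : ℝ) : ℝ≥0∞ :=
  ⨆ ε : Ioi (0 : ℝ), ‖truncHilbert f ε s‖ₑ

theorem enorm_truncHilbert_le_maxHilbert (f : ℝ → ℝ) {ε : ℝ} (hε : 0 < ε) (s : ℝ) :
    ‖truncHilbert f ε s‖ₑ ≤ maxHilbert f s :=
  le_iSup (fun ε : Ioi (0 : ℝ) => ‖truncHilbert f ε s‖ₑ) ⟨ε, hε⟩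

theorem measurable_maxHilbert {f : ℝ → ℝ} (hf : Integrable f) : Measurable (maxHilbert f) :=
  (lowerSemicontinuous_iSup fun ε : Ioi (0 : ℝ) =>
    (continuous_truncHilbert hf ε.2).enorm.lowerSemicontinuous).measurable

theorem ofReal_lt_maxHilbert_iff {f : ℝ → ℝ} {l s : ℝ} :
    ENNReal.ofReal l < maxHilbert f s ↔ ∃ ε, 0 < ε ∧ ENNReal.ofReal l < ‖truncHilbert f ε s‖ₑ := by
  simp only [maxHilbert, lt_iSup_iff, Subtype.exists, mem_Ioi, exists_prop]

theorem volume_lt_maxHilbert_le_of_forall {f : ℝ → ℝ} {l : ℝ} (hl : 0 < l) {C : ℝ≥0∞}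
    (h : ∀ e₀ : ℝ, 0 < e₀ → volume {s | ∃ ε, e₀ ≤ ε ∧ l < |truncHilbert f ε s|} ≤ C) :
    volume {s | ENNReal.ofReal l < maxHilbert f s} ≤ C := by
  have hU : {s | ENNReal.ofReal l < maxHilbert f s} ⊆
      ⋃ n : ℕ, {s | ∃ ε, 1 / ((n : ℝ) + 1) ≤ ε ∧ l < |truncHilbert f ε s|} := by
    intro s hs
    obtain ⟨ε, hε, hlt⟩ := ofReal_lt_maxHilbert_iff.1 hs
    obtain ⟨n, hn⟩ := exists_nat_one_div_lt hε
    refine mem_iUnion.2 ⟨n, ε, hn.le, ?_⟩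
    rwa [Real.enorm_eq_ofReal_abs, ENNReal.ofReal_lt_ofReal_iff_of_nonneg hl.le] at hlt
  have hmono : Monotone fun n : ℕ =>
      {s | ∃ ε, 1 / ((n : ℝ) + 1) ≤ ε ∧ l < |truncHilbert f ε s|} := by
    rintro n m hnm s ⟨ε, h1, h2⟩
    refine ⟨ε, le_trans ?_ h1, h2⟩
    have : (n : ℝ) ≤ m := by exact_mod_cast hnm
    exact one_div_le_one_div_of_le (by positivity) (by linarith)
  refine (measure_mono hU).trans ?_
  rw [hmono.measure_iUnion]
  exact iSup_le fun n => h _ (by positivity)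

/-- The maximal inequality for functions with values in `[-B, B]`. -/
theorem volume_lt_maxHilbert_le {f : ℝ → ℝ} (hf : Integrable f) {B : ℝ} (hB : 0 < B)
    (hfB : ∀ η, |f η| ≤ B) {l : ℝ} (hl : 0 < l) :
    volume {s | ENNReal.ofReal l < maxHilbert f s} ≤
      ENNReal.ofReal (40 * ((∫ η, |f η|) / B / Real.sinh (l / (16 * B)))) := by
  refine volume_lt_maxHilbert_le_of_forall hl fun e₀ he₀ => ?_
  set p : ℝ → ℝ := fun η => max (f η) 0 / B with hp
  set q : ℝ → ℝ := fun η => max (-f η) 0 / B with hq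
  have hpi : Integrable p := hf.pos_part.div_const B
  have hqi : Integrable q := hf.neg_part.div_const B
  have hp0 : ∀ η, 0 ≤ p η := fun η => by positivity
  have hq0 : ∀ η, 0 ≤ q η := fun η => by positivity
  have hp1 : ∀ η, p η ≤ 1 := fun η => (div_le_one hB).2
    (max_le ((le_abs_self _).trans (hfB η)) hB.le)
  have hq1 : ∀ η, q η ≤ 1 := fun η => (div_le_one hB).2
    (max_le ((neg_le_abs _).trans (hfB η)) hB.le)
  have hfpq : ∀ ε > 0, ∀ s, truncHilbert f ε s = B * (truncHilbert p ε s - truncHilbert q ε s) := by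
    intro ε hε s
    rw [← truncHilbert_sub hpi hqi hε, ← truncHilbert_const_mul]
    congr 1
    ext η
    rw [hp, hq, ← sub_div, mul_div_cancel₀ _ hB.ne',
      max_zero_sub_max_neg_zero_eq_self]
  -- Positive and negative parts, divided by `B`, share the level equally; `l / (2B)` divided by `8`
  -- gives the argument `l / (16B)` of `sinh`.
  have hl' : 0 < l / (2 * B) := by positivity
  have hsub : {s | ∃ ε, e₀ ≤ ε ∧ l < |truncHilbert f ε s|} ⊆
      {s | ∃ ε, e₀ ≤ ε ∧ l / (2 * B) < |truncHilbert p ε s|} ∪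
      {s | ∃ ε, e₀ ≤ ε ∧ l / (2 * B) < |truncHilbert q ε s|} := by
    rintro s ⟨ε, hε, hlt⟩
    rw [hfpq ε (he₀.trans_le hε), abs_mul, abs_of_pos hB] at hlt
    by_contra hcon
    simp only [mem_union, not_or] at hcon
    have h1 : |truncHilbert p ε s| ≤ l / (2 * B) := not_lt.1 fun h => hcon.1 ⟨ε, hε, h⟩
    have h2 : |truncHilbert q ε s| ≤ l / (2 * B) := not_lt.1 fun h => hcon.2 ⟨ε, hε, h⟩
    have h3 := abs_sub (truncHilbert p ε s) (truncHilbert q ε s)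
    have h4 : B * (l / (2 * B) + l / (2 * B)) = l := by field_simp; ring
    have h5 : B * |truncHilbert p ε s - truncHilbert q ε s| ≤ B * (l / (2 * B) + l / (2 * B)) := by
      gcongr
      linarith
    linarith
  have e1 := volume_exists_lt_abs_truncHilbert_le hpi hp0 hp1 hl' he₀
  have e2 := volume_exists_lt_abs_truncHilbert_le hqi hq0 hq1 hl' he₀
  rw [show l / (2 * B) / 8 = l / (16 * B) by field_simp; norm_num] at e1 e2
  have hsinh : 0 < Real.sinh (l / (16 * B)) := Real.sinh_pos_iff.2 (by positivity)
  refine (measure_mono hsub).trans ((measure_union_le _ _).trans ((add_le_add e1 e2).trans ?_))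
  have hp2 : 0 ≤ ∫ η, p η := integral_nonneg hp0
  have hq2 : 0 ≤ ∫ η, q η := integral_nonneg hq0
  rw [← ENNReal.ofReal_add (by positivity) (by positivity), ← mul_add, ← add_div,
    ← integral_add hpi hqi]
  have habs : ∀ η, p η + q η = |f η| / B := fun η => by
    rw [hp, hq, ← add_div, max_zero_add_max_neg_zero_eq_abs_self]
  simp only [habs, integral_div, le_refl]

/-- The maximal truncated Hilbert transform is of weak type `(1, 1)` on bounded functions. -/
theorem volume_lt_maxHilbert_le_div {f : ℝ → ℝ} (hf : Integrable f) {B : ℝ} (hB : 0 < B)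
    (hfB : ∀ η, |f η| ≤ B) {l : ℝ} (hl : 0 < l) :
    volume {s | ENNReal.ofReal l < maxHilbert f s} ≤
      ENNReal.ofReal (640 * (∫ η, |f η|) / l) := by
  refine (volume_lt_maxHilbert_le hf hB hfB hl).trans (ENNReal.ofReal_le_ofReal ?_)
  have h0 : 0 < l / (16 * B) := by positivity
  have h1 : l / (16 * B) ≤ Real.sinh (l / (16 * B)) := Real.self_le_sinh_iff.2 h0.le
  have h2 : 0 ≤ ∫ η, |f η| := integral_nonneg fun η => abs_nonneg _
  calc 40 * ((∫ η, |f η|) / B / Real.sinh (l / (16 * B)))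
      ≤ 40 * ((∫ η, |f η|) / B / (l / (16 * B))) := by gcongr
    _ = _ := by field_simp; ring

/-! ### Almost everywhere existence of principal values -/

theorem integral_truncated_inv_eq_zero (ε s : ℝ) :
    ∫ η, {η : ℝ | ε < |s - η| ∧ |s - η| ≤ 1}.indicator (fun η => 1 / (s - η)) η = 0 := by
  set F : ℝ → ℝ := {u : ℝ | ε < |u| ∧ |u| ≤ 1}.indicator fun u => 1 / u with hF
  have h1 : ∫ η, {η : ℝ | ε < |s - η| ∧ |s - η| ≤ 1}.indicator (fun η => 1 / (s - η)) η =
      ∫ u, F u := by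
    rw [← integral_sub_left_eq_self F volume s]
    rfl
  have h2 : ∫ u, F u = ∫ u, -F u := by
    rw [← integral_neg_eq_self F]
    congr 1
    ext u
    by_cases h : ε < |u| ∧ |u| ≤ 1
    · rw [hF, indicator_of_mem (show u ∈ {u : ℝ | ε < |u| ∧ |u| ≤ 1} from h),
        indicator_of_mem (show -u ∈ {u : ℝ | ε < |u| ∧ |u| ≤ 1} by simpa using h)]
      rw [one_div, one_div, inv_neg]
    · rw [hF, indicator_of_notMem (show u ∉ {u : ℝ | ε < |u| ∧ |u| ≤ 1} from h),
        indicator_of_notMem (show -u ∉ {u : ℝ | ε < |u| ∧ |u| ≤ 1} by simpa using h), neg_zero]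
  rw [integral_neg] at h2
  rw [h1]
  linarith

/-- Subtracting `g(s) / (s - η)` on `|s - η| ≤ 1` does not change the truncated integrals, because
the kernel is odd about `s`. What remains is integrable since `g` is Lipschitz, and dominated
convergence gives the limit. -/
theorem tendsto_truncHilbert_of_contDiff {g : ℝ → ℝ} (hg : ContDiff ℝ 1 g)
    (hgc : HasCompactSupport g) (s : ℝ) :
    ∃ L, Tendsto (fun ε => truncHilbert g ε s) (𝓝[>] 0) (𝓝 L) := by
  obtain ⟨K, hK⟩ := hg.lipschitzWith_of_hasCompactSupport hgc one_ne_zero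
  have hgi : Integrable g := hg.continuous.integrable_of_hasCompactSupport hgc
  set h : ℝ → ℝ := fun η => g η / (s - η) -
    g s * {η : ℝ | |s - η| ≤ 1}.indicator (fun η => 1 / (s - η)) η with hh
  have hm1 : MeasurableSet {η : ℝ | |s - η| ≤ 1} := measurableSet_le (by fun_prop) measurable_const
  have hmeas : AEStronglyMeasurable h volume := by
    refine Measurable.aestronglyMeasurable ?_
    exact (hg.continuous.measurable.div (by fun_prop)).sub
      (((by fun_prop : Measurable fun η : ℝ => 1 / (s - η)).indicator hm1).const_mul _)
  have hbound : ∀ η, ‖h η‖ ≤ {η : ℝ | |s - η| ≤ 1}.indicator (fun _ => (K : ℝ)) η + ‖g η‖ := by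
    intro η
    by_cases hη : |s - η| ≤ 1
    · have e : h η = (g η - g s) / (s - η) := by
        simp only [hh]
        rw [indicator_of_mem (show η ∈ {η : ℝ | |s - η| ≤ 1} from hη)]
        ring
      rw [indicator_of_mem (show η ∈ {η : ℝ | |s - η| ≤ 1} from hη), e, norm_div]
      have e2 := hK.dist_le_mul η s
      rw [Real.dist_eq, Real.dist_eq, abs_sub_comm η s] at e2
      have e3 : ‖g η - g s‖ / ‖s - η‖ ≤ K := div_le_of_le_mul₀ (norm_nonneg _) K.2 e2
      linarith [norm_nonneg (g η)]
    · have e : h η = g η / (s - η) := by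
        simp only [hh]
        rw [indicator_of_notMem (show η ∉ {η : ℝ | |s - η| ≤ 1} from hη)]
        ring
      rw [indicator_of_notMem (show η ∉ {η : ℝ | |s - η| ≤ 1} from hη), e, norm_div, zero_add]
      exact div_le_self (norm_nonneg _) (not_le.1 hη).le
  have hint : Integrable h := by
    refine Integrable.mono' (Integrable.add ?_ hgi.norm) hmeas (ae_of_all _ hbound)
    refine (integrable_indicator_iff hm1).2 (integrableOn_const ?_)
    refine ((measure_mono ?_).trans_lt (measure_Icc_lt_top (a := s - 1) (b := s + 1))).ne
    intro η hη
    have hη' : |s - η| ≤ 1 := hη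
    rw [abs_le] at hη'
    constructor <;> linarith [hη'.1, hη'.2]
  refine ⟨∫ η, h η, ?_⟩
  have heq : ∀ ε > 0, truncHilbert g ε s = ∫ η, {η : ℝ | ε < |s - η|}.indicator h η := by
    intro ε hε
    have e1 : (fun η => {η : ℝ | ε < |s - η|}.indicator h η) =
        fun η => {η : ℝ | ε < |s - η|}.indicator (fun η => g η / (s - η)) η -
          g s * {η : ℝ | ε < |s - η| ∧ |s - η| ≤ 1}.indicator (fun η => 1 / (s - η)) η := by
      ext η
      by_cases h1 : ε < |s - η| <;> by_cases h2 : |s - η| ≤ 1 <;>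
        simp [Set.indicator, hh, h1, h2]
    have hset : {η : ℝ | ε < |s - η| ∧ |s - η| ≤ 1} ⊆ Icc (s - 1) (s + 1) := by
      intro η hη
      have hη' := abs_le.1 hη.2
      constructor <;> linarith [hη'.1, hη'.2]
    have hm2 : MeasurableSet {η : ℝ | ε < |s - η| ∧ |s - η| ≤ 1} := (measurableSet_far ε s).inter hm1
    have e2 : Integrable
        ({η : ℝ | ε < |s - η| ∧ |s - η| ≤ 1}.indicator (fun η => 1 / (s - η))) := by
      rw [integrable_indicator_iff hm2]
      refine Measure.integrableOn_of_bounded (M := 1 / ε)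
        ((measure_mono hset).trans_lt measure_Icc_lt_top).ne
        (by fun_prop : Measurable fun η : ℝ => 1 / (s - η)).aestronglyMeasurable ?_
      filter_upwards [ae_restrict_mem hm2] with η hη
      rw [norm_div, norm_one]
      exact one_div_le_one_div_of_le hε hη.1.le
    rw [e1, integral_sub ((integrable_indicator_iff (measurableSet_far ε s)).2
      (integrableOn_div_sub hgi hε s)) (e2.const_mul _), integral_const_mul,
      integral_truncated_inv_eq_zero, mul_zero, sub_zero,
      integral_indicator (measurableSet_far ε s), truncHilbert]
  have hlim : Tendsto (fun ε => ∫ η, {η : ℝ | ε < |s - η|}.indicator h η) (𝓝[>] 0)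
      (𝓝 (∫ η, h η)) := by
    refine tendsto_integral_filter_of_dominated_convergence (fun η => ‖h η‖) ?_ ?_ hint.norm ?_
    · exact Eventually.of_forall fun ε => hmeas.indicator (measurableSet_far ε s)
    · exact Eventually.of_forall fun ε => ae_of_all _ fun η => norm_indicator_le_norm_self _ _
    · filter_upwards [measure_eq_zero_iff_ae_notMem.1 (measure_singleton (μ := volume) s)] with η hη
      have h0 : 0 < |s - η| := abs_pos.2 (sub_ne_zero.2 (Ne.symm hη))
      refine tendsto_const_nhds.congr' ?_
      filter_upwards [Ioo_mem_nhdsGT h0] with ε hε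
      exact (indicator_of_mem (show η ∈ {η : ℝ | ε < |s - η|} from hε.2) _).symm
  refine hlim.congr' ?_
  filter_upwards [self_mem_nhdsWithin] with ε hε
  exact (heq ε hε).symm

/-- For smooth compactly supported `g` the limit exists everywhere, and the weak type bound for `f -
g` shows that the oscillation of the truncations of `f` exceeds any fixed level only on sets of
arbitrarily small measure. -/
theorem ae_exists_tendsto_truncHilbert {f : ℝ → ℝ} (hf : Integrable f) {B : ℝ}
    (hfB : ∀ η, |f η| ≤ B) :
    ∀ᵐ s, ∃ L, Tendsto (fun ε => truncHilbert f ε s) (𝓝[>] 0) (𝓝 L) := by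
  have key : ∀ l : ℝ, 0 < l → ∀ᵐ s, ∃ δ > 0, ∀ ε ∈ Ioo 0 δ, ∀ ε' ∈ Ioo 0 δ,
      |truncHilbert f ε s - truncHilbert f ε' s| < 3 * l := by
    intro l hl
    rw [ae_iff]
    refine le_antisymm (ENNReal.le_of_forall_pos_le_add fun τ hτ _ => ?_) zero_le
    rw [zero_add]
    -- With this accuracy in `L¹` the weak type bound `640 ‖f - g‖₁ / l` is at most `τ`.
    have hτ' : (0 : ℝ) < τ * l / 640 := by positivity
    obtain ⟨g, hgc, hg, hfg⟩ := (memLp_one_iff_integrable.2 hf).exist_eLpNorm_sub_le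
      ENNReal.one_ne_top le_rfl hτ'
    have hgi : Integrable g := hg.continuous.integrable_of_hasCompactSupport hgc
    obtain ⟨D, hD⟩ := hgc.exists_bound_of_continuous hg.continuous
    have hfgi : Integrable fun η => f η - g η := hf.sub hgi
    have hB0 : 0 ≤ B := (abs_nonneg _).trans (hfB 0)
    have hD0 : 0 ≤ D := (norm_nonneg _).trans (hD 0)
    have hbd : ∀ η, |f η - g η| ≤ B + D + 1 := fun η => by
      have := hD η
      rw [Real.norm_eq_abs] at this
      linarith [abs_sub (f η) (g η), hfB η]
    have hweak := volume_lt_maxHilbert_le_div hfgi (by linarith) hbd hl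
    have hnorm : ∫ η, |f η - g η| ≤ τ * l / 640 := by
      rw [eLpNorm_one_eq_lintegral_enorm] at hfg
      have := integral_norm_eq_lintegral_enorm hfgi.aestronglyMeasurable
      simp only [Real.norm_eq_abs] at this
      rw [this]
      exact ENNReal.toReal_le_of_le_ofReal hτ'.le hfg
    refine (measure_mono ?_).trans (hweak.trans ?_)
    · intro s hs
      by_contra hcon
      have hM : maxHilbert (fun η => f η - g η) s ≤ ENNReal.ofReal l := not_lt.1 hcon
      refine hs ?_
      obtain ⟨L, hL⟩ := tendsto_truncHilbert_of_contDiff (hg.of_le (by norm_cast)) hgc s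
      have hev := hL.eventually (Metric.ball_mem_nhds L (by positivity : 0 < l / 2))
      obtain ⟨δ, hδ, hδ'⟩ := (mem_nhdsGT_iff_exists_Ioo_subset).1 hev
      refine ⟨δ, hδ, fun ε hε ε' hε' => ?_⟩
      have h1 : ∀ ε ∈ Ioo 0 δ, |truncHilbert g ε s - L| < l / 2 := fun ε hε => hδ' hε
      have h2 : ∀ ε ∈ Ioo 0 δ, |truncHilbert f ε s - truncHilbert g ε s| ≤ l := by
        intro ε hε
        rw [← truncHilbert_sub hf hgi hε.1]
        have := (enorm_truncHilbert_le_maxHilbert (fun η => f η - g η) hε.1 s).trans hM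
        rwa [Real.enorm_eq_ofReal_abs, ENNReal.ofReal_le_ofReal_iff hl.le] at this
      have a1 := abs_lt.1 (h1 ε hε)
      have a2 := abs_lt.1 (h1 ε' hε')
      have a3 := abs_le.1 (h2 ε hε)
      have a4 := abs_le.1 (h2 ε' hε')
      rw [abs_lt]
      constructor <;> linarith [a1.1, a1.2, a2.1, a2.2, a3.1, a3.2, a4.1, a4.2]
    · rw [← ENNReal.ofReal_coe_nnreal]
      refine ENNReal.ofReal_le_ofReal ?_
      rw [div_le_iff₀ hl]
      linarith
  have key' : ∀ᵐ s, ∀ n : ℕ, ∃ δ > 0, ∀ ε ∈ Ioo 0 δ, ∀ ε' ∈ Ioo 0 δ,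
      |truncHilbert f ε s - truncHilbert f ε' s| < 3 * (1 / ((n : ℝ) + 1)) :=
    ae_all_iff.2 fun n => key _ (by positivity)
  filter_upwards [key'] with s hs
  refine cauchy_map_iff_exists_tendsto.1 (Metric.cauchy_iff.2 ⟨inferInstance, fun r hr => ?_⟩)
  obtain ⟨n, hn⟩ := exists_nat_one_div_lt (show 0 < r / 3 by positivity)
  obtain ⟨δ, hδ, h⟩ := hs n
  refine ⟨_, image_mem_map (Ioo_mem_nhdsGT hδ), ?_⟩
  rintro _ ⟨ε, hε, rfl⟩ _ ⟨ε', hε', rfl⟩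
  rw [Real.dist_eq]
  linarith [h ε hε ε' hε']

/-! ### Layer cake formulas -/

section LayerCake

variable {α : Type*} [MeasurableSpace α]

/-- The distribution function of a function with values in `[0, ∞]`. -/
def distrib (m : Measure α) (f : α → ℝ≥0∞) (s : ℝ) : ℝ≥0∞ := m {a | ENNReal.ofReal s < f a}

theorem distrib_antitone (m : Measure α) (f : α → ℝ≥0∞) : Antitone (distrib m f) := fun _ _ hst =>
  measure_mono fun _ ha => (ENNReal.ofReal_le_ofReal hst).trans_lt ha

theorem distrib_mono_ae {m : Measure α} {f g : α → ℝ≥0∞} (h : ∀ᵐ a ∂m, f a ≤ g a) (s : ℝ) :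
    distrib m f s ≤ distrib m g s :=
  measure_mono_ae (h.mono fun _ ha h' => lt_of_lt_of_le h' ha)

theorem lintegral_eq_lintegral_distrib (m : Measure α) {f : α → ℝ≥0∞} (hf : AEMeasurable f m) :
    ∫⁻ a, f a ∂m = ∫⁻ s in Ioi (0 : ℝ), distrib m f s := by
  by_cases htop : m {a | f a = ∞} = 0
  · have hae : ∀ᵐ a ∂m, f a ≠ ∞ := by simpa [ae_iff] using htop
    have h1 := lintegral_eq_lintegral_meas_lt m (f := fun a => (f a).toReal)
      (ae_of_all _ fun a => ENNReal.toReal_nonneg) hf.ennreal_toReal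
    have h2 : ∫⁻ a, f a ∂m = ∫⁻ a, ENNReal.ofReal (f a).toReal ∂m :=
      lintegral_congr_ae (hae.mono fun a ha => (ENNReal.ofReal_toReal ha).symm)
    rw [h2, h1]
    refine setLIntegral_congr_fun measurableSet_Ioi fun s hs => measure_congr ?_
    filter_upwards [hae] with a ha
    exact propext (ENNReal.ofReal_lt_iff_lt_toReal (le_of_lt hs) ha).symm
  · rw [lintegral_eq_top_of_measure_eq_top_ne_zero hf htop, eq_comm, ← top_le_iff]
    calc (∞ : ℝ≥0∞) = ∫⁻ s in Ioi (0 : ℝ), m {a | f a = ∞} := by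
          rw [setLIntegral_const, Real.volume_Ioi, ENNReal.mul_top htop]
      _ ≤ _ := lintegral_mono fun s => measure_mono fun a ha => by
          show _ < f a
          rw [show f a = ∞ from ha]
          exact ENNReal.ofReal_lt_top

theorem setLIntegral_Ioi_comp_add (h : ℝ → ℝ≥0∞) (c : ℝ) :
    ∫⁻ s in Ioi (0 : ℝ), h (s + c) = ∫⁻ s in Ioi c, h s := by
  rw [← lintegral_indicator measurableSet_Ioi, ← lintegral_indicator measurableSet_Ioi,
    ← lintegral_add_right_eq_self ((Ioi c).indicator h) c]
  refine lintegral_congr fun s => ?_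
  simp [Set.indicator]

theorem lintegral_tsub_eq (m : Measure α) {f : α → ℝ≥0∞} (hf : AEMeasurable f m) {c : ℝ}
    (hc : 0 ≤ c) :
    ∫⁻ a, (f a - ENNReal.ofReal c) ∂m = ∫⁻ s in Ioi c, distrib m f s := by
  rw [lintegral_eq_lintegral_distrib m (hf.sub_const _), ← setLIntegral_Ioi_comp_add (distrib m f) c]
  refine setLIntegral_congr_fun measurableSet_Ioi fun s hs => ?_
  simp only [distrib, lt_tsub_iff_right, ENNReal.ofReal_add (le_of_lt hs) hc]

/-- The minimum is bounded by `r` below the height `c` and by the distribution function above it.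
With the next lemma this shows that `∫ min(d_f, r)` is the minimum of the right side over `c`, the
`K`-functional of `(L¹, L^∞)`. -/
theorem lintegral_min_distrib_le (m : Measure α) {f : α → ℝ≥0∞} (hf : AEMeasurable f m) {c : ℝ}
    (hc : 0 ≤ c) (r : ℝ≥0∞) :
    ∫⁻ s in Ioi (0 : ℝ), min (distrib m f s) r ≤
      ∫⁻ a, (f a - ENNReal.ofReal c) ∂m + r * ENNReal.ofReal c := by
  rw [lintegral_tsub_eq m hf hc, ← Ioc_union_Ioi_eq_Ioi hc, add_comm]
  refine (lintegral_union_le _ _ _).trans (add_le_add ?_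
    (lintegral_mono fun s => min_le_left (distrib m f s) r))
  refine (lintegral_mono fun s => min_le_right (distrib m f s) r).trans_eq ?_
  rw [setLIntegral_const, Real.volume_Ioc, sub_zero]

/-- The optimal height is `c = inf {s ≥ 0 | d_f(s) ≤ r}`: the distribution function exceeds `r`
before `c` and is at most `r` after it. If there were no such `s`, the integrand would equal `r`
everywhere and the integral would be infinite. -/
theorem exists_lintegral_min_distrib_eq (m : Measure α) {f : α → ℝ≥0∞} (hf : AEMeasurable f m)
    {r : ℝ≥0∞} (hr : r ≠ 0) (hfin : ∫⁻ s in Ioi (0 : ℝ), min (distrib m f s) r ≠ ∞) :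
    ∃ c : ℝ, 0 ≤ c ∧ ∫⁻ a, (f a - ENNReal.ofReal c) ∂m + r * ENNReal.ofReal c ≤
      ∫⁻ s in Ioi (0 : ℝ), min (distrib m f s) r := by
  set A : Set ℝ := {s | 0 ≤ s ∧ distrib m f s ≤ r} with hA
  have hbdd : BddBelow A := ⟨0, fun s hs => hs.1⟩
  have hne : A.Nonempty := by
    by_contra hE
    rw [not_nonempty_iff_eq_empty] at hE
    apply hfin
    rw [← top_le_iff]
    calc (∞ : ℝ≥0∞) = ∫⁻ s in Ioi (0 : ℝ), r := by
          rw [setLIntegral_const, Real.volume_Ioi, ENNReal.mul_top hr]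
      _ ≤ _ := setLIntegral_mono' measurableSet_Ioi fun s hs => by
          refine le_min (le_of_lt (not_le.1 fun h => ?_)) le_rfl
          have : s ∈ A := ⟨le_of_lt hs, h⟩
          rw [hE] at this
          exact this
  refine ⟨sInf A, le_csInf hne fun s hs => hs.1, ?_⟩
  have hc : 0 ≤ sInf A := le_csInf hne fun s hs => hs.1
  rw [lintegral_tsub_eq m hf hc, ← Ioc_union_Ioi_eq_Ioi hc,
    lintegral_union measurableSet_Ioi (Set.Ioc_disjoint_Ioi le_rfl), add_comm]
  refine add_le_add ?_ ?_
  · rw [setLIntegral_congr Ioo_ae_eq_Ioc.symm]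
    calc r * ENNReal.ofReal (sInf A) = ∫⁻ s in Ioo 0 (sInf A), r := by
          rw [setLIntegral_const, Real.volume_Ioo, sub_zero]
      _ ≤ _ := setLIntegral_mono' measurableSet_Ioo fun s hs => by
          refine le_min (le_of_lt (not_le.1 fun h => ?_)) le_rfl
          exact absurd (csInf_le hbdd (show s ∈ A from ⟨hs.1.le, h⟩)) (not_le.2 hs.2)
  · refine setLIntegral_mono' measurableSet_Ioi fun s hs => le_min le_rfl ?_
    obtain ⟨t, ht, hts⟩ := exists_lt_of_csInf_lt hne hs
    exact (distrib_antitone m f hts.le).trans ht.2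

/-- Use the sum of the heights that are optimal for `f` and `g`, together with `(f + g - c - d)₊ ≤
(f - c)₊ + (g - d)₊`. -/
theorem lintegral_min_distrib_add_le (m : Measure α) {f g : α → ℝ≥0∞} (hf : AEMeasurable f m)
    (hg : AEMeasurable g m) (r : ℝ≥0∞) :
    ∫⁻ s in Ioi (0 : ℝ), min (distrib m (fun a => f a + g a) s) r ≤
      (∫⁻ s in Ioi (0 : ℝ), min (distrib m f s) r) +
        ∫⁻ s in Ioi (0 : ℝ), min (distrib m g s) r := by
  rcases eq_or_ne r 0 with rfl | hr
  · simp
  by_cases hf' : ∫⁻ s in Ioi (0 : ℝ), min (distrib m f s) r = ∞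
  · rw [hf', top_add]; exact le_top
  by_cases hg' : ∫⁻ s in Ioi (0 : ℝ), min (distrib m g s) r = ∞
  · rw [hg', add_top]; exact le_top
  obtain ⟨c, hc, hc'⟩ := exists_lintegral_min_distrib_eq m hf hr hf'
  obtain ⟨d, hd, hd'⟩ := exists_lintegral_min_distrib_eq m hg hr hg'
  refine (lintegral_min_distrib_le m (hf.add hg) (add_nonneg hc hd) r).trans ?_
  refine le_trans ?_ (add_le_add hc' hd')
  have h1 : ∫⁻ a, (f a + g a - ENNReal.ofReal (c + d)) ∂m ≤
      ∫⁻ a, (f a - ENNReal.ofReal c) ∂m + ∫⁻ a, (g a - ENNReal.ofReal d) ∂m := by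
    rw [← lintegral_add_left' (hf.sub_const _)]
    refine lintegral_mono fun a => ?_
    rw [ENNReal.ofReal_add hc hd]
    exact add_tsub_add_le_tsub_add_tsub
  calc _ ≤ ∫⁻ a, (f a - ENNReal.ofReal c) ∂m + ∫⁻ a, (g a - ENNReal.ofReal d) ∂m +
        r * ENNReal.ofReal (c + d) := by gcongr; exact h1
    _ = _ := by rw [ENNReal.ofReal_add hc hd]; ring

end LayerCake

/-! ### Concave functions as mixtures of truncations -/

namespace OmegaFn

/-- The extension of `ψ` to `[0, ∞]`. -/
def ext (ψ : OmegaFn) (v : ℝ≥0∞) : ℝ≥0∞ := ψ.stieltjes.measure {t | 0 < t ∧ ENNReal.ofReal t < v}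

variable (ψ : OmegaFn)

theorem ext_mono : Monotone ψ.ext := fun _ _ h => measure_mono fun _ ht => ⟨ht.1, ht.2.trans_le h⟩

theorem ext_zero : ψ.ext 0 = 0 := by simp [ext]

theorem continuous_stieltjes : Continuous ψ.stieltjes :=
  ψ.continuousOn.comp_continuous (continuous_id.max continuous_const)
    (fun _ => mem_Ici.2 (le_max_right _ _))

theorem measure_Ioo_eq {u : ℝ} (hu : 0 ≤ u) :
    ψ.stieltjes.measure (Ioo 0 u) = ENNReal.ofReal (ψ u) := by
  rw [StieltjesFunction.measure_Ioo, (ψ.continuous_stieltjes.continuousAt.continuousWithinAt).leftLim_eq]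
  congr 1
  show ψ (max u 0) - ψ (max 0 0) = ψ u
  rw [max_eq_left hu, max_self, ψ.map_zero, sub_zero]

theorem setOf_ofReal_lt_ofReal (u : ℝ) :
    {t : ℝ | 0 < t ∧ ENNReal.ofReal t < ENNReal.ofReal u} = Ioo 0 u := by
  ext t
  simp only [mem_ofPred_eq, mem_Ioo, and_congr_right_iff]
  intro ht
  exact ENNReal.ofReal_lt_ofReal_iff_of_nonneg ht.le

theorem ext_ofReal {u : ℝ} (hu : 0 ≤ u) : ψ.ext (ENNReal.ofReal u) = ENNReal.ofReal (ψ u) := by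
  rw [ext, setOf_ofReal_lt_ofReal, ψ.measure_Ioo_eq hu]

theorem ext_iSup {v : ℕ → ℝ≥0∞} (hv : Monotone v) : ψ.ext (⨆ n, v n) = ⨆ n, ψ.ext (v n) := by
  have : {t : ℝ | 0 < t ∧ ENNReal.ofReal t < ⨆ n, v n} =
      ⋃ n, {t : ℝ | 0 < t ∧ ENNReal.ofReal t < v n} := by
    ext t
    simp [lt_iSup_iff]
  rw [ext, this, Monotone.measure_iUnion]
  · rfl
  · exact fun n k h t ht => ⟨ht.1, ht.2.trans_le (hv h)⟩

theorem ext_top_of_tendsto {ψ : OmegaFn} (hlim : Tendsto ψ atTop atTop) : ψ.ext ∞ = ∞ := by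
  refine ENNReal.eq_top_of_forall_nnreal_le fun c => ?_
  obtain ⟨t, ht, ht'⟩ := ((hlim.eventually_ge_atTop (c : ℝ)).and (eventually_ge_atTop 0)).exists
  calc (c : ℝ≥0∞) = ENNReal.ofReal c := ENNReal.ofReal_coe_nnreal.symm
    _ ≤ ENNReal.ofReal (ψ t) := ENNReal.ofReal_le_ofReal ht
    _ = ψ.ext (ENNReal.ofReal t) := (ψ.ext_ofReal ht').symm
    _ ≤ _ := ψ.ext_mono le_top

/-- A concave function that is continuous on `[0, ∞)` and vanishes at `0` is the integral of its
right derivative. As that derivative is nonnegative, the fundamental theorem of calculus holds down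
to `0`, where it may blow up. -/
theorem exists_rightDeriv : ∃ g : ℝ → ℝ, AntitoneOn g (Ioi 0) ∧ (∀ t, 0 < t → 0 ≤ g t) ∧
    ∀ u, 0 ≤ u → ENNReal.ofReal (ψ u) = ∫⁻ t in Ioo 0 u, ENNReal.ofReal (g t) := by
  have hconv : ConvexOn ℝ (Ici 0) (-⇑ψ) := ψ.concave.neg
  set g : ℝ → ℝ := fun t => -derivWithin (-⇑ψ) (Ioi t) t with hg
  have hint : interior (Ici (0 : ℝ)) = Ioi 0 := interior_Ici
  have hanti : AntitoneOn g (Ioi 0) := by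
    have := hconv.monotoneOn_rightDeriv
    rw [hint] at this
    exact this.neg
  have hderiv : ∀ t, 0 < t → HasDerivWithinAt ψ (g t) (Ioi t) t := fun t ht => by
    have := (hconv.hasDerivWithinAt_rightDeriv_of_mem_interior (x := t)
      (by rw [hint]; exact ht)).neg
    rwa [neg_neg] at this
  have hg0 : ∀ t, 0 < t → 0 ≤ g t := by
    intro t ht
    have h1 := (hasDerivWithinAt_iff_tendsto_slope' (self_notMem_Ioi)).1 (hderiv t ht)
    refine ge_of_tendsto h1 ?_
    filter_upwards [self_mem_nhdsWithin] with y hy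
    rw [slope_def_field]
    have hy' : t < y := hy
    exact div_nonneg (sub_nonneg.2 (ψ.mono (mem_Ici.2 ht.le) (mem_Ici.2 (ht.trans hy').le) hy'.le))
      (by linarith)
  refine ⟨g, hanti, hg0, fun u hu => ?_⟩
  have hcont : ContinuousOn ψ (Icc 0 u) := ψ.continuousOn.mono Icc_subset_Ici_self
  have hi : IntegrableOn g (Ioc 0 u) :=
    intervalIntegral.integrableOn_deriv_right_of_nonneg hcont (fun t ht => hderiv t ht.1)
      (fun t ht => hg0 t ht.1)
  have hftc := intervalIntegral.integral_eq_sub_of_hasDeriv_right_of_le hu hcont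
    (fun t ht => hderiv t ht.1) ((intervalIntegrable_iff_integrableOn_Ioc_of_le hu).2 hi)
  rw [ψ.map_zero, sub_zero, intervalIntegral.integral_of_le hu] at hftc
  rw [← hftc, setLIntegral_congr Ioo_ae_eq_Ioc, ofReal_integral_eq_lintegral_ofReal hi]
  filter_upwards [ae_restrict_mem measurableSet_Ioc] with t ht
  exact hg0 t ht.1

theorem measurableSet_lowerSet (v : ℝ≥0∞) : MeasurableSet {t : ℝ | 0 < t ∧ ENNReal.ofReal t < v} :=
  measurableSet_Ioi.inter (measurableSet_lt ENNReal.measurable_ofReal measurable_const)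

theorem iUnion_lowerSet :
    {t : ℝ | 0 < t ∧ ENNReal.ofReal t < ∞} = ⋃ n : ℕ, Ioo (0 : ℝ) n := by
  ext t
  simp only [mem_ofPred_eq, mem_iUnion, mem_Ioo, ENNReal.ofReal_lt_top, and_true]
  exact ⟨fun h => (exists_nat_gt t).imp fun n hn => ⟨h, hn⟩, fun ⟨n, h, _⟩ => h⟩

theorem volume_lowerSet (v : ℝ≥0∞) : volume {t : ℝ | 0 < t ∧ ENNReal.ofReal t < v} = v := by
  rcases eq_or_ne v ∞ with rfl | hv
  · simp only [ENNReal.ofReal_lt_top, and_true]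
    exact Real.volume_Ioi
  · rw [← ENNReal.ofReal_toReal hv, setOf_ofReal_lt_ofReal, Real.volume_Ioo, sub_zero]

/-- A concave function is a mixture of the functions `v ↦ min v r`. -/
theorem exists_ext_eq_lintegral_min : ∃ r : ℝ → ℝ≥0∞, Antitone r ∧
    ∀ v, ψ.ext v = ∫⁻ l in Ioi (0 : ℝ), min v (r l) := by
  obtain ⟨g, hanti, hg0, hg⟩ := ψ.exists_rightDeriv
  -- Since `g` is antitone, `{g > l}` is an initial interval. It is nested with `{t < v}`, so the
  -- intersection of the two has measure `min v (r l)`; integrating over `l` recovers `∫_0^v g`.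
  set T : ℝ → Set ℝ := fun l => {t | 0 < t ∧ l < g t} with hT
  refine ⟨fun l => volume (T l), fun l k h => measure_mono fun t ht => ⟨ht.1, h.trans_lt ht.2⟩,
    fun v => ?_⟩
  set A : Set ℝ := {t : ℝ | 0 < t ∧ ENNReal.ofReal t < v} with hA
  have hAm : MeasurableSet A := measurableSet_lowerSet v
  have h1 : ψ.ext v = ∫⁻ t in A, ENNReal.ofReal (g t) := by
    rcases eq_or_ne v ∞ with rfl | hv
    · have hmono : Monotone fun n : ℕ => Ioo (0 : ℝ) n := fun n k h =>
        Ioo_subset_Ioo_right (by exact_mod_cast h)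
      rw [← withDensity_apply _ hAm, ext, hA, iUnion_lowerSet, hmono.measure_iUnion,
        hmono.measure_iUnion]
      refine iSup_congr fun n => ?_
      rw [ψ.measure_Ioo_eq n.cast_nonneg, hg n n.cast_nonneg,
        withDensity_apply _ measurableSet_Ioo]
    · rw [hA, ← ENNReal.ofReal_toReal hv, ψ.ext_ofReal ENNReal.toReal_nonneg,
        hg _ ENNReal.toReal_nonneg, setOf_ofReal_lt_ofReal]
  have hAIoi : A ⊆ Ioi 0 := fun t ht => ht.1
  have hgm : AEMeasurable g (volume.restrict A) :=
    (aemeasurable_restrict_of_antitoneOn measurableSet_Ioi hanti).mono_set hAIoi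
  rw [h1, lintegral_eq_lintegral_meas_lt (volume.restrict A) ?_ hgm]
  · refine setLIntegral_congr_fun measurableSet_Ioi fun l _ => ?_
    rw [Measure.restrict_apply' hAm]
    have h2 : {a | l < g a} ∩ A = A ∩ T l := by
      ext t
      exact ⟨fun h => ⟨h.2, h.2.1, h.1⟩, fun h => ⟨h.2.2, h.1⟩⟩
    rw [h2]
    have hcomp : A ⊆ T l ∨ T l ⊆ A := by
      by_contra hcon
      rw [not_or, not_subset, not_subset] at hcon
      obtain ⟨⟨x, hxA, hxT⟩, y, hyT, hyA⟩ := hcon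
      rcases le_total x y with hxy | hxy
      · exact hxT ⟨hxA.1, hyT.2.trans_le (hanti hxA.1 hyT.1 hxy)⟩
      · exact hyA ⟨hyT.1, (ENNReal.ofReal_le_ofReal hxy).trans_lt hxA.2⟩
    have hvA : volume A = v := volume_lowerSet v
    rcases hcomp with h | h
    · rw [inter_eq_left.2 h, hvA, min_eq_left]
      rw [← hvA]
      exact measure_mono h
    · rw [inter_eq_right.2 h, min_eq_right]
      rw [← hvA]
      exact measure_mono h
  · filter_upwards [ae_restrict_mem hAm] with t ht
    exact hg0 t ht.1

end OmegaFn

/-! ### The Lorentz functional -/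

section Functional

variable {α : Type*} [MeasurableSpace α]

/-- The functional `∫₀^∞ ψ(m {f > s}) ds` on functions with values in `[0, ∞]`. -/
def lorentzFunctional (ψ : OmegaFn) (m : Measure α) (f : α → ℝ≥0∞) : ℝ≥0∞ :=
  ∫⁻ s in Ioi (0 : ℝ), ψ.ext (distrib m f s)

variable (ψ : OmegaFn) {m : Measure α}

theorem lorentzFunctional_mono_ae {f g : α → ℝ≥0∞} (h : ∀ᵐ a ∂m, f a ≤ g a) :
    lorentzFunctional ψ m f ≤ lorentzFunctional ψ m g :=
  lintegral_mono fun s => ψ.ext_mono (distrib_mono_ae h s)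

theorem lorentzFunctional_congr_ae {f g : α → ℝ≥0∞} (h : ∀ᵐ a ∂m, f a = g a) :
    lorentzFunctional ψ m f = lorentzFunctional ψ m g :=
  le_antisymm (lorentzFunctional_mono_ae ψ (h.mono fun _ ha => ha.le))
    (lorentzFunctional_mono_ae ψ (h.mono fun _ ha => ha.ge))

theorem measurable_ext_distrib (f : α → ℝ≥0∞) : Measurable fun s => ψ.ext (distrib m f s) :=
  Antitone.measurable fun _ _ h => ψ.ext_mono (distrib_antitone m f h)

/-- By Tonelli and the mixture representation it suffices to treat `min v r` in place of `ψ`. -/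
theorem lorentzFunctional_add_le {f g : α → ℝ≥0∞} (hf : AEMeasurable f m) (hg : AEMeasurable g m) :
    lorentzFunctional ψ m (fun a => f a + g a) ≤
      lorentzFunctional ψ m f + lorentzFunctional ψ m g := by
  obtain ⟨r, hr, hψ⟩ := ψ.exists_ext_eq_lintegral_min
  have hmeas : ∀ h : α → ℝ≥0∞, Measurable fun p : ℝ × ℝ => min (distrib m h p.1) (r p.2) := fun h =>
    ((distrib_antitone m h).measurable.comp measurable_fst).min (hr.measurable.comp measurable_snd)
  have key : ∀ h : α → ℝ≥0∞, lorentzFunctional ψ m h =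
      ∫⁻ l in Ioi (0 : ℝ), ∫⁻ s in Ioi (0 : ℝ), min (distrib m h s) (r l) := by
    intro h
    simp only [lorentzFunctional, hψ]
    exact lintegral_lintegral_swap (hmeas h).aemeasurable
  rw [key, key, key, ← lintegral_add_left]
  · exact lintegral_mono fun l => lintegral_min_distrib_add_le m hf hg (r l)
  · exact (hmeas f).lintegral_prod_left'

theorem lorentzFunctional_iSup {f : ℕ → α → ℝ≥0∞} (hf : Monotone f) :
    lorentzFunctional ψ m (fun a => ⨆ n, f n a) = ⨆ n, lorentzFunctional ψ m (f n) := by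
  have hd : ∀ s, distrib m (fun a => ⨆ n, f n a) s = ⨆ n, distrib m (f n) s := by
    intro s
    have : {a | ENNReal.ofReal s < ⨆ n, f n a} = ⋃ n, {a | ENNReal.ofReal s < f n a} := by
      ext a
      simp [lt_iSup_iff]
    rw [distrib, this, Monotone.measure_iUnion]
    · rfl
    · exact fun n k h a ha => lt_of_lt_of_le ha (hf h a)
  have hmono : ∀ s, Monotone fun n => distrib m (f n) s := fun s n k h =>
    distrib_mono_ae (ae_of_all _ fun a => hf h a) s
  simp only [lorentzFunctional]
  rw [← lintegral_iSup (fun n => measurable_ext_distrib ψ (f n))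
    (fun n k h s => ψ.ext_mono (hmono s h))]
  refine lintegral_congr fun s => ?_
  rw [hd, ψ.ext_iSup (hmono s)]

theorem lorentzFunctional_zero : lorentzFunctional ψ m (fun _ => 0) = 0 := by
  simp [lorentzFunctional, distrib, ψ.ext_zero]

theorem lorentzFunctional_sum_le {ι : Type*} (S : Finset ι) {f : ι → α → ℝ≥0∞}
    (hf : ∀ i, AEMeasurable (f i) m) :
    lorentzFunctional ψ m (fun a => ∑ i ∈ S, f i a) ≤ ∑ i ∈ S, lorentzFunctional ψ m (f i) := by
  classical
  induction S using Finset.induction_on with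
  | empty => simp [lorentzFunctional_zero]
  | insert i S hi ih =>
    simp only [Finset.sum_insert hi]
    refine (lorentzFunctional_add_le ψ (hf i) ?_).trans (add_le_add le_rfl ih)
    exact Finset.aemeasurable_fun_sum S fun j _ => hf j

theorem lorentzFunctional_tsum_le {f : ℕ → α → ℝ≥0∞} (hf : ∀ i, AEMeasurable (f i) m) :
    lorentzFunctional ψ m (fun a => ∑' i, f i a) ≤ ∑' i, lorentzFunctional ψ m (f i) := by
  simp only [ENNReal.tsum_eq_iSup_nat]
  have hmono : Monotone fun n a => ∑ i ∈ Finset.range n, f i a := fun n k h a =>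
    Finset.sum_le_sum_of_subset (Finset.range_mono h)
  rw [lorentzFunctional_iSup ψ hmono]
  exact iSup_mono fun n => lorentzFunctional_sum_le ψ _ hf

theorem lorentzFunctional_liminf_le (f : ℕ → α → ℝ≥0∞) :
    lorentzFunctional ψ m (fun a => liminf (fun n => f n a) atTop) ≤
      liminf (fun n => lorentzFunctional ψ m (f n)) atTop := by
  simp only [liminf_eq_iSup_iInf_of_nat]
  rw [lorentzFunctional_iSup ψ (f := fun n a => ⨅ i ≥ n, f i a)]
  · refine iSup_mono fun n => le_iInf₂ fun i hi => ?_
    exact lorentzFunctional_mono_ae ψ (ae_of_all _ fun a => iInf₂_le i hi)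
  · exact fun n k h a => le_iInf₂ fun i hi => iInf₂_le i (h.trans hi)

theorem lintegral_Ioi_comp_mul_left (h : ℝ → ℝ≥0∞) (hh : Measurable h) {c : ℝ} (hc : 0 < c) :
    ENNReal.ofReal c * ∫⁻ s in Ioi (0 : ℝ), h (c * s) = ∫⁻ s in Ioi (0 : ℝ), h s := by
  rw [← lintegral_indicator measurableSet_Ioi, ← lintegral_indicator measurableSet_Ioi]
  conv_rhs => rw [← Real.smul_map_volume_mul_left hc.ne']
  rw [lintegral_smul_measure, lintegral_map (hh.indicator measurableSet_Ioi) (by fun_prop),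
    abs_of_pos hc, smul_eq_mul]
  congr 1
  refine lintegral_congr fun s => ?_
  simp [Set.indicator, mul_pos_iff_of_pos_left hc]

theorem lorentzFunctional_const_mul {c : ℝ} (hc : 0 ≤ c) (f : α → ℝ≥0∞) :
    lorentzFunctional ψ m (fun a => ENNReal.ofReal c * f a) =
      ENNReal.ofReal c * lorentzFunctional ψ m f := by
  rcases hc.eq_or_lt with rfl | hc
  · simp [lorentzFunctional_zero]
  rw [lorentzFunctional, ← lintegral_Ioi_comp_mul_left _ (measurable_ext_distrib ψ _) hc]
  congr 1
  refine lintegral_congr fun s => ?_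
  congr 1
  rw [distrib, distrib]
  congr 1
  ext a
  rw [mem_ofPred_eq, mem_ofPred_eq, ENNReal.ofReal_mul hc.le]
  exact ENNReal.mul_lt_mul_iff_right (ENNReal.ofReal_pos.2 hc).ne' ENNReal.ofReal_ne_top

/-- Chebyshev's inequality for the Lorentz functional. -/
theorem ofReal_mul_ext_distrib_le (f : α → ℝ≥0∞) (s : ℝ) :
    ENNReal.ofReal s * ψ.ext (distrib m f s) ≤ lorentzFunctional ψ m f := by
  rw [mul_comm]
  calc ψ.ext (distrib m f s) * ENNReal.ofReal s = ∫⁻ t in Ioc 0 s, ψ.ext (distrib m f s) := by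
        rw [setLIntegral_const, Real.volume_Ioc, sub_zero]
    _ ≤ ∫⁻ t in Ioc 0 s, ψ.ext (distrib m f t) :=
        setLIntegral_mono' measurableSet_Ioc fun t ht => ψ.ext_mono (distrib_antitone m f ht.2)
    _ ≤ _ := lintegral_mono_set Ioc_subset_Ioi_self

theorem lorentzFunctional_indicator_const (c : ℝ) (E : Set α) :
    lorentzFunctional ψ m (E.indicator fun _ => ENNReal.ofReal c) =
      ENNReal.ofReal c * ψ.ext (m E) := by
  have h : ∀ s ∈ Ioi (0 : ℝ), ψ.ext (distrib m (E.indicator fun _ => ENNReal.ofReal c) s) =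
      (Ioo 0 c).indicator (fun _ => ψ.ext (m E)) s := by
    intro s hs
    by_cases hsc : s < c
    · rw [indicator_of_mem (show s ∈ Ioo 0 c from ⟨hs, hsc⟩), distrib]
      congr 2
      ext a
      by_cases ha : a ∈ E
      · simp [ha, ENNReal.ofReal_lt_ofReal_iff_of_nonneg (le_of_lt hs), hsc]
      · simp [ha]
    · rw [indicator_of_notMem (fun h : s ∈ Ioo 0 c => hsc h.2), distrib]
      convert ψ.ext_zero
      convert measure_empty (μ := m)
      ext a
      by_cases ha : a ∈ E
      · simp [ha, ENNReal.ofReal_le_ofReal (not_lt.1 hsc)]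
      · simp [ha]
  rw [lorentzFunctional, setLIntegral_congr_fun measurableSet_Ioi h,
    lintegral_indicator measurableSet_Ioo, setLIntegral_const,
    Measure.restrict_apply measurableSet_Ioo, inter_eq_left.2 Ioo_subset_Ioi_self,
    Real.volume_Ioo, sub_zero, mul_comm]

theorem distrib_add_le (f g : α → ℝ≥0∞) {s t : ℝ} (hs : 0 ≤ s) (ht : 0 ≤ t) :
    distrib m (fun a => f a + g a) (s + t) ≤ distrib m f s + distrib m g t := by
  refine (measure_mono ?_).trans (measure_union_le _ _)
  intro a ha
  by_contra hcon
  rw [mem_union, not_or] at hcon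
  have h1 : f a ≤ ENNReal.ofReal s := not_lt.1 hcon.1
  have h2 : g a ≤ ENNReal.ofReal t := not_lt.1 hcon.2
  have h3 : ENNReal.ofReal (s + t) < f a + g a := ha
  rw [ENNReal.ofReal_add hs ht] at h3
  exact absurd (add_le_add h1 h2) (not_le.2 h3)

variable {ψ}

theorem OmegaFn.ext_pos (hψ : ∀ t, 0 < t → 0 < ψ t) {v : ℝ≥0∞} (hv : v ≠ 0) : 0 < ψ.ext v := by
  have h1 : min v 1 ≠ ∞ := (min_le_right _ _).trans_lt ENNReal.one_lt_top |>.ne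
  have h2 : 0 < (min v 1).toReal := ENNReal.toReal_pos (by simp [hv]) h1
  calc 0 < ENNReal.ofReal (ψ (min v 1).toReal) := ENNReal.ofReal_pos.2 (hψ _ h2)
    _ = ψ.ext (min v 1) := by rw [← ψ.ext_ofReal h2.le, ENNReal.ofReal_toReal h1]
    _ ≤ ψ.ext v := ψ.ext_mono (min_le_left _ _)

theorem ae_lt_top_of_lorentzFunctional_ne_top (hψ : ∀ t, 0 < t → 0 < ψ t) {f : α → ℝ≥0∞}
    (hf : lorentzFunctional ψ m f ≠ ∞) : ∀ᵐ a ∂m, f a < ∞ := by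
  have h0 : m {a | f a = ∞} = 0 := by
    by_contra hne
    apply hf
    rw [← top_le_iff]
    calc (∞ : ℝ≥0∞) = ∫⁻ s in Ioi (0 : ℝ), ψ.ext (m {a | f a = ∞}) := by
          rw [setLIntegral_const, Real.volume_Ioi, ENNReal.mul_top (OmegaFn.ext_pos hψ hne).ne']
      _ ≤ _ := lintegral_mono fun s => ψ.ext_mono (measure_mono fun a ha => by
          show _ < f a
          rw [show f a = ∞ from ha]
          exact ENNReal.ofReal_lt_top)
  rw [ae_iff]
  simpa using h0

theorem exists_distrib_lt_top (hψ : ∀ t, 0 < t → 0 < ψ t) {f : α → ℝ≥0∞}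
    (hf : lorentzFunctional ψ m f ≠ ∞) : ∃ s : ℝ, 0 < s ∧ distrib m f s < ∞ := by
  by_contra! hcon
  apply hf
  rw [← top_le_iff]
  calc (∞ : ℝ≥0∞) = ∫⁻ s in Ioi (0 : ℝ), ψ.ext ∞ := by
        rw [setLIntegral_const, Real.volume_Ioi,
          ENNReal.mul_top (OmegaFn.ext_pos hψ ENNReal.top_ne_zero).ne']
    _ ≤ _ := setLIntegral_mono' measurableSet_Ioi fun s hs => ψ.ext_mono (hcon s hs)

theorem distrib_lt_top_of_lorentzFunctional_lt {f : α → ℝ≥0∞} {s : ℝ}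
    (hf : lorentzFunctional ψ m f < ENNReal.ofReal s * ψ.ext ∞) : distrib m f s < ∞ := by
  by_contra hcon
  have := ofReal_mul_ext_distrib_le ψ (m := m) f s
  rw [top_le_iff.1 (not_lt.1 hcon)] at this
  exact absurd hf (not_lt.2 this)

theorem ae_eq_zero_of_lorentzFunctional_eq_zero (hψ : ∀ t, 0 < t → 0 < ψ t) {f : α → ℝ≥0∞}
    (hf : lorentzFunctional ψ m f = 0) : ∀ᵐ a ∂m, f a = 0 := by
  have h : ∀ n : ℕ, ∀ᵐ a ∂m, f a ≤ ENNReal.ofReal (1 / ((n : ℝ) + 1)) := by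
    intro n
    have hn : (0 : ℝ) < 1 / ((n : ℝ) + 1) := by positivity
    have h1 := ofReal_mul_ext_distrib_le ψ (m := m) f (1 / ((n : ℝ) + 1))
    rw [hf, nonpos_iff_eq_zero, mul_eq_zero] at h1
    rcases h1 with h1 | h1
    · exact absurd h1 (ENNReal.ofReal_pos.2 hn).ne'
    · have h2 : m {a | ENNReal.ofReal (1 / ((n : ℝ) + 1)) < f a} = 0 := by
        by_contra hne
        exact (OmegaFn.ext_pos hψ hne).ne' h1
      rw [ae_iff]
      simpa only [not_le] using h2
  filter_upwards [ae_all_iff.2 h] with a ha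
  have hlim : Tendsto (fun n : ℕ => ENNReal.ofReal (1 / ((n : ℝ) + 1))) atTop (𝓝 0) := by
    rw [← ENNReal.ofReal_zero]
    exact ENNReal.tendsto_ofReal tendsto_one_div_add_atTop_nhds_zero_nat
  exact le_antisymm (ge_of_tendsto' hlim ha) zero_le

end Functional

/-! ### Lorentz spaces are symmetric Banach function spaces -/

section LorentzSpaces

variable {α : Type*} [MeasurableSpace α] {m : Measure α}

/-- The modulus of a class of functions, as a function with values in `[0, ∞]`. -/
def modulus (x : α →ₘ[m] ℝ) (a : α) : ℝ≥0∞ := ‖x a‖ₑ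

theorem aemeasurable_modulus (x : α →ₘ[m] ℝ) : AEMeasurable (modulus x) m :=
  x.aestronglyMeasurable.enorm

theorem distrib_modulus (x : α →ₘ[m] ℝ) {s : ℝ} (hs : 0 ≤ s) :
    distrib m (modulus x) s = m {a | s < |x a|} := by
  rw [distrib]
  congr 1
  ext a
  rw [mem_ofPred_eq, mem_ofPred_eq, modulus, Real.enorm_eq_ofReal_abs,
    ENNReal.ofReal_lt_ofReal_iff_of_nonneg hs]

/-- The distribution function is right continuous, so the infimum defining the rearrangement is
attained and the two functions are generalised inverses of each other. -/
theorem ofReal_lt_decRearr_iff (x : α →ₘ[m] ℝ) (s t : ℝ) :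
    ENNReal.ofReal s < decRearr x t ↔ ENNReal.ofReal t < distrib m (modulus x) s := by
  rw [← not_le, ← not_le, not_iff_not]
  constructor
  · intro h
    have hU : {a | ENNReal.ofReal s < modulus x a} =
        ⋃ n : ℕ, {a | ENNReal.ofReal s + ENNReal.ofReal (1 / ((n : ℝ) + 1)) < modulus x a} := by
      ext a
      simp only [mem_iUnion, mem_ofPred_eq]
      constructor
      · intro ha
        have hlim : Tendsto (fun n : ℕ => ENNReal.ofReal s + ENNReal.ofReal (1 / ((n : ℝ) + 1)))
            atTop (𝓝 (ENNReal.ofReal s + 0)) := by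
          refine tendsto_const_nhds.add ?_
          rw [← ENNReal.ofReal_zero]
          exact ENNReal.tendsto_ofReal tendsto_one_div_add_atTop_nhds_zero_nat
        rw [add_zero] at hlim
        exact (hlim.eventually_lt_const ha).exists
      · rintro ⟨n, hn⟩
        exact lt_of_le_of_lt le_self_add hn
    have hmono : Monotone fun n : ℕ =>
        {a | ENNReal.ofReal s + ENNReal.ofReal (1 / ((n : ℝ) + 1)) < modulus x a} := by
      intro n k hnk a ha
      have ha' : ENNReal.ofReal s + ENNReal.ofReal (1 / ((n : ℝ) + 1)) < modulus x a := ha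
      refine lt_of_le_of_lt ?_ ha'
      have : (n : ℝ) ≤ k := by exact_mod_cast hnk
      gcongr
    rw [distrib, hU, hmono.measure_iUnion]
    refine iSup_le fun n => ?_
    have hlt : decRearr x t < ENNReal.ofReal s + ENNReal.ofReal (1 / ((n : ℝ) + 1)) := by
      refine h.trans_lt (ENNReal.lt_add_right ENNReal.ofReal_ne_top ?_)
      exact (ENNReal.ofReal_pos.2 (by positivity)).ne'
    obtain ⟨r, hr, hr'⟩ := sInf_lt_iff.1 hlt
    exact (measure_mono fun a ha => hr'.trans ha).trans hr
  · intro h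
    exact sInf_le h

theorem decRearr_antitone (x : α →ₘ[m] ℝ) : Antitone (decRearr x) := fun _ _ hst =>
  sInf_le_sInf fun _ hr => le_trans hr (ENNReal.ofReal_le_ofReal hst)

/-- Layer cake for the Stieltjes measure: the level set `{t > 0 | μ(t) > s}` is `{0 < t < d(s)}`,
and `OmegaFn.ext` is its measure. All later estimates use the right side, which requires no
rearrangement. -/
theorem lorentzENorm_eq (ψ : OmegaFn) (x : α →ₘ[m] ℝ) :
    lorentzENorm ψ x = lorentzFunctional ψ m (modulus x) := by
  rw [lorentzENorm, lintegral_eq_lintegral_distrib _ (decRearr_antitone x).measurable.aemeasurable]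
  refine lintegral_congr fun s => ?_
  rw [distrib, Measure.restrict_apply' measurableSet_Ioi, OmegaFn.ext]
  congr 1
  ext t
  simp only [mem_inter_iff, mem_ofPred_eq, ofReal_lt_decRearr_iff, mem_Ioi]
  exact and_comm

theorem mem_lorentzSpace_iff {ψ : OmegaFn} (hψ : ∀ t, 0 < t → 0 < ψ t) {x : α →ₘ[m] ℝ} :
    x ∈ lorentzSpace ψ m ↔ lorentzFunctional ψ m (modulus x) < ∞ := by
  rw [← lorentzENorm_eq]
  refine ⟨fun h => h.2, fun h => ⟨?_, h⟩⟩
  rw [lorentzENorm_eq] at h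
  obtain ⟨s, hs, hs'⟩ := exists_distrib_lt_top hψ h.ne
  exact ⟨s, hs, by rwa [distrib_modulus x hs.le] at hs'⟩

theorem tendsto_decRearr_iff (x : α →ₘ[m] ℝ) :
    Tendsto (decRearr x) atTop (𝓝 0) ↔ ∀ s : ℝ, 0 < s → distrib m (modulus x) s < ∞ := by
  constructor
  · intro h s hs
    obtain ⟨t, ht⟩ := (h.eventually_lt_const (ENNReal.ofReal_pos.2 hs)).exists
    refine lt_of_le_of_lt (not_lt.1 fun hlt => ?_) (ENNReal.ofReal_lt_top (r := t))
    exact absurd ht (not_lt.2 ((ofReal_lt_decRearr_iff x s t).2 hlt).le)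
  · intro h
    rw [ENNReal.tendsto_nhds_zero]
    intro ε hε
    obtain ⟨s, hs, hsε⟩ : ∃ s : ℝ, 0 < s ∧ ENNReal.ofReal s ≤ ε := by
      have h1 : min ε 1 ≠ ∞ := ((min_le_right _ _).trans_lt ENNReal.one_lt_top).ne
      exact ⟨(min ε 1).toReal, ENNReal.toReal_pos (by simp [hε.ne']) h1, by
        rw [ENNReal.ofReal_toReal h1]; exact min_le_left _ _⟩
    filter_upwards [eventually_ge_atTop (distrib m (modulus x) s).toReal] with t ht
    refine le_trans (not_lt.1 fun hlt => ?_) hsε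
    have h1 := (ofReal_lt_decRearr_iff x s t).1 hlt
    exact absurd ((ENNReal.le_ofReal_iff_toReal_le (h s hs).ne
      (ENNReal.toReal_nonneg.trans ht)).2 ht) (not_le.2 h1)

theorem modulus_add_le (x y : α →ₘ[m] ℝ) :
    ∀ᵐ a ∂m, modulus (x + y) a ≤ modulus x a + modulus y a := by
  filter_upwards [AEEqFun.coeFn_add x y] with a ha
  rw [modulus, ha]
  exact enorm_add_le _ _

theorem modulus_smul (c : ℝ) (x : α →ₘ[m] ℝ) :
    ∀ᵐ a ∂m, modulus (c • x) a = ENNReal.ofReal |c| * modulus x a := by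
  filter_upwards [AEEqFun.coeFn_smul c x] with a ha
  rw [modulus, ha, Pi.smul_apply, enorm_smul, Real.enorm_eq_ofReal_abs, modulus]

theorem modulus_sub (x y : α →ₘ[m] ℝ) :
    ∀ᵐ a ∂m, modulus (x - y) a = ‖x a - y a‖ₑ := by
  filter_upwards [AEEqFun.coeFn_sub x y] with a ha
  rw [modulus, ha, Pi.sub_apply]

theorem modulus_zero : ∀ᵐ a ∂m, modulus (0 : α →ₘ[m] ℝ) a = 0 := by
  filter_upwards [AEEqFun.coeFn_zero (α := α) (μ := m) (β := ℝ)] with a ha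
  rw [modulus, ha, Pi.zero_apply, enorm_zero]

variable (ψ : OmegaFn)

theorem lorentzFunctional_modulus_add_le (x y : α →ₘ[m] ℝ) :
    lorentzFunctional ψ m (modulus (x + y)) ≤
      lorentzFunctional ψ m (modulus x) + lorentzFunctional ψ m (modulus y) :=
  (lorentzFunctional_mono_ae ψ (modulus_add_le x y)).trans
    (lorentzFunctional_add_le ψ (aemeasurable_modulus x) (aemeasurable_modulus y))

theorem lorentzFunctional_modulus_smul (c : ℝ) (x : α →ₘ[m] ℝ) :
    lorentzFunctional ψ m (modulus (c • x)) =
      ENNReal.ofReal |c| * lorentzFunctional ψ m (modulus x) := by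
  rw [lorentzFunctional_congr_ae ψ (modulus_smul c x),
    lorentzFunctional_const_mul ψ (abs_nonneg c)]

theorem lorentzFunctional_modulus_sub_comm (x y : α →ₘ[m] ℝ) :
    lorentzFunctional ψ m (modulus (x - y)) = lorentzFunctional ψ m (modulus (y - x)) := by
  refine lorentzFunctional_congr_ae ψ ?_
  filter_upwards [modulus_sub x y, modulus_sub y x] with a h1 h2
  rw [h1, h2, ← enorm_neg, neg_sub]

theorem lorentzFunctional_modulus_le_of_decRearr {x y : α →ₘ[m] ℝ}
    (h : ∀ t > 0, decRearr y t = decRearr x t) :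
    lorentzFunctional ψ m (modulus y) = lorentzFunctional ψ m (modulus x) := by
  rw [← lorentzENorm_eq, ← lorentzENorm_eq]
  exact setLIntegral_congr_fun measurableSet_Ioi fun t ht => h t ht

variable {ψ}

/-- Completeness of the Lorentz functional. -/
theorem exists_lorentz_limit (hψ : ∀ t, 0 < t → 0 < ψ t) (u : ℕ → α →ₘ[m] ℝ)
    (hu : ∀ ε : ℝ, 0 < ε → ∃ n₀, ∀ n ≥ n₀, ∀ k ≥ n₀,
      lorentzFunctional ψ m (modulus (u n - u k)) ≤ ENNReal.ofReal ε) :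
    ∃ x : α →ₘ[m] ℝ, ∀ ε : ℝ, 0 < ε → ∃ n₀, ∀ n ≥ n₀,
      lorentzFunctional ψ m (modulus (u n - x)) ≤ ENNReal.ofReal ε := by
  -- Along this subsequence the increments have functional at most `2^{-k}`, so the sum of their
  -- moduli is finite almost everywhere and the subsequence converges pointwise.
  obtain ⟨σ, hσ, hσ'⟩ := extraction_forall_of_eventually'
    (P := fun k n => ∀ i ≥ n, ∀ j ≥ n,
      lorentzFunctional ψ m (modulus (u i - u j)) ≤ ENNReal.ofReal ((1 / 2 : ℝ) ^ k))
    (fun k => by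
      obtain ⟨n₀, h⟩ := hu ((1 / 2 : ℝ) ^ k) (by positivity)
      exact ⟨n₀, fun n hn i hi j hj => h i (hn.trans hi) j (hn.trans hj)⟩)
  set f : ℕ → α → ℝ≥0∞ := fun k => modulus (u (σ (k + 1)) - u (σ k)) with hf
  have hfin : lorentzFunctional ψ m (fun a => ∑' k, f k a) ≠ ∞ := by
    refine ne_top_of_le_ne_top ?_
      ((lorentzFunctional_tsum_le ψ fun k => aemeasurable_modulus _).trans
        (ENNReal.tsum_le_tsum fun k => hσ' k _ (hσ (Nat.lt_succ_self k)).le _ le_rfl))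
    rw [← ENNReal.ofReal_tsum_of_nonneg (fun k => by positivity) summable_geometric_two]
    exact ENNReal.ofReal_ne_top
  have hlim : ∀ᵐ a ∂m, ∃ L, Tendsto (fun k => u (σ k) a) atTop (𝓝 L) := by
    filter_upwards [ae_lt_top_of_lorentzFunctional_ne_top hψ hfin,
      ae_all_iff.2 fun k => modulus_sub (u (σ (k + 1))) (u (σ k))] with a ha hd
    refine cauchySeq_tendsto_of_complete
      (cauchySeq_of_edist_le_of_tsum_ne_top (fun k => f k a) (fun k => ?_) ha.ne)
    rw [edist_comm, edist_eq_enorm_sub, hf]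
    exact (hd k).ge
  obtain ⟨g, hg, hgl⟩ := exists_stronglyMeasurable_limit_of_tendsto_ae
    (fun k => (u (σ k)).aestronglyMeasurable) hlim
  refine ⟨AEEqFun.mk g hg.aestronglyMeasurable, fun ε hε => ?_⟩
  obtain ⟨n₀, h⟩ := hu ε hε
  refine ⟨n₀, fun n hn => ?_⟩
  -- Convergence in norm of the whole sequence follows from Fatou's lemma along the subsequence.
  have h1 : ∀ᵐ a ∂m, modulus (u n - AEEqFun.mk g hg.aestronglyMeasurable) a =
      liminf (fun k => modulus (u n - u (σ k)) a) atTop := by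
    filter_upwards [hgl, modulus_sub (u n) (AEEqFun.mk g hg.aestronglyMeasurable),
      AEEqFun.coeFn_mk g hg.aestronglyMeasurable,
      ae_all_iff.2 fun k => modulus_sub (u n) (u (σ k))] with a ha h1 h2 h3
    simp only [h1, h2, h3]
    exact ((tendsto_const_nhds.sub ha).enorm.liminf_eq).symm
  rw [lorentzFunctional_congr_ae ψ h1]
  refine (lorentzFunctional_liminf_le ψ _).trans ?_
  refine liminf_le_of_frequently_le' (Eventually.frequently ?_)
  filter_upwards [eventually_ge_atTop n₀] with k hk
  exact h n hn _ (hk.trans (hσ.id_le k))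

/-- A closed order ideal of a Lorentz space is a symmetric Banach function space. -/
theorem isSymmetricBanach_of_closed (hψ : ∀ t, 0 < t → 0 < ψ t) (E : Set (α →ₘ[m] ℝ))
    (Q : (α →ₘ[m] ℝ) → Prop) (hE : ∀ x, x ∈ E ↔ lorentzFunctional ψ m (modulus x) < ∞ ∧ Q x)
    (hQ0 : Q 0) (hQadd : ∀ x y, Q x → Q y → Q (x + y)) (hQsmul : ∀ (c : ℝ) x, Q x → Q (c • x))
    (hQideal : ∀ x y, Q x → (∀ᵐ a ∂m, |y a| ≤ |x a|) → Q y)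
    (hQsymm : ∀ x y, Q x → (∀ t > 0, decRearr y t = decRearr x t) → Q y)
    (hQclosed : ∀ x, (∀ ε : ℝ, 0 < ε → ∃ y, Q y ∧
      lorentzFunctional ψ m (modulus (y - x)) ≤ ENNReal.ofReal ε) → Q x) :
    IsSymmetricBanach m E (lorentzNorm ψ) := by
  have hN : ∀ x : α →ₘ[m] ℝ, lorentzNorm ψ x = (lorentzFunctional ψ m (modulus x)).toReal :=
    fun x => by rw [lorentzNorm, lorentzENorm_eq]
  have hE' : ∀ x ∈ E, lorentzFunctional ψ m (modulus x) ≠ ∞ := fun x hx => ((hE x).1 hx).1.ne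
  have hadd : ∀ x ∈ E, ∀ y ∈ E, x + y ∈ E := fun x hx y hy => (hE _).2
    ⟨(lorentzFunctional_modulus_add_le ψ x y).trans_lt
      (ENNReal.add_lt_top.2 ⟨((hE x).1 hx).1, ((hE y).1 hy).1⟩),
      hQadd x y ((hE x).1 hx).2 ((hE y).1 hy).2⟩
  have hsmul : ∀ (c : ℝ), ∀ x ∈ E, c • x ∈ E := fun c x hx => (hE _).2
    ⟨by
      rw [lorentzFunctional_modulus_smul]
      exact ENNReal.mul_lt_top ENNReal.ofReal_lt_top ((hE x).1 hx).1,
      hQsmul c x ((hE x).1 hx).2⟩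
  have hsub : ∀ x ∈ E, ∀ y ∈ E, x - y ∈ E := fun x hx y hy => by
    rw [sub_eq_add_neg, ← neg_one_smul ℝ y]
    exact hadd x hx _ (hsmul _ y hy)
  refine ⟨?_, ?_, hadd, hsmul, ?_, ?_, ?_, ?_, ?_, ?_, ?_⟩
  · exact fun x hx => ((mem_lorentzSpace_iff hψ).2 ((hE x).1 hx).1).1
  · refine (hE 0).2 ⟨?_, hQ0⟩
    rw [lorentzFunctional_congr_ae ψ modulus_zero, lorentzFunctional_zero]
    exact ENNReal.zero_lt_top
  · exact fun x _ => ENNReal.toReal_nonneg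
  · intro x hx
    rw [hN, ENNReal.toReal_eq_zero_iff, or_iff_left (hE' x hx)]
    constructor
    · intro h
      refine AEEqFun.ext ?_
      filter_upwards [ae_eq_zero_of_lorentzFunctional_eq_zero hψ h,
        AEEqFun.coeFn_zero (α := α) (μ := m) (β := ℝ)] with a ha h0
      rw [h0]
      exact enorm_eq_zero.1 ha
    · rintro rfl
      rw [lorentzFunctional_congr_ae ψ modulus_zero, lorentzFunctional_zero]
  · intro c x _
    rw [hN, hN, lorentzFunctional_modulus_smul, ENNReal.toReal_mul,
      ENNReal.toReal_ofReal (abs_nonneg c)]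
  · intro x hx y hy
    rw [hN, hN, hN, ← ENNReal.toReal_add (hE' x hx) (hE' y hy)]
    exact ENNReal.toReal_mono (ENNReal.add_ne_top.2 ⟨hE' x hx, hE' y hy⟩)
      (lorentzFunctional_modulus_add_le ψ x y)
  · intro u hu hcauchy
    have hc : ∀ ε : ℝ, 0 < ε → ∃ n₀, ∀ n ≥ n₀, ∀ k ≥ n₀,
        lorentzFunctional ψ m (modulus (u n - u k)) ≤ ENNReal.ofReal ε := by
      intro ε hε
      obtain ⟨n₀, h⟩ := hcauchy ε hε
      refine ⟨n₀, fun n hn k hk => ?_⟩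
      have h1 := h n hn k hk
      rw [hN] at h1
      exact (ENNReal.le_ofReal_iff_toReal_le (hE' _ (hsub _ (hu n) _ (hu k))) hε.le).2 h1.le
    obtain ⟨x, hx⟩ := exists_lorentz_limit hψ u hc
    refine ⟨x, (hE x).2 ⟨?_, ?_⟩, ?_⟩
    · obtain ⟨n, hn⟩ := hx 1 one_pos
      have h1 := lorentzFunctional_modulus_add_le ψ (u n) (x - u n)
      rw [add_sub_cancel, lorentzFunctional_modulus_sub_comm ψ x] at h1
      exact h1.trans_lt (ENNReal.add_lt_top.2 ⟨((hE _).1 (hu n)).1,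
        (hn n le_rfl).trans_lt ENNReal.ofReal_lt_top⟩)
    · refine hQclosed x fun ε hε => ?_
      obtain ⟨n, hn⟩ := hx ε hε
      exact ⟨u n, ((hE _).1 (hu n)).2, hn n le_rfl⟩
    · rw [Metric.tendsto_atTop]
      intro ε hε
      obtain ⟨n₀, h⟩ := hx (ε / 2) (by positivity)
      refine ⟨n₀, fun n hn => ?_⟩
      rw [Real.dist_eq, sub_zero, hN, abs_of_nonneg ENNReal.toReal_nonneg]
      linarith [ENNReal.toReal_le_of_le_ofReal (by positivity) (h n hn)]
  · intro x hx y _ hyx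
    have h1 : lorentzFunctional ψ m (modulus y) ≤ lorentzFunctional ψ m (modulus x) := by
      refine lorentzFunctional_mono_ae ψ ?_
      filter_upwards [hyx] with a ha
      rw [modulus, modulus, Real.enorm_eq_ofReal_abs, Real.enorm_eq_ofReal_abs]
      exact ENNReal.ofReal_le_ofReal ha
    refine ⟨(hE y).2 ⟨h1.trans_lt ((hE x).1 hx).1, hQideal x y ((hE x).1 hx).2 hyx⟩, ?_⟩
    rw [hN, hN]
    exact ENNReal.toReal_mono (hE' x hx) h1
  · intro x hx y _ hyx
    have h1 := lorentzFunctional_modulus_le_of_decRearr ψ hyx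
    refine ⟨(hE y).2 ⟨h1 ▸ ((hE x).1 hx).1, hQsymm x y ((hE x).1 hx).2 hyx⟩, ?_⟩
    rw [hN, hN, h1]

theorem isSymmetricBanach_lorentzSpace (hψ : ∀ t, 0 < t → 0 < ψ t) :
    IsSymmetricBanach m (lorentzSpace ψ m) (lorentzNorm ψ) :=
  isSymmetricBanach_of_closed hψ _ (fun _ => True)
    (fun x => by rw [mem_lorentzSpace_iff hψ, and_true]) trivial (fun _ _ _ _ => trivial)
    (fun _ _ _ => trivial) (fun _ _ _ _ => trivial) (fun _ _ _ _ => trivial) (fun _ _ => trivial)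

theorem mem_lorentzSpaceVanishing_iff (hψ : ∀ t, 0 < t → 0 < ψ t) {x : α →ₘ[m] ℝ} :
    x ∈ lorentzSpaceVanishing ψ m ↔ lorentzFunctional ψ m (modulus x) < ∞ ∧
      ∀ s : ℝ, 0 < s → distrib m (modulus x) s < ∞ := by
  rw [← mem_lorentzSpace_iff hψ, ← tendsto_decRearr_iff]
  rfl

theorem distrib_lt_top_of_le_add {f g h : α → ℝ≥0∞} (hfg : ∀ᵐ a ∂m, f a ≤ g a + h a) {s : ℝ}
    (hs : 0 < s) (hg : distrib m g (s / 2) < ∞) (hh : distrib m h (s / 2) < ∞) :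
    distrib m f s < ∞ := by
  have h1 := distrib_add_le (m := m) g h (half_pos hs).le (half_pos hs).le
  rw [add_halves] at h1
  exact ((distrib_mono_ae hfg s).trans h1).trans_lt (ENNReal.add_lt_top.2 ⟨hg, hh⟩)

theorem isSymmetricBanach_lorentzSpaceVanishing (hψ : ∀ t, 0 < t → 0 < ψ t) :
    IsSymmetricBanach m (lorentzSpaceVanishing ψ m) (lorentzNorm ψ) := by
  refine isSymmetricBanach_of_closed hψ _ (fun x => ∀ s : ℝ, 0 < s → distrib m (modulus x) s < ∞)
    (fun x => mem_lorentzSpaceVanishing_iff hψ) ?_ ?_ ?_ ?_ ?_ ?_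
  · intro s _
    refine (distrib_mono_ae (g := fun _ => 0) (modulus_zero.mono fun a ha => ha.le) s).trans_lt ?_
    simp [distrib]
  · exact fun x y hx hy s hs => distrib_lt_top_of_le_add (modulus_add_le x y) hs
      (hx _ (half_pos hs)) (hy _ (half_pos hs))
  · intro c x hx s hs
    rcases eq_or_ne c 0 with rfl | hc
    · refine (distrib_mono_ae (g := fun _ => 0)
        ((modulus_smul 0 x).mono fun a ha => by rw [ha]; simp) s).trans_lt ?_
      simp [distrib]
    · have hc' : 0 < |c| := abs_pos.2 hc
      refine lt_of_le_of_lt (measure_mono_ae ?_) (hx (s / |c|) (by positivity))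
      filter_upwards [modulus_smul c x] with a ha h
      have h' : ENNReal.ofReal s < modulus (c • x) a := h
      rw [ha, show s = |c| * (s / |c|) by field_simp, ENNReal.ofReal_mul hc'.le] at h'
      exact (ENNReal.mul_lt_mul_iff_right (ENNReal.ofReal_pos.2 hc').ne' ENNReal.ofReal_ne_top).1 h'
  · intro x y hx hyx s hs
    refine (distrib_mono_ae ?_ s).trans_lt (hx s hs)
    filter_upwards [hyx] with a ha
    rw [modulus, modulus, Real.enorm_eq_ofReal_abs, Real.enorm_eq_ofReal_abs]
    exact ENNReal.ofReal_le_ofReal ha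
  · intro x y hx hyx
    rw [← tendsto_decRearr_iff] at hx ⊢
    refine hx.congr' ?_
    filter_upwards [eventually_gt_atTop 0] with t ht
    exact (hyx t ht).symm
  · intro x hx s hs
    have htop : 0 < ψ.ext ∞ := OmegaFn.ext_pos hψ ENNReal.top_ne_zero
    -- An approximant `y` closer to `x` than `(s / 2) ψ(∞)` leaves `{|x - y| > s / 2}` of finite
    -- measure, by Chebyshev.
    have hpos : 0 < ENNReal.ofReal (s / 2) * ψ.ext ∞ :=
      ENNReal.mul_pos (ENNReal.ofReal_pos.2 (half_pos hs)).ne' htop.ne'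
    obtain ⟨c, hc0, hc⟩ := ENNReal.lt_iff_exists_nnreal_btwn.1 hpos
    obtain ⟨y, hy, hyx⟩ := hx c (by exact_mod_cast hc0)
    rw [ENNReal.ofReal_coe_nnreal, lorentzFunctional_modulus_sub_comm] at hyx
    refine distrib_lt_top_of_le_add ?_ hs (hy _ (half_pos hs))
      (distrib_lt_top_of_lorentzFunctional_lt (hyx.trans_lt hc))
    have := modulus_add_le y (x - y)
    rwa [add_sub_cancel] at this

theorem lorentzSpaceVanishing_eq (hψ : ∀ t, 0 < t → 0 < ψ t) (hlim : Tendsto ψ atTop atTop) :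
    lorentzSpaceVanishing ψ m = lorentzSpace ψ m := by
  ext x
  rw [mem_lorentzSpaceVanishing_iff hψ, mem_lorentzSpace_iff hψ, and_iff_left_iff_imp]
  intro h s hs
  refine distrib_lt_top_of_lorentzFunctional_lt (ψ := ψ) ?_
  rwa [OmegaFn.ext_top_of_tendsto hlim, ENNReal.mul_top (ENNReal.ofReal_pos.2 hs).ne']

end LorentzSpaces

/-! ### Dyadic sums -/

/-- On `(2^(n-1), 2^n]`, whose length is half of `2^n`, the function is at least its value at the
right end. -/
theorem tsum_zpow_mul_le {h : ℝ → ℝ≥0∞} (hh : Antitone h) :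
    ∑' n : ℤ, ENNReal.ofReal ((2 : ℝ) ^ n) * h ((2 : ℝ) ^ n) ≤ 2 * ∫⁻ s in Ioi (0 : ℝ), h s := by
  set I : ℤ → Set ℝ := fun n => Ioc ((2 : ℝ) ^ (n - 1)) ((2 : ℝ) ^ n) with hI
  have hmono : Monotone fun n : ℤ => (2 : ℝ) ^ n := zpow_right_mono₀ one_le_two
  have hdisj : Pairwise (Function.onFun Disjoint I) := hmono.pairwise_disjoint_on_Ioc_pred
  have hterm : ∀ n : ℤ, ENNReal.ofReal ((2 : ℝ) ^ n) * h ((2 : ℝ) ^ n) ≤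
      2 * ∫⁻ s in I n, h s := by
    intro n
    have h1 : (2 : ℝ) ^ n = 2 * ((2 : ℝ) ^ n - (2 : ℝ) ^ (n - 1)) := by
      rw [zpow_sub_one₀ two_ne_zero]
      ring
    calc ENNReal.ofReal ((2 : ℝ) ^ n) * h ((2 : ℝ) ^ n)
        = 2 * ∫⁻ s in I n, h ((2 : ℝ) ^ n) := by
          rw [setLIntegral_const, hI, Real.volume_Ioc]
          conv_lhs => rw [h1, ENNReal.ofReal_mul two_pos.le, ENNReal.ofReal_ofNat]
          rw [← h1]
          ring
      _ ≤ _ := by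
          gcongr 2 * ?_
          exact setLIntegral_mono' measurableSet_Ioc fun s hs => hh hs.2
  refine (ENNReal.tsum_le_tsum hterm).trans ?_
  rw [ENNReal.tsum_mul_left, ← lintegral_iUnion (fun n => measurableSet_Ioc) hdisj]
  gcongr
  exact iUnion_subset fun n s hs => (zpow_pos two_pos _).trans hs.1

theorem tsum_zpow_mul_ext_le {α : Type*} [MeasurableSpace α] (ψ : OmegaFn) (m : Measure α)
    (f : α → ℝ≥0∞) :
    ∑' n : ℤ, ENNReal.ofReal ((2 : ℝ) ^ n) * ψ.ext (distrib m f ((2 : ℝ) ^ n)) ≤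
      2 * lorentzFunctional ψ m f :=
  tsum_zpow_mul_le fun _ _ h => ψ.ext_mono (distrib_antitone m f h)

/-! ### Consequences of the inclusion into the logarithmic Lorentz space -/

namespace OmegaFn

theorem map_mul_le (φ : OmegaFn) {c t : ℝ} (hc : 1 ≤ c) (ht : 0 ≤ t) : φ (c * t) ≤ c * φ t := by
  have hc0 : 0 < c := by linarith
  have h := φ.concave.2 (mem_Ici.2 (show 0 ≤ c * t by positivity)) (mem_Ici.2 (le_refl (0 : ℝ)))
    (show 0 ≤ c⁻¹ by positivity) (sub_nonneg.2 (inv_le_one_of_one_le₀ hc)) (by ring)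
  simp only [smul_eq_mul, φ.map_zero, mul_zero, add_zero, inv_mul_cancel_left₀ hc0.ne'] at h
  rwa [inv_mul_le_iff₀ hc0] at h

theorem tendsto_log_atTop : Tendsto OmegaFn.log atTop atTop :=
  Real.tendsto_log_atTop.comp (tendsto_atTop_add_const_left _ _ tendsto_id)

theorem ext_eq_zero_of_forall {φ : OmegaFn} (h : ∀ t, 0 ≤ t → φ t = 0) (v : ℝ≥0∞) :
    φ.ext v = 0 := by
  refine le_antisymm ((φ.ext_mono le_top).trans ?_) zero_le
  have hmono : Monotone fun n : ℕ => Ioo (0 : ℝ) n := fun n k h =>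
    Ioo_subset_Ioo_right (by exact_mod_cast h)
  rw [ext, iUnion_lowerSet, hmono.measure_iUnion]
  refine iSup_le fun n => ?_
  rw [φ.measure_Ioo_eq n.cast_nonneg, h _ n.cast_nonneg, ENNReal.ofReal_zero]

/-- By concavity a zero of `φ` at a positive point forces `φ = 0` on `[0, ∞)`. Then the constant `1`
lies in `Λ_φ`, but it is not in `Λ_log`. -/
theorem pos_of_lorentzSpace_subset_log {φ : OmegaFn}
    (hlog : lorentzSpace φ (volume.restrict (Ioi (0 : ℝ))) ⊆
      lorentzSpace OmegaFn.log (volume.restrict (Ioi (0 : ℝ)))) : ∀ t, 0 < t → 0 < φ t := by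
  intro t₀ ht₀
  by_contra hcon
  have h0 : φ t₀ = 0 := le_antisymm (not_lt.1 hcon) (φ.nonneg _ ht₀.le)
  have hzero : ∀ t, 0 ≤ t → φ t = 0 := by
    intro t ht
    refine le_antisymm ?_ (φ.nonneg t ht)
    rcases le_total t t₀ with h | h
    · exact (φ.mono (mem_Ici.2 ht) (mem_Ici.2 ht₀.le) h).trans h0.le
    · have := φ.map_mul_le ((one_le_div ht₀).2 h) ht₀.le
      rwa [div_mul_cancel₀ _ ht₀.ne', h0, mul_zero] at this
  set m : Measure ℝ := volume.restrict (Ioi (0 : ℝ)) with hm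
  set x : ℝ →ₘ[m] ℝ := AEEqFun.const ℝ (1 : ℝ) with hx
  have hmod : ∀ᵐ a ∂m, modulus x a = 1 := by
    filter_upwards [AEEqFun.coeFn_const ℝ (1 : ℝ) (μ := m)] with a ha
    rw [modulus, ha]
    simp
  have hmem : x ∈ lorentzSpace φ m := by
    refine ⟨⟨1, one_pos, ?_⟩, ?_⟩
    · rw [← distrib_modulus x zero_le_one]
      refine (distrib_mono_ae (g := fun _ => 1) (hmod.mono fun a ha => ha.le) 1).trans_lt ?_
      simp [distrib]
    · rw [lorentzENorm_eq]
      simp [lorentzFunctional, ext_eq_zero_of_forall hzero]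
  have h1 := (hlog hmem).2
  rw [lorentzENorm_eq, lorentzFunctional_congr_ae _ hmod] at h1
  have h2 := ofReal_mul_ext_distrib_le OmegaFn.log (m := m) (fun _ => 1) (1 / 2)
  have h3 : distrib m (fun _ => 1) (1 / 2) = ∞ := by
    have : {a : ℝ | ENNReal.ofReal (1 / 2) < 1} = univ := by
      refine eq_univ_of_forall fun a => ?_
      show ENNReal.ofReal (1 / 2) < 1
      rw [ENNReal.ofReal_lt_one]
      norm_num
    rw [distrib, this, hm, Measure.restrict_apply_univ, Real.volume_Ioi]
  rw [h3, ext_top_of_tendsto tendsto_log_atTop, ENNReal.mul_top (by simp)] at h2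
  exact absurd h1 (not_lt.2 h2)

/-- A closed graph argument made explicit. Otherwise choose `t_n` with `4^n φ(t_n) < log (1 + t_n)`.
The sum of the indicators of `(0, t_n)` with weights `2^n / log (1 + t_n)` has `φ`-norm at most `∑
2^{-n}`, while its logarithmic norm is at least `2^n` for every `n`. -/
theorem exists_log_le_mul {φ : OmegaFn}
    (hlog : lorentzSpace φ (volume.restrict (Ioi (0 : ℝ))) ⊆
      lorentzSpace OmegaFn.log (volume.restrict (Ioi (0 : ℝ)))) :
    ∃ C : ℝ, 0 < C ∧ ∀ t, 0 ≤ t → Real.log (1 + t) ≤ C * φ t := by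
  have hpos := pos_of_lorentzSpace_subset_log hlog
  by_contra! hcon
  have h4 : ∀ n : ℕ, ∃ t : ℝ, 0 ≤ t ∧ (4 : ℝ) ^ n * φ t < Real.log (1 + t) := fun n =>
    hcon _ (by positivity)
  choose t ht htlog using h4
  have hlt : ∀ n, 0 < Real.log (1 + t n) := fun n =>
    lt_of_le_of_lt (mul_nonneg (by positivity) (φ.nonneg _ (ht n))) (htlog n)
  set c : ℕ → ℝ := fun n => 2 ^ n / Real.log (1 + t n) with hc
  have hc0 : ∀ n, 0 < c n := fun n => div_pos (by positivity) (hlt n)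
  set m : Measure ℝ := volume.restrict (Ioi (0 : ℝ)) with hm
  have hmIoo : ∀ n, m (Ioo 0 (t n)) = ENNReal.ofReal (t n) := fun n => by
    rw [hm, Measure.restrict_apply measurableSet_Ioo, inter_eq_left.2 Ioo_subset_Ioi_self,
      Real.volume_Ioo, sub_zero]
  set f : ℕ → ℝ → ℝ≥0∞ := fun n => (Ioo 0 (t n)).indicator fun _ => ENNReal.ofReal (c n) with hf
  have hfm : ∀ n, Measurable (f n) := fun n => measurable_const.indicator measurableSet_Ioo
  have hφf : lorentzFunctional φ m (fun a => ∑' n, f n a) < ∞ := by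
    refine (lorentzFunctional_tsum_le φ fun n => (hfm n).aemeasurable).trans_lt ?_
    have hle : ∀ n, lorentzFunctional φ m (f n) ≤ ENNReal.ofReal ((1 / 2 : ℝ) ^ n) := by
      intro n
      rw [lorentzFunctional_indicator_const, hmIoo, φ.ext_ofReal (ht n),
        ← ENNReal.ofReal_mul (hc0 n).le]
      refine ENNReal.ofReal_le_ofReal ?_
      rw [hc, div_mul_eq_mul_div, div_le_iff₀ (hlt n)]
      have h1 : (2 : ℝ) ^ n * φ (t n) = (1 / 2) ^ n * (4 ^ n * φ (t n)) := by
        rw [← mul_assoc, ← mul_pow]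
        norm_num
      rw [h1]
      gcongr
      exact (htlog n).le
    refine (ENNReal.tsum_le_tsum hle).trans_lt ?_
    rw [← ENNReal.ofReal_tsum_of_nonneg (fun k => by positivity) summable_geometric_two]
    exact ENNReal.ofReal_lt_top
  have hFm : Measurable fun a => ∑' n, f n a := Measurable.tsum hfm
  set x : ℝ →ₘ[m] ℝ := AEEqFun.mk (fun a => (∑' n, f n a).toReal)
    hFm.ennreal_toReal.aestronglyMeasurable with hx
  have hmod : ∀ᵐ a ∂m, modulus x a = ∑' n, f n a := by
    filter_upwards [AEEqFun.coeFn_mk (μ := m) (fun a => (∑' n, f n a).toReal)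
      hFm.ennreal_toReal.aestronglyMeasurable,
      ae_lt_top_of_lorentzFunctional_ne_top hpos hφf.ne] with a ha ha'
    rw [modulus, ha, Real.enorm_eq_ofReal ENNReal.toReal_nonneg, ENNReal.ofReal_toReal ha'.ne]
  have hmem : x ∈ lorentzSpace φ m := by
    rw [mem_lorentzSpace_iff hpos, lorentzFunctional_congr_ae _ hmod]
    exact hφf
  have h1 := (hlog hmem).2
  rw [lorentzENorm_eq, lorentzFunctional_congr_ae _ hmod] at h1
  refine h1.ne (ENNReal.eq_top_of_forall_nnreal_le fun r => ?_)
  obtain ⟨n, hn⟩ := pow_unbounded_of_one_lt (r : ℝ) one_lt_two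
  calc (r : ℝ≥0∞) = ENNReal.ofReal r := ENNReal.ofReal_coe_nnreal.symm
    _ ≤ ENNReal.ofReal (c n * OmegaFn.log (t n)) := by
        refine ENNReal.ofReal_le_ofReal ?_
        show (r : ℝ) ≤ 2 ^ n / Real.log (1 + t n) * Real.log (1 + t n)
        rw [div_mul_cancel₀ _ (hlt n).ne']
        exact hn.le
    _ = lorentzFunctional OmegaFn.log m (f n) := by
        rw [lorentzFunctional_indicator_const, hmIoo, OmegaFn.log.ext_ofReal (ht n),
          ← ENNReal.ofReal_mul (hc0 n).le]
    _ ≤ _ := lorentzFunctional_mono_ae _ (ae_of_all _ fun a => ENNReal.le_tsum n)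

theorem tendsto_atTop_of_log_le {φ : OmegaFn} {C : ℝ} (hC : 0 < C)
    (h : ∀ t, 0 ≤ t → Real.log (1 + t) ≤ C * φ t) : Tendsto φ atTop atTop := by
  refine tendsto_atTop_mono' _ ?_ (tendsto_log_atTop.atTop_div_const hC)
  filter_upwards [eventually_ge_atTop 0] with t ht
  rw [div_le_iff₀ hC, mul_comm]
  exact h t ht

/-- Concavity gives `log (1 + uw) ≥ min(u, 1) log (1 + w)`, and `log (1 + w) ≥ (1 + log w) / 2`
because `e w ≤ (1 + w)²`. All quotients in the infimum are thus at least `min(u, 1) / (2C)`. -/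
theorem psi_pos_of_log_le {φ : OmegaFn} {C : ℝ} (hC : 0 < C)
    (h : ∀ t, 0 ≤ t → Real.log (1 + t) ≤ C * φ t) : ∀ u, 0 < u → 0 < φ.psi u := by
  intro u hu
  have : Nonempty (Ioi (1 : ℝ)) := ⟨⟨2, by norm_num⟩⟩
  have hmin : 0 < min u 1 := lt_min hu one_pos
  refine lt_of_lt_of_le (show 0 < min u 1 / (2 * C) by positivity) (le_ciInf fun w => ?_)
  have hw : (1 : ℝ) < w := w.2
  have hw0 : (0 : ℝ) < w := by linarith
  have hlw := Real.log_nonneg hw.le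
  rw [div_le_div_iff₀ (by positivity) (by linarith)]
  have h1 : 1 + Real.log w ≤ 2 * Real.log (1 + w) := by
    have h2 : Real.exp 1 * w ≤ (1 + w) ^ 2 := by
      nlinarith [Real.exp_one_lt_d9, sq_nonneg ((w : ℝ) - 1)]
    have h3 := Real.log_le_log (by positivity) h2
    rw [Real.log_mul (Real.exp_pos 1).ne' hw0.ne', Real.log_exp, Real.log_pow] at h3
    exact_mod_cast h3
  have h2 : min u 1 * Real.log (1 + w) ≤ Real.log (1 + u * w) := by
    have h3 := OmegaFn.log.map_mul_le (c := (min u 1)⁻¹) (t := min u 1 * w)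
      ((one_le_inv₀ hmin).2 (min_le_right _ _)) (by positivity)
    rw [inv_mul_cancel_left₀ hmin.ne', ← div_eq_inv_mul, le_div_iff₀ hmin] at h3
    have h4 : OmegaFn.log (min u 1 * w) ≤ OmegaFn.log (u * w) :=
      OmegaFn.log.mono (mem_Ici.2 (by positivity)) (mem_Ici.2 (by positivity))
        (mul_le_mul_of_nonneg_right (min_le_left _ _) hw0.le)
    calc min u 1 * Real.log (1 + w) = OmegaFn.log w * min u 1 := mul_comm _ _
      _ ≤ _ := h3.trans h4
  have h3 := h (u * w) (by positivity)
  nlinarith [mul_le_mul_of_nonneg_left h1 hmin.le]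

end OmegaFn

/-! ### The norm of the maximal Hilbert transform of a bounded function -/

/-- The substitution `t = v / x`. With `t = v e^{-x}` in the next lemma, it converts the two regimes
of `1 / sinh x` into the two integrals of the hypothesis. -/
theorem lintegral_comp_div_eq (ψ : ℝ → ℝ) {v : ℝ} (hv : 0 < v) :
    ∫⁻ x in Ioo (0 : ℝ) 1, ENNReal.ofReal (ψ (v / x)) =
      ENNReal.ofReal v * ∫⁻ t in Ioi v, ENNReal.ofReal (ψ t / t ^ 2) := by
  have himg : (fun t : ℝ => v / t) '' Ioi v = Ioo 0 1 := by
    ext x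
    constructor
    · rintro ⟨t, ht, rfl⟩
      have ht' : v < t := ht
      exact ⟨div_pos hv (hv.trans ht'), (div_lt_one (hv.trans ht')).2 ht'⟩
    · rintro ⟨h0, h1⟩
      refine ⟨v / x, (lt_div_iff₀ h0).2 (by nlinarith), ?_⟩
      field_simp
  have hd : ∀ t ∈ Ioi v, HasDerivWithinAt (fun t : ℝ => v / t) (-v / t ^ 2) (Ioi v) t := by
    intro t ht
    have ht0 : t ≠ 0 := (hv.trans ht).ne'
    have := ((hasDerivAt_inv ht0).const_mul v).hasDerivWithinAt (s := Ioi v)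
    simp only [← div_eq_mul_inv] at this
    convert! this using 1
    ring
  have hinj : InjOn (fun t : ℝ => v / t) (Ioi v) := by
    intro t ht t' ht' h
    have h1 : t ≠ 0 := (hv.trans ht).ne'
    have h2 : t' ≠ 0 := (hv.trans ht').ne'
    have h3 : v / t = v / t' := h
    field_simp at h3
    exact h3.symm
  rw [← himg, lintegral_image_eq_lintegral_abs_deriv_mul measurableSet_Ioi hd hinj,
    ← lintegral_const_mul' _ _ ENNReal.ofReal_ne_top]
  refine setLIntegral_congr_fun measurableSet_Ioi fun t ht => ?_
  have ht0 : 0 < t := hv.trans ht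
  show ENNReal.ofReal |-v / t ^ 2| * ENNReal.ofReal (ψ (v / (v / t))) = _
  rw [neg_div, abs_neg, abs_of_pos (by positivity), ← ENNReal.ofReal_mul (by positivity),
    ← ENNReal.ofReal_mul hv.le, div_div_cancel₀ hv.ne']
  congr 1
  ring

theorem lintegral_comp_exp_neg_eq (ψ : ℝ → ℝ) {v : ℝ} (hv : 0 < v) :
    ∫⁻ x in Ioi (0 : ℝ), ENNReal.ofReal (ψ (v * Real.exp (-x))) =
      ∫⁻ t in Ioo 0 v, ENNReal.ofReal (ψ t / t) := by
  have himg : (fun t : ℝ => Real.log v - Real.log t) '' Ioo 0 v = Ioi 0 := by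
    ext x
    constructor
    · rintro ⟨t, ht, rfl⟩
      exact sub_pos.2 (Real.log_lt_log ht.1 ht.2)
    · intro hx
      have hx' : 0 < x := hx
      refine ⟨v * Real.exp (-x), ⟨by positivity, ?_⟩, ?_⟩
      · have : Real.exp (-x) < 1 := by rwa [Real.exp_lt_one_iff, neg_lt_zero]
        nlinarith
      · show Real.log v - Real.log (v * Real.exp (-x)) = x
        rw [Real.log_mul hv.ne' (Real.exp_pos _).ne', Real.log_exp]
        ring
  have hd : ∀ t ∈ Ioo 0 v, HasDerivWithinAt (fun t : ℝ => Real.log v - Real.log t) (-t⁻¹)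
      (Ioo 0 v) t := fun t ht =>
    ((Real.hasDerivAt_log ht.1.ne').const_sub _).hasDerivWithinAt
  have hinj : InjOn (fun t : ℝ => Real.log v - Real.log t) (Ioo 0 v) := by
    intro t ht t' ht' h
    exact Real.log_injOn_pos ht.1 ht'.1 (sub_right_inj.1 h)
  rw [← himg, lintegral_image_eq_lintegral_abs_deriv_mul measurableSet_Ioo hd hinj]
  refine setLIntegral_congr_fun measurableSet_Ioo fun t ht => ?_
  show ENNReal.ofReal |-t⁻¹| *
    ENNReal.ofReal (ψ (v * Real.exp (-(Real.log v - Real.log t)))) = _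
  rw [abs_neg, abs_of_pos (inv_pos.2 ht.1), ← ENNReal.ofReal_mul (inv_pos.2 ht.1).le, neg_sub,
    Real.exp_sub, Real.exp_log hv, Real.exp_log ht.1, mul_div_cancel₀ _ hv.ne']
  congr 1
  ring

/-- The restricted estimate for the maximal Hilbert transform. -/
theorem lorentzFunctional_maxHilbert_le {φ ψ : OmegaFn} {c : ℝ}
    (hcrit : ∀ u : ℝ, 0 < u →
      (∫⁻ t in Ioo 0 u, ENNReal.ofReal (ψ t / t)) +
        ENNReal.ofReal u * (∫⁻ t in Ioi u, ENNReal.ofReal (ψ t / t ^ 2)) ≤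
      ENNReal.ofReal (c * φ u)) {f : ℝ → ℝ} (hf : Integrable f) (hf1 : ∀ η, |f η| ≤ 1) :
    lorentzFunctional ψ volume (maxHilbert f) ≤
      ENNReal.ofReal (1920 * |c| * φ (∫ η, |f η|)) := by
  set I := ∫ η, |f η| with hI
  have hI0 : 0 ≤ I := integral_nonneg fun η => abs_nonneg _
  have h1 : ∀ l ∈ Ioi (0 : ℝ), ψ.ext (distrib volume (maxHilbert f) l) ≤
      ψ.ext (ENNReal.ofReal (40 * (I / Real.sinh (1 / 16 * l)))) := by
    intro l hl
    refine ψ.ext_mono ((volume_lt_maxHilbert_le hf one_pos hf1 hl).trans_eq ?_)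
    congr 4
    · rw [div_one]
    · ring
  rcases hI0.eq_or_lt with hI' | hI'
  · refine (setLIntegral_mono' measurableSet_Ioi h1).trans ?_
    simp [← hI', ψ.ext_zero]
  -- `120 = 40 · 3`, from `sinh x ≥ e^x / 3` for `x > 1`; the same `v` is more than enough for `x ≤
  -- 1`. Rescaling the level costs a further `16`, and `φ(120 I) ≤ 120 φ(I)` then yields `1920 = 16
  -- · 120`.
  set v := 120 * I with hv
  have hv0 : 0 < v := by positivity
  have h2 : ∀ x, 0 < x → x ≤ 1 → 40 * (I / Real.sinh x) ≤ v / x := by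
    intro x hx _
    have : x ≤ Real.sinh x := Real.self_le_sinh_iff.2 hx.le
    calc 40 * (I / Real.sinh x) ≤ 40 * (I / x) := by gcongr
      _ ≤ v / x := by
        rw [← mul_div_assoc, hv]
        gcongr
        norm_num
  have h3 : ∀ x, 1 < x → 40 * (I / Real.sinh x) ≤ v * Real.exp (-x) := by
    intro x hx
    have hs : Real.exp x / 3 ≤ Real.sinh x := by
      rw [Real.sinh_eq, Real.exp_neg]
      have h4 : 2 ≤ Real.exp x := by linarith [Real.add_one_le_exp x]
      have h5 : (Real.exp x)⁻¹ ≤ Real.exp x / 4 := by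
        rw [inv_le_iff_one_le_mul₀ (by positivity)]
        nlinarith
      linarith
    calc 40 * (I / Real.sinh x) ≤ 40 * (I / (Real.exp x / 3)) := by gcongr
      _ = v * Real.exp (-x) := by
        rw [Real.exp_neg, hv]
        field_simp
        norm_num
  have hext : ∀ x y : ℝ, 0 ≤ y → x ≤ y → ψ.ext (ENNReal.ofReal x) ≤ ENNReal.ofReal (ψ y) :=
    fun x y hy hxy => (ψ.ext_mono (ENNReal.ofReal_le_ofReal hxy)).trans_eq (ψ.ext_ofReal hy)
  have hmeas : Measurable fun l => ψ.ext (ENNReal.ofReal (40 * (I / Real.sinh l))) :=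
    ψ.ext_mono.measurable.comp (by fun_prop)
  have hscale := lintegral_Ioi_comp_mul_left _ hmeas (show (0 : ℝ) < 1 / 16 by norm_num)
  calc lorentzFunctional ψ volume (maxHilbert f)
      ≤ ∫⁻ l in Ioi (0 : ℝ), ψ.ext (ENNReal.ofReal (40 * (I / Real.sinh (1 / 16 * l)))) :=
        setLIntegral_mono' measurableSet_Ioi h1
    _ = 16 * ∫⁻ l in Ioi (0 : ℝ), ψ.ext (ENNReal.ofReal (40 * (I / Real.sinh l))) := by
        rw [← hscale, ← mul_assoc, ← ENNReal.ofReal_ofNat 16, ← ENNReal.ofReal_mul (by norm_num)]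
        norm_num
    _ ≤ 16 * (ENNReal.ofReal v * (∫⁻ t in Ioi v, ENNReal.ofReal (ψ t / t ^ 2)) +
          ∫⁻ t in Ioo 0 v, ENNReal.ofReal (ψ t / t)) := by
        rw [← lintegral_comp_div_eq ψ hv0, ← lintegral_comp_exp_neg_eq ψ hv0,
          ← Ioc_union_Ioi_eq_Ioi (zero_le_one' ℝ)]
        gcongr
        refine (lintegral_union_le _ _ _).trans (add_le_add ?_ ?_)
        · rw [setLIntegral_congr Ioo_ae_eq_Ioc.symm]
          exact setLIntegral_mono' measurableSet_Ioo fun x hx =>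
            hext _ _ (div_pos hv0 hx.1).le (h2 x hx.1 hx.2.le)
        · rw [Ioc_union_Ioi_eq_Ioi (zero_le_one' ℝ)]
          refine (setLIntegral_mono' measurableSet_Ioi fun x hx =>
            hext _ _ (by positivity) (h3 x hx)).trans (lintegral_mono_set ?_)
          exact Ioi_subset_Ioi zero_le_one
    _ ≤ 16 * ENNReal.ofReal (c * φ v) := by
        gcongr
        rw [add_comm]
        exact hcrit v hv0
    _ ≤ 16 * ENNReal.ofReal (|c| * (120 * φ I)) := by
        gcongr
        · exact φ.nonneg _ hv0.le
        · exact le_abs_self c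
        · exact φ.map_mul_le (by norm_num) hI0
    _ = _ := by
        rw [← ENNReal.ofReal_ofNat 16, ← ENNReal.ofReal_mul (by norm_num)]
        congr 1
        ring

/-! ### Integrability of the truncated kernel -/

theorem setLIntegral_Ioc_deriv_eq {F F' : ℝ → ℝ} {a b : ℝ} (hab : a ≤ b)
    (hd : ∀ t ∈ Icc a b, HasDerivAt F (F' t) t) (hc : ContinuousOn F' (Icc a b))
    (h0 : ∀ t ∈ Icc a b, 0 ≤ F' t) :
    ∫⁻ t in Ioc a b, ENNReal.ofReal (F' t) = ENNReal.ofReal (F b - F a) := by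
  have hi : IntervalIntegrable F' volume a b := by
    rw [← uIcc_of_le hab] at hc
    exact hc.intervalIntegrable
  rw [← intervalIntegral.integral_eq_sub_of_hasDerivAt (fun t ht =>
      hd t (by rwa [uIcc_of_le hab] at ht)) hi,
    intervalIntegral.integral_of_le hab, ofReal_integral_eq_lintegral_ofReal
      ((intervalIntegrable_iff_integrableOn_Ioc_of_le hab).1 hi)]
  filter_upwards [ae_restrict_mem measurableSet_Ioc] with t ht
  exact h0 t (Ioc_subset_Icc_self ht)

/-- Cut at `R = ε + u`. The two shells `ε ≤ |s - η| ≤ R` contribute `log (R / ε)` each. Beyond `R`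
the kernel is at most `1 / R` on a set of measure at most `u`, and `u / R = 1 - ε / R ≤ log (R /
ε)`. -/
theorem setLIntegral_inv_abs_le {ε u s : ℝ} (hε : 0 < ε) (hu : 0 ≤ u) {E : Set ℝ}
    (hE : volume E ≤ ENNReal.ofReal u) :
    ∫⁻ η in {η : ℝ | ε < |s - η|} ∩ E, ENNReal.ofReal (1 / |s - η|) ≤
      ENNReal.ofReal (3 * Real.log (1 + u / ε)) := by
  set R := ε + u with hR
  have hR0 : 0 < R := by positivity
  have hεR : ε ≤ R := by linarith
  have hlog : Real.log (1 + u / ε) = Real.log R - Real.log ε := by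
    rw [← Real.log_div hR0.ne' hε.ne', hR]
    congr 1
    field_simp
  have hl0 : 0 ≤ Real.log R - Real.log ε := sub_nonneg.2 (Real.log_le_log hε hεR)
  have hsub : {η : ℝ | ε < |s - η|} ∩ E ⊆ (Ioc (s - R) (s - ε) ∪ Ioc (s + ε) (s + R)) ∪
      ({s - R} ∪ ({η : ℝ | R < |s - η|} ∩ E)) := by
    rintro η ⟨h1, h2⟩
    by_cases h3 : R < |s - η|
    · exact Or.inr (Or.inr ⟨h3, h2⟩)
    · have h1' : ε < |s - η| := h1
      have h4 := abs_le.1 (not_lt.1 h3)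
      rcases eq_or_ne η (s - R) with h5 | h5
      · exact Or.inr (Or.inl h5)
      · left
        rcases lt_abs.1 h1' with h | h
        · left
          exact ⟨lt_of_le_of_ne (by linarith [h4.2]) (Ne.symm h5), by linarith⟩
        · right
          exact ⟨by linarith, by linarith [h4.1]⟩
  have e1 : ∫⁻ η in Ioc (s - R) (s - ε), ENNReal.ofReal (1 / |s - η|) =
      ENNReal.ofReal (Real.log R - Real.log ε) := by
    have h := setLIntegral_Ioc_deriv_eq (F := fun t => -Real.log (s - t))
      (F' := fun t => 1 / (s - t)) (a := s - R) (b := s - ε) (by linarith) ?_ ?_ ?_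
    · simp only [sub_sub_cancel, neg_sub_neg] at h
      rw [← h]
      refine setLIntegral_congr_fun measurableSet_Ioc fun t ht => ?_
      simp only [abs_of_pos (show 0 < s - t by linarith [ht.2])]
    · intro t ht
      have h1 : HasDerivAt (fun t => s - t) (-1) t := by simpa using (hasDerivAt_id t).const_sub s
      have h2 : HasDerivAt (fun t => -Real.log (s - t)) (-(-1 / (s - t))) t :=
        (h1.log (by linarith [ht.2] : s - t ≠ 0)).neg
      rwa [neg_div, neg_neg] at h2
    · exact continuousOn_const.div (by fun_prop) fun t ht => by linarith [ht.2]
    · exact fun t ht => one_div_nonneg.2 (by linarith [ht.2])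
  have e2 : ∫⁻ η in Ioc (s + ε) (s + R), ENNReal.ofReal (1 / |s - η|) =
      ENNReal.ofReal (Real.log R - Real.log ε) := by
    have h := setLIntegral_Ioc_deriv_eq (F := fun t => Real.log (t - s))
      (F' := fun t => 1 / (t - s)) (a := s + ε) (b := s + R) (by linarith) ?_ ?_ ?_
    · simp only [add_sub_cancel_left] at h
      rw [← h]
      refine setLIntegral_congr_fun measurableSet_Ioc fun t ht => ?_
      simp only [abs_sub_comm s t, abs_of_pos (show 0 < t - s by linarith [ht.1])]
    · intro t ht
      exact ((hasDerivAt_id t).sub_const s).log (by simp only [id]; linarith [ht.1])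
    · exact continuousOn_const.div (by fun_prop) fun t ht => by linarith [ht.1]
    · exact fun t ht => one_div_nonneg.2 (by linarith [ht.1])
  have e3 : ∫⁻ η in {η : ℝ | R < |s - η|} ∩ E, ENNReal.ofReal (1 / |s - η|) ≤
      ENNReal.ofReal (Real.log R - Real.log ε) := by
    calc ∫⁻ η in {η : ℝ | R < |s - η|} ∩ E, ENNReal.ofReal (1 / |s - η|)
        ≤ ∫⁻ η in E, ENNReal.ofReal (1 / R) := by
          rw [← Measure.restrict_restrict (measurableSet_far R s)]
          refine (setLIntegral_mono' (measurableSet_far R s) fun η hη => ?_).trans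
            (setLIntegral_le_lintegral _ _)
          exact ENNReal.ofReal_le_ofReal (one_div_le_one_div_of_le hR0 (le_of_lt hη))
      _ ≤ ENNReal.ofReal (1 / R) * ENNReal.ofReal u := by
          rw [setLIntegral_const]
          gcongr
      _ ≤ _ := by
          rw [← ENNReal.ofReal_mul (by positivity)]
          refine ENNReal.ofReal_le_ofReal ?_
          have h1 := Real.log_le_sub_one_of_pos (div_pos hε hR0)
          rw [Real.log_div hε.ne' hR0.ne'] at h1
          have h2 : 1 / R * u = 1 - ε / R := by
            field_simp
            rw [hR]
            ring
          linarith
  have e4 : ∫⁻ η in {s - R}, ENNReal.ofReal (1 / |s - η|) = 0 := by simp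
  refine (lintegral_mono_set hsub).trans ((lintegral_union_le _ _ _).trans ?_)
  refine (add_le_add (lintegral_union_le _ _ _) (lintegral_union_le _ _ _)).trans ?_
  rw [e1, e2, e4, zero_add, hlog, show 3 * (Real.log R - Real.log ε) = (Real.log R - Real.log ε) +
    (Real.log R - Real.log ε) + (Real.log R - Real.log ε) by ring,
    ENNReal.ofReal_add (by positivity) hl0, ENNReal.ofReal_add hl0 hl0]
  gcongr

/-! ### Dyadic decomposition -/

/-- The part of a real number `t` in the dyadic shell `2 ^ n < |t| ≤ 2 ^ (n + 1)`. -/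
def dyadicPart (n : ℤ) (t : ℝ) : ℝ :=
  {t : ℝ | (2 : ℝ) ^ n < |t| ∧ |t| ≤ (2 : ℝ) ^ (n + 1)}.indicator id t

theorem measurable_dyadicPart (n : ℤ) : Measurable (dyadicPart n) :=
  measurable_id.indicator
    ((measurableSet_lt measurable_const (by fun_prop : Measurable fun t : ℝ => |t|)).inter
      (measurableSet_le (by fun_prop : Measurable fun t : ℝ => |t|) measurable_const))

theorem abs_dyadicPart_le (n : ℤ) (t : ℝ) :
    |dyadicPart n t| ≤ {t : ℝ | (2 : ℝ) ^ n < |t|}.indicator (fun _ => (2 : ℝ) ^ (n + 1)) t := by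
  by_cases h : (2 : ℝ) ^ n < |t| ∧ |t| ≤ (2 : ℝ) ^ (n + 1)
  · rw [dyadicPart,
      indicator_of_mem (show t ∈ {t : ℝ | (2 : ℝ) ^ n < |t| ∧ |t| ≤ (2 : ℝ) ^ (n + 1)} from h),
      indicator_of_mem (show t ∈ {t : ℝ | (2 : ℝ) ^ n < |t|} from h.1)]
    exact h.2
  · rw [dyadicPart,
      indicator_of_notMem (show t ∉ {t : ℝ | (2 : ℝ) ^ n < |t| ∧ |t| ≤ (2 : ℝ) ^ (n + 1)} from h),
      abs_zero]
    exact indicator_nonneg (fun _ _ => by positivity) _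

theorem hasSum_dyadicPart (t : ℝ) : HasSum (fun n => dyadicPart n t) t := by
  rcases eq_or_ne t 0 with rfl | ht
  · have : ∀ n, dyadicPart n 0 = 0 := fun n => by simp [dyadicPart, Set.indicator]
    simp only [this]
    exact hasSum_zero
  · obtain ⟨n, hn⟩ := exists_mem_Ioc_zpow (abs_pos.2 ht) one_lt_two
    have h1 : dyadicPart n t = t :=
      indicator_of_mem (show t ∈ {t : ℝ | (2 : ℝ) ^ n < |t| ∧ |t| ≤ (2 : ℝ) ^ (n + 1)} from hn) _
    have h2 := hasSum_single (f := fun k => dyadicPart k t) n fun k hk => ?_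
    · simpa only [h1] using h2
    · refine indicator_of_notMem (fun h => hk ?_) _
      have h3 : (2 : ℝ) ^ k < |t| ∧ |t| ≤ (2 : ℝ) ^ (k + 1) := h
      have h4 := (zpow_lt_zpow_iff_right₀ (one_lt_two : (1 : ℝ) < 2)).1 (hn.1.trans_le h3.2)
      have h5 := (zpow_lt_zpow_iff_right₀ (one_lt_two : (1 : ℝ) < 2)).1 (h3.1.trans_le hn.2)
      omega

theorem maxHilbert_const_mul {c : ℝ} (hc : 0 ≤ c) (f : ℝ → ℝ) (s : ℝ) :
    maxHilbert (fun η => c * f η) s = ENNReal.ofReal c * maxHilbert f s := by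
  simp only [maxHilbert, truncHilbert_const_mul, enorm_mul, ENNReal.mul_iSup,
    Real.enorm_of_nonneg hc]

theorem lorentzFunctional_tsum_int_le {α : Type*} [MeasurableSpace α] {m : Measure α}
    (ψ : OmegaFn) {f : ℤ → α → ℝ≥0∞} (hf : ∀ i, AEMeasurable (f i) m) :
    lorentzFunctional ψ m (fun a => ∑' i, f i a) ≤ ∑' i, lorentzFunctional ψ m (f i) := by
  have h := lorentzFunctional_tsum_le ψ (f := fun k => f (Equiv.intEquivNat.symm k))
    fun k => hf _
  rw [Equiv.intEquivNat.symm.tsum_eq (fun i => lorentzFunctional ψ m (f i))] at h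
  simpa only [fun a => Equiv.intEquivNat.symm.tsum_eq (fun i => f i a)] using h

theorem distrib_sum_lt_top {α ι : Type*} [MeasurableSpace α] {m : Measure α} (S : Finset ι)
    {f : ι → α → ℝ≥0∞} (hf : ∀ i, ∀ s : ℝ, 0 < s → distrib m (f i) s < ∞) :
    ∀ s : ℝ, 0 < s → distrib m (fun a => ∑ i ∈ S, f i a) s < ∞ := by
  classical
  induction S using Finset.induction_on with
  | empty => intro s _; simp [distrib]
  | insert i S hi ih =>
    intro s hs
    simp only [Finset.sum_insert hi]
    exact distrib_lt_top_of_le_add (ae_of_all _ fun a => le_rfl) hs (hf i _ (half_pos hs))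
      (ih _ (half_pos hs))

/-- Finiteness of level sets passes to finite sums. The tail of the series has functional below `(s
/ 2) ψ(∞)`, so Chebyshev handles it; this covers bounded `ψ` as well. -/
theorem distrib_tsum_lt_top {α : Type*} [MeasurableSpace α] {m : Measure α} {ψ : OmegaFn}
    (hψ : ∀ t, 0 < t → 0 < ψ t) {f : ℕ → α → ℝ≥0∞} (hfm : ∀ i, AEMeasurable (f i) m)
    (hsum : ∑' i, lorentzFunctional ψ m (f i) ≠ ∞)
    (hf : ∀ i, ∀ s : ℝ, 0 < s → distrib m (f i) s < ∞) {s : ℝ} (hs : 0 < s) :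
    distrib m (fun a => ∑' i, f i a) s < ∞ := by
  have hpos : 0 < ENNReal.ofReal (s / 2) * ψ.ext ∞ :=
    ENNReal.mul_pos (ENNReal.ofReal_pos.2 (half_pos hs)).ne'
      (OmegaFn.ext_pos hψ ENNReal.top_ne_zero).ne'
  obtain ⟨N, hN⟩ := ((ENNReal.tendsto_sum_nat_add _ hsum).eventually_lt_const hpos).exists
  refine distrib_lt_top_of_le_add (g := fun a => ∑ i ∈ Finset.range N, f i a)
    (h := fun a => ∑' i, f (i + N) a) (ae_of_all _ fun a => ?_) hs
    (distrib_sum_lt_top _ hf _ (half_pos hs)) (distrib_lt_top_of_lorentzFunctional_lt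
      ((lorentzFunctional_tsum_le ψ fun i => hfm _).trans_lt hN))
  exact (ENNReal.summable.sum_add_tsum_nat_add' (f := fun i => f i a) (k := N)).ge

theorem distrib_tsum_int_lt_top {α : Type*} [MeasurableSpace α] {m : Measure α} {ψ : OmegaFn}
    (hψ : ∀ t, 0 < t → 0 < ψ t) {f : ℤ → α → ℝ≥0∞} (hfm : ∀ i, AEMeasurable (f i) m)
    (hsum : ∑' i, lorentzFunctional ψ m (f i) ≠ ∞)
    (hf : ∀ i, ∀ s : ℝ, 0 < s → distrib m (f i) s < ∞) {s : ℝ} (hs : 0 < s) :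
    distrib m (fun a => ∑' i, f i a) s < ∞ := by
  have h := distrib_tsum_lt_top hψ (f := fun k => f (Equiv.intEquivNat.symm k))
    (fun k => hfm _) (by
      rwa [Equiv.intEquivNat.symm.tsum_eq (fun i => lorentzFunctional ψ m (f i))])
    (fun k => hf _) hs
  simpa only [fun a => Equiv.intEquivNat.symm.tsum_eq (fun i => f i a)] using h

/-! ### Boundedness of the Hilbert transform -/

section Bounded

variable {φ : OmegaFn} {x : ℝ →ₘ[volume] ℝ}

theorem measurable_coe_aeeqFun (x : ℝ →ₘ[volume] ℝ) : Measurable x := x.stronglyMeasurable.measurable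

theorem distrib_modulus_lt_top (hφ : Tendsto φ atTop atTop)
    (hx : lorentzFunctional φ volume (modulus x) < ∞) {s : ℝ} (hs : 0 < s) :
    distrib volume (modulus x) s < ∞ := by
  refine distrib_lt_top_of_lorentzFunctional_lt (ψ := φ) ?_
  rwa [OmegaFn.ext_top_of_tendsto hφ, ENNReal.mul_top (ENNReal.ofReal_pos.2 hs).ne']

theorem measurableSet_lt_abs (x : ℝ →ₘ[volume] ℝ) (s : ℝ) : MeasurableSet {η | s < |x η|} :=
  measurableSet_lt measurable_const (measurable_coe_aeeqFun x).abs

theorem integrable_indicator_dyadic (n : ℤ)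
    (hD : distrib volume (modulus x) ((2 : ℝ) ^ n) < ∞) (c : ℝ) :
    Integrable ({η | (2 : ℝ) ^ n < |x η|}.indicator fun _ => c) := by
  rw [distrib_modulus x (by positivity)] at hD
  exact (integrable_indicator_iff (measurableSet_lt_abs x _)).2 (integrableOn_const hD.ne)

theorem integrable_dyadicPart (n : ℤ)
    (hD : distrib volume (modulus x) ((2 : ℝ) ^ n) < ∞) :
    Integrable fun η => dyadicPart n (x η) :=
  (integrable_indicator_dyadic n hD ((2 : ℝ) ^ (n + 1))).mono'
    ((measurable_dyadicPart n).comp (measurable_coe_aeeqFun x)).aestronglyMeasurable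
    (ae_of_all _ fun η => abs_dyadicPart_le n (x η))

/-- Divided by `2^(n+1)`, the slice is bounded by `1` and its `L¹` norm is at most the measure of
`{|x| > 2^n}`, so the restricted estimate applies. The constant is `3840 = 2 · 1920`. -/
theorem lorentzFunctional_maxHilbert_dyadicPart_le {ψ : OmegaFn} {c : ℝ}
    (hcrit : ∀ u : ℝ, 0 < u →
      (∫⁻ t in Ioo 0 u, ENNReal.ofReal (ψ t / t)) +
        ENNReal.ofReal u * (∫⁻ t in Ioi u, ENNReal.ofReal (ψ t / t ^ 2)) ≤
      ENNReal.ofReal (c * φ u)) (n : ℤ)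
    (hD : distrib volume (modulus x) ((2 : ℝ) ^ n) < ∞) :
    lorentzFunctional ψ volume (maxHilbert fun η => dyadicPart n (x η)) ≤
      ENNReal.ofReal (3840 * |c|) *
        (ENNReal.ofReal ((2 : ℝ) ^ n) * φ.ext (distrib volume (modulus x) ((2 : ℝ) ^ n))) := by
  set f : ℝ → ℝ := fun η => ((2 : ℝ) ^ (n + 1))⁻¹ * dyadicPart n (x η) with hf
  have hp : (0 : ℝ) < 2 ^ (n + 1) := by positivity
  have hfi : Integrable f := (integrable_dyadicPart n hD).const_mul _
  have hfb : ∀ η, |f η| ≤ {η | (2 : ℝ) ^ n < |x η|}.indicator (fun _ => (1 : ℝ)) η := by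
    intro η
    rw [hf, abs_mul, abs_of_pos (inv_pos.2 hp), inv_mul_le_iff₀ hp]
    refine (abs_dyadicPart_le n (x η)).trans_eq ?_
    by_cases h : (2 : ℝ) ^ n < |x η| <;> simp [Set.indicator, h]
  have hf1 : ∀ η, |f η| ≤ 1 := fun η => (hfb η).trans
    (indicator_le_self' (fun _ _ => zero_le_one) η)
  have hint : ∫ η, |f η| ≤ (distrib volume (modulus x) ((2 : ℝ) ^ n)).toReal := by
    refine (integral_mono hfi.abs (integrable_indicator_dyadic n hD 1) hfb).trans_eq ?_
    rw [integral_indicator (measurableSet_lt_abs x _), distrib_modulus x (by positivity)]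
    simp [Measure.real]
  have heq : (fun η => dyadicPart n (x η)) = fun η => (2 : ℝ) ^ (n + 1) * f η := by
    ext η
    rw [hf, mul_inv_cancel_left₀ hp.ne']
  have hφ0 : 0 ≤ φ (distrib volume (modulus x) ((2 : ℝ) ^ n)).toReal :=
    φ.nonneg _ ENNReal.toReal_nonneg
  calc lorentzFunctional ψ volume (maxHilbert fun η => dyadicPart n (x η))
      = ENNReal.ofReal ((2 : ℝ) ^ (n + 1)) * lorentzFunctional ψ volume (maxHilbert f) := by
        rw [heq, ← lorentzFunctional_const_mul ψ hp.le]
        exact lorentzFunctional_congr_ae ψ (ae_of_all _ fun s => maxHilbert_const_mul hp.le f s)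
    _ ≤ ENNReal.ofReal ((2 : ℝ) ^ (n + 1)) * ENNReal.ofReal
          (1920 * |c| * φ (distrib volume (modulus x) ((2 : ℝ) ^ n)).toReal) := by
        gcongr
        refine (lorentzFunctional_maxHilbert_le hcrit hfi hf1).trans (ENNReal.ofReal_le_ofReal ?_)
        gcongr
        exact φ.mono (mem_Ici.2 (integral_nonneg fun η => abs_nonneg _))
          (mem_Ici.2 ENNReal.toReal_nonneg) hint
    _ = _ := by
        conv_rhs => rw [← ENNReal.ofReal_toReal hD.ne, φ.ext_ofReal ENNReal.toReal_nonneg]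
        rw [← ENNReal.ofReal_mul (by positivity), ← ENNReal.ofReal_mul (by positivity),
          ← ENNReal.ofReal_mul (by positivity), zpow_add_one₀ two_ne_zero]
        congr 1
        ring

/-- The kernel estimate produces `log (1 + u / ε)`, and the bound of the logarithm by `φ` makes the
slices summable against the `φ`-norm. The factor `max 1 (1 / ε)` comes from concavity, which
compares `log (1 + ku)` with `log (1 + u)` for `k ≥ 1`. -/
theorem setLIntegral_dyadicPart_div_le {C : ℝ} (hC : 0 < C)
    (hlog : ∀ t, 0 ≤ t → Real.log (1 + t) ≤ C * φ t) (n : ℤ)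
    (hD : distrib volume (modulus x) ((2 : ℝ) ^ n) < ∞) {ε : ℝ} (hε : 0 < ε) (s : ℝ) :
    ∫⁻ η in {η : ℝ | ε < |s - η|}, ‖dyadicPart n (x η) / (s - η)‖ₑ ≤
      ENNReal.ofReal (6 * max 1 (1 / ε) * C) *
        (ENNReal.ofReal ((2 : ℝ) ^ n) * φ.ext (distrib volume (modulus x) ((2 : ℝ) ^ n))) := by
  set E : Set ℝ := {η | (2 : ℝ) ^ n < |x η|} with hE
  set u := (distrib volume (modulus x) ((2 : ℝ) ^ n)).toReal with hu
  have hu0 : 0 ≤ u := ENNReal.toReal_nonneg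
  have hEu : volume E ≤ ENNReal.ofReal u := by
    rw [hu, ENNReal.ofReal_toReal hD.ne, distrib_modulus x (by positivity)]
  have hEm : MeasurableSet E := measurableSet_lt_abs x _
  have hp : (0 : ℝ) < 2 ^ (n + 1) := by positivity
  have hlog1 : Real.log (1 + u / ε) ≤ max 1 (1 / ε) * (C * φ u) := by
    calc Real.log (1 + u / ε) ≤ OmegaFn.log (max 1 (1 / ε) * u) := by
          refine OmegaFn.log.mono (mem_Ici.2 (by positivity)) (mem_Ici.2 (by positivity)) ?_
          rw [div_eq_mul_one_div, mul_comm]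
          exact mul_le_mul_of_nonneg_right (le_max_right _ _) hu0
      _ ≤ max 1 (1 / ε) * OmegaFn.log u := OmegaFn.log.map_mul_le (le_max_left _ _) hu0
      _ ≤ _ := mul_le_mul_of_nonneg_left (hlog u hu0) (by positivity)
  calc ∫⁻ η in {η : ℝ | ε < |s - η|}, ‖dyadicPart n (x η) / (s - η)‖ₑ
      ≤ ∫⁻ η in {η : ℝ | ε < |s - η|}, E.indicator
          (fun η => ENNReal.ofReal ((2 : ℝ) ^ (n + 1)) * ENNReal.ofReal (1 / |s - η|)) η := by
        refine lintegral_mono fun η => ?_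
        have h1 := abs_dyadicPart_le n (x η)
        by_cases h : (2 : ℝ) ^ n < |x η|
        · rw [indicator_of_mem (show x η ∈ {t : ℝ | (2 : ℝ) ^ n < |t|} from h)] at h1
          rw [indicator_of_mem (show η ∈ E from h), ← ENNReal.ofReal_mul hp.le,
            Real.enorm_eq_ofReal_abs, abs_div, mul_one_div]
          refine ENNReal.ofReal_le_ofReal ?_
          gcongr
        · rw [indicator_of_notMem (show x η ∉ {t : ℝ | (2 : ℝ) ^ n < |t|} from h)] at h1
          rw [abs_eq_zero.1 (le_antisymm h1 (abs_nonneg _))]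
          simp
    _ = ENNReal.ofReal ((2 : ℝ) ^ (n + 1)) *
          ∫⁻ η in {η : ℝ | ε < |s - η|} ∩ E, ENNReal.ofReal (1 / |s - η|) := by
        rw [lintegral_indicator hEm, Measure.restrict_restrict hEm, inter_comm,
          lintegral_const_mul' _ _ ENNReal.ofReal_ne_top]
    _ ≤ ENNReal.ofReal ((2 : ℝ) ^ (n + 1)) *
          ENNReal.ofReal (3 * (max 1 (1 / ε) * (C * φ u))) := by
        gcongr
        refine (setLIntegral_inv_abs_le hε hu0 hEu).trans (ENNReal.ofReal_le_ofReal ?_)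
        gcongr
    _ = _ := by
        have hφ0 : 0 ≤ φ u := φ.nonneg _ hu0
        rw [← ENNReal.ofReal_toReal hD.ne, ← hu, φ.ext_ofReal hu0,
          ← ENNReal.ofReal_mul (by positivity), ← ENNReal.ofReal_mul (by positivity),
          ← ENNReal.ofReal_mul (by positivity), zpow_add_one₀ two_ne_zero]
        congr 1
        ring

theorem tsum_setLIntegral_dyadicPart_lt_top {C : ℝ} (hC : 0 < C)
    (hlog : ∀ t, 0 ≤ t → Real.log (1 + t) ≤ C * φ t)
    (hx : lorentzFunctional φ volume (modulus x) < ∞) {ε : ℝ} (hε : 0 < ε) (s : ℝ) :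
    ∑' n : ℤ, ∫⁻ η in {η : ℝ | ε < |s - η|}, ‖dyadicPart n (x η) / (s - η)‖ₑ < ∞ := by
  refine (ENNReal.tsum_le_tsum fun n => setLIntegral_dyadicPart_div_le hC hlog n
    (distrib_modulus_lt_top (OmegaFn.tendsto_atTop_of_log_le hC hlog) hx (by positivity))
    hε s).trans_lt ?_
  rw [ENNReal.tsum_mul_left]
  exact ENNReal.mul_lt_top ENNReal.ofReal_lt_top ((tsum_zpow_mul_ext_le φ volume _).trans_lt
    (ENNReal.mul_lt_top (by norm_num) hx))

theorem measurable_dyadicPart_div (x : ℝ →ₘ[volume] ℝ) (n : ℤ) (s : ℝ) :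
    Measurable fun η => dyadicPart n (x η) / (s - η) :=
  ((measurable_dyadicPart n).comp (measurable_coe_aeeqFun x)).div (by fun_prop)

theorem hasSum_dyadicPart_div (x : ℝ →ₘ[volume] ℝ) (s η : ℝ) :
    HasSum (fun n => dyadicPart n (x η) / (s - η)) (x η / (s - η)) :=
  (hasSum_dyadicPart (x η)).div_const _

theorem integrableOn_aeeqFun_div_sub {C : ℝ} (hC : 0 < C)
    (hlog : ∀ t, 0 ≤ t → Real.log (1 + t) ≤ C * φ t)
    (hx : lorentzFunctional φ volume (modulus x) < ∞) {ε : ℝ} (hε : 0 < ε) (s : ℝ) :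
    IntegrableOn (fun η : ℝ => x η / (s - η)) {η | ε < |s - η|} := by
  refine ⟨((measurable_coe_aeeqFun x).div (by fun_prop)).aestronglyMeasurable, ?_⟩
  refine lt_of_le_of_lt ?_ (tsum_setLIntegral_dyadicPart_lt_top hC hlog hx hε s)
  rw [← lintegral_tsum fun n => (measurable_dyadicPart_div x n s).enorm.aemeasurable]
  refine lintegral_mono fun η => ?_
  change ‖x η / (s - η)‖ₑ ≤ _
  rw [← (hasSum_dyadicPart_div x s η).tsum_eq]
  exact enorm_tsum_le_tsum_enorm

theorem truncHilbert_eq_tsum {C : ℝ} (hC : 0 < C)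
    (hlog : ∀ t, 0 ≤ t → Real.log (1 + t) ≤ C * φ t)
    (hx : lorentzFunctional φ volume (modulus x) < ∞) {ε : ℝ} (hε : 0 < ε) (s : ℝ) :
    truncHilbert x ε s = ∑' n : ℤ, truncHilbert (fun η => dyadicPart n (x η)) ε s := by
  simp only [truncHilbert]
  rw [← integral_tsum (fun n => (measurable_dyadicPart_div x n s).aestronglyMeasurable)
    (tsum_setLIntegral_dyadicPart_lt_top hC hlog hx hε s).ne]
  simp only [fun η => (hasSum_dyadicPart_div x s η).tsum_eq]

theorem stronglyMeasurable_truncHilbert (x : ℝ →ₘ[volume] ℝ) (ε : ℝ) :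
    StronglyMeasurable (truncHilbert x ε) := by
  have heq : truncHilbert x ε = fun s => ∫ η, {p : ℝ × ℝ | ε < |p.1 - p.2|}.indicator
      (fun p => x p.2 / (p.1 - p.2)) (s, η) := by
    ext s
    rw [truncHilbert, ← integral_indicator (measurableSet_far ε s)]
    rfl
  rw [heq]
  refine StronglyMeasurable.integral_prod_right' (Measurable.stronglyMeasurable ?_)
  exact (((measurable_coe_aeeqFun x).comp measurable_snd).div (by fun_prop)).indicator
    (measurableSet_lt measurable_const (by fun_prop))

theorem tendsto_one_div_add_atTop_nhdsGT_zero :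
    Tendsto (fun k : ℕ => 1 / ((k : ℝ) + 1)) atTop (𝓝[>] 0) :=
  tendsto_nhdsWithin_iff.2 ⟨tendsto_one_div_add_atTop_nhds_zero_nat,
    Eventually.of_forall fun _ => mem_Ioi.2 (by positivity)⟩

/-- The Hilbert transform exists almost everywhere on a Lorentz space contained in the logarithmic
one, with an estimate. -/
theorem exists_isHilbertTransform {ψ : OmegaFn} (hψ : ∀ t, 0 < t → 0 < ψ t) {C : ℝ} (hC : 0 < C)
    (hlog : ∀ t, 0 ≤ t → Real.log (1 + t) ≤ C * φ t) {c : ℝ}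
    (hcrit : ∀ u : ℝ, 0 < u →
      (∫⁻ t in Ioo 0 u, ENNReal.ofReal (ψ t / t)) +
        ENNReal.ofReal u * (∫⁻ t in Ioi u, ENNReal.ofReal (ψ t / t ^ 2)) ≤
      ENNReal.ofReal (c * φ u))
    (hx : lorentzFunctional φ volume (modulus x) < ∞) :
    ∃ y : ℝ →ₘ[volume] ℝ, IsHilbertTransform x y ∧
      lorentzFunctional ψ volume (modulus y) ≤
        ENNReal.ofReal (7680 * |c|) * lorentzFunctional φ volume (modulus x) ∧
      ∀ s : ℝ, 0 < s → distrib volume (modulus y) s < ∞ := by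
  have hφ := OmegaFn.tendsto_atTop_of_log_le hC hlog
  have hD : ∀ n : ℤ, distrib volume (modulus x) ((2 : ℝ) ^ n) < ∞ := fun n =>
    distrib_modulus_lt_top hφ hx (by positivity)
  set g : ℤ → ℝ → ℝ := fun n η => dyadicPart n (x η) with hg
  have hgi : ∀ n, Integrable (g n) := fun n => integrable_dyadicPart n (hD n)
  have hgb : ∀ n η, |g n η| ≤ (2 : ℝ) ^ (n + 1) := fun n η =>
    (abs_dyadicPart_le n (x η)).trans (indicator_le_self' (fun _ _ => by positivity) _)
  -- This majorant of all truncations of `x` serves three purposes: dominated convergence over the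
  -- slices, the norm bound, and the finiteness of the level sets.
  set Φ : ℝ → ℝ≥0∞ := fun s => ∑' n, maxHilbert (g n) s with hΦ
  have hmm : ∀ n, AEMeasurable (maxHilbert (g n)) volume := fun n =>
    (measurable_maxHilbert (hgi n)).aemeasurable
  -- `7680 = 2 · 3840`, the factor `2` being the loss in the dyadic sum.
  have hsumL : ∑' n, lorentzFunctional ψ volume (maxHilbert (g n)) ≤
      ENNReal.ofReal (7680 * |c|) * lorentzFunctional φ volume (modulus x) := by
    refine (ENNReal.tsum_le_tsum fun n =>
      lorentzFunctional_maxHilbert_dyadicPart_le hcrit n (hD n)).trans ?_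
    rw [ENNReal.tsum_mul_left]
    refine (mul_le_mul_right (tsum_zpow_mul_ext_le φ volume (modulus x)) _).trans_eq ?_
    rw [← mul_assoc, ← ENNReal.ofReal_ofNat 2, ← ENNReal.ofReal_mul (by positivity)]
    congr 2
    ring
  have hsumtop : ∑' n, lorentzFunctional ψ volume (maxHilbert (g n)) ≠ ∞ :=
    (hsumL.trans_lt (ENNReal.mul_lt_top ENNReal.ofReal_lt_top hx)).ne
  have hΦL : lorentzFunctional ψ volume Φ ≤
      ENNReal.ofReal (7680 * |c|) * lorentzFunctional φ volume (modulus x) :=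
    (lorentzFunctional_tsum_int_le ψ hmm).trans hsumL
  have hΦd : ∀ s : ℝ, 0 < s → distrib volume Φ s < ∞ := fun s hs =>
    distrib_tsum_int_lt_top hψ hmm hsumtop (fun n t ht =>
      (volume_lt_maxHilbert_le_div (hgi n) (by positivity) (hgb n) ht).trans_lt
        ENNReal.ofReal_lt_top) hs
  have hΦfin : ∀ᵐ s, Φ s < ∞ := ae_lt_top_of_lorentzFunctional_ne_top hψ
    (hΦL.trans_lt (ENNReal.mul_lt_top ENNReal.ofReal_lt_top hx)).ne
  have hlim : ∀ᵐ s, ∃ l, Tendsto (fun ε => truncHilbert x ε s) (𝓝[>] 0) (𝓝 l) := by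
    filter_upwards [hΦfin, ae_all_iff.2 fun n => ae_exists_tendsto_truncHilbert (hgi n) (hgb n)]
      with s hs hl
    choose h hh using hl
    refine ⟨∑' n, h n, ?_⟩
    have h1 : Tendsto (fun ε => ∑' n, truncHilbert (g n) ε s) (𝓝[>] 0) (𝓝 (∑' n, h n)) := by
      refine tendsto_tsum_of_dominated_convergence
        (bound := fun n => (maxHilbert (g n) s).toReal) (ENNReal.summable_toReal hs.ne) hh ?_
      filter_upwards [self_mem_nhdsWithin] with ε hε n
      have h2 := enorm_truncHilbert_le_maxHilbert (g n) hε s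
      have h3 : maxHilbert (g n) s ≠ ∞ := ne_top_of_le_ne_top hs.ne (ENNReal.le_tsum n)
      rw [← toReal_enorm]
      exact ENNReal.toReal_mono h3 h2
    refine h1.congr' ?_
    filter_upwards [self_mem_nhdsWithin] with ε hε
    exact (truncHilbert_eq_tsum hC hlog hx hε s).symm
  -- A measurable limit is chosen along `ε = 1 / (k + 1)` and then identified with the limit over
  -- all `ε`.
  obtain ⟨y₀, hy₀, hy₀'⟩ := exists_stronglyMeasurable_limit_of_tendsto_ae
    (f := fun (k : ℕ) s => truncHilbert x (1 / ((k : ℝ) + 1)) s)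
    (fun k => (stronglyMeasurable_truncHilbert x _).aestronglyMeasurable) (μ := volume) (by
      filter_upwards [hlim] with s ⟨l, hl⟩
      exact ⟨l, hl.comp tendsto_one_div_add_atTop_nhdsGT_zero⟩)
  have hy₁ : ∀ᵐ s, Tendsto (fun ε => truncHilbert x ε s) (𝓝[>] 0) (𝓝 (y₀ s)) := by
    filter_upwards [hlim, hy₀'] with s ⟨l, hl⟩ hs
    rwa [← tendsto_nhds_unique (hl.comp tendsto_one_div_add_atTop_nhdsGT_zero) hs]
  set y : ℝ →ₘ[volume] ℝ := AEEqFun.mk (fun s => 1 / Real.pi * y₀ s)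
    (hy₀.const_mul _).aestronglyMeasurable with hy
  have hyc : ∀ᵐ s, y s = 1 / Real.pi * y₀ s := AEEqFun.coeFn_mk _ _
  have hyΦ : ∀ᵐ s, modulus y s ≤ Φ s := by
    filter_upwards [hyc, hy₁] with s h1 h2
    have h3 : ‖y₀ s‖ₑ ≤ Φ s := by
      refine le_of_tendsto h2.enorm ?_
      filter_upwards [self_mem_nhdsWithin] with ε hε
      rw [truncHilbert_eq_tsum hC hlog hx hε s]
      exact enorm_tsum_le_tsum_enorm.trans
        (ENNReal.tsum_le_tsum fun n => enorm_truncHilbert_le_maxHilbert (g n) hε s)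
    rw [modulus, h1, enorm_mul]
    refine le_trans ?_ h3
    refine mul_le_of_le_one_left zero_le ?_
    rw [Real.enorm_of_nonneg (by positivity), ENNReal.ofReal_le_one, div_le_one Real.pi_pos]
    linarith [Real.pi_gt_three]
  refine ⟨y, ?_, (lorentzFunctional_mono_ae ψ hyΦ).trans hΦL, fun s hs =>
    (distrib_mono_ae hyΦ s).trans_lt (hΦd s hs)⟩
  filter_upwards [hyc, hy₁] with s h1 h2
  refine ⟨fun ε hε => integrableOn_aeeqFun_div_sub hC hlog hx hε s, ?_⟩
  rw [h1]
  exact h2.const_mul _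

end Bounded

/-! ### Indicator functions -/

section Indicator

variable {α : Type*} [MeasurableSpace α] {m : Measure α}

/-- The class of the indicator function of a measurable set. -/
def indicatorClass (m : Measure α) {E : Set α} (hE : MeasurableSet E) : α →ₘ[m] ℝ :=
  AEEqFun.mk (E.indicator fun _ => (1 : ℝ)) (measurable_const.indicator hE).aestronglyMeasurable

theorem coeFn_indicatorClass {E : Set α} (hE : MeasurableSet E) :
    ∀ᵐ a ∂m, indicatorClass m hE a = E.indicator (fun _ => (1 : ℝ)) a :=
  AEEqFun.coeFn_mk _ _

theorem measure_lt_enorm_indicatorClass {E : Set α} (hE : MeasurableSet E) (s : ℝ≥0∞) :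
    m {a | s < ‖indicatorClass m hE a‖ₑ} = if s < 1 then m E else 0 := by
  have h : m {a | s < ‖indicatorClass m hE a‖ₑ} = m {a | s < 1 ∧ a ∈ E} := by
    refine measure_congr ?_
    filter_upwards [coeFn_indicatorClass (m := m) hE] with a ha
    refine propext ?_
    change s < ‖indicatorClass m hE a‖ₑ ↔ s < 1 ∧ a ∈ E
    rw [ha]
    by_cases h : a ∈ E <;> simp [h]
  rw [h]
  split_ifs with hs <;> simp [hs]

theorem decRearr_indicatorClass_congr {E F : Set α} (hE : MeasurableSet E) (hF : MeasurableSet F)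
    (h : m E = m F) (t : ℝ) :
    decRearr (indicatorClass m hE) t = decRearr (indicatorClass m hF) t := by
  simp only [decRearr, measure_lt_enorm_indicatorClass, h]

theorem indicatorClass_mem_LZero {E : Set α} (hE : MeasurableSet E) :
    indicatorClass m hE ∈ LZero m := by
  refine ⟨1, one_pos, ?_⟩
  rw [← distrib_modulus _ zero_le_one, distrib]
  simp only [modulus, ENNReal.ofReal_one, measure_lt_enorm_indicatorClass]
  simp

theorem lorentzFunctional_indicatorClass (ψ : OmegaFn) {E : Set α} (hE : MeasurableSet E) :
    lorentzFunctional ψ m (modulus (indicatorClass m hE)) = ψ.ext (m E) := by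
  have h := lorentzFunctional_indicator_const (m := m) ψ 1 E
  rw [ENNReal.ofReal_one, one_mul] at h
  rw [← h]
  refine lorentzFunctional_congr_ae ψ ?_
  filter_upwards [coeFn_indicatorClass (m := m) hE] with a ha
  rw [modulus, ha]
  by_cases h : a ∈ E <;> simp [h]

theorem indicatorClass_eq_zero {E : Set α} (hE : MeasurableSet E) (h : m E = 0) :
    indicatorClass m hE = 0 := by
  refine AEEqFun.ext ?_
  filter_upwards [coeFn_indicatorClass (m := m) hE, AEEqFun.coeFn_zero (α := α) (μ := m) (β := ℝ),
    measure_eq_zero_iff_ae_notMem.1 h] with a h1 h2 h3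
  rw [h1, h2, indicator_of_notMem h3, Pi.zero_apply]

end Indicator

/-! ### Series in symmetric Banach function spaces -/

section Series

variable {α : Type*} [MeasurableSpace α] {m : Measure α} {E : Set (α →ₘ[m] ℝ)}
  {N : (α →ₘ[m] ℝ) → ℝ}

theorem LZero_ideal {x y : α →ₘ[m] ℝ} (hx : x ∈ LZero m) (h : ∀ᵐ a ∂m, |y a| ≤ |x a|) :
    y ∈ LZero m := by
  obtain ⟨s, hs, hs'⟩ := hx
  refine ⟨s, hs, lt_of_le_of_lt (measure_mono_ae ?_) hs'⟩
  filter_upwards [h] with a ha h1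
  exact lt_of_lt_of_le h1 ha

namespace IsSymmetricBanach

theorem sub_mem (hE : IsSymmetricBanach m E N) {x y : α →ₘ[m] ℝ} (hx : x ∈ E) (hy : y ∈ E) :
    x - y ∈ E := by
  rw [sub_eq_add_neg, ← neg_one_smul ℝ y]
  exact hE.add_mem x hx _ (hE.smul_mem _ y hy)

theorem norm_sub_comm (hE : IsSymmetricBanach m E N) {x y : α →ₘ[m] ℝ} (hx : x ∈ E) (hy : y ∈ E) :
    N (x - y) = N (y - x) := by
  have h := hE.norm_smul (-1) (y - x) (hE.sub_mem hy hx)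
  rwa [neg_one_smul, neg_sub, abs_neg, abs_one, one_mul] at h

/-- A series of nonnegative functions with summable norms has an upper bound for its terms. -/
theorem exists_ge_of_summable (hE : IsSymmetricBanach m E N) {e : ℕ → α →ₘ[m] ℝ}
    (heE : ∀ i, e i ∈ E) (he : ∀ i, ∀ᵐ a ∂m, 0 ≤ e i a) (hs : Summable fun i => N (e i)) :
    ∃ z ∈ E, ∀ i, ∀ᵐ a ∂m, e i a ≤ z a := by
  set u : ℕ → α →ₘ[m] ℝ := fun n => ∑ i ∈ Finset.range n, e i with hu
  have hsucc : ∀ n, u (n + 1) = u n + e n := fun n => Finset.sum_range_succ _ _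
  have huE : ∀ n, u n ∈ E := by
    intro n
    induction n with
    | zero => simpa [hu] using hE.zero_mem
    | succ n ih =>
      rw [hsucc]
      exact hE.add_mem _ ih _ (heE n)
  have hue : ∀ n, ∀ᵐ a ∂m, u n a = ∑ i ∈ Finset.range n, e i a := by
    intro n
    induction n with
    | zero =>
      filter_upwards [AEEqFun.coeFn_zero (α := α) (μ := m) (β := ℝ)] with a ha
      simpa [hu] using ha
    | succ n ih =>
      rw [hsucc]
      filter_upwards [ih, AEEqFun.coeFn_add (u n) (e n)] with a h1 h2
      rw [h2, Pi.add_apply, h1, Finset.sum_range_succ]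
  have hdiff : ∀ k j, N (u (k + j) - u k) ≤
      ∑ i ∈ Finset.range (k + j), N (e i) - ∑ i ∈ Finset.range k, N (e i) := by
    intro k j
    induction j with
    | zero =>
      have h0 := (hE.norm_eq_zero_iff 0 hE.zero_mem).2 rfl
      simp [h0]
    | succ j ih =>
      rw [← add_assoc, hsucc, Finset.sum_range_succ, add_sub_right_comm]
      have := hE.norm_add_le _ (hE.sub_mem (huE (k + j)) (huE k)) _ (heE (k + j))
      linarith
  have hcauchy : ∀ ε > 0, ∃ n₀, ∀ n ≥ n₀, ∀ k ≥ n₀, N (u n - u k) < ε := by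
    intro ε hε
    obtain ⟨n₀, h⟩ := Metric.cauchySeq_iff.1 hs.hasSum.tendsto_sum_nat.cauchySeq ε hε
    have key : ∀ k ≥ n₀, ∀ j, N (u (k + j) - u k) < ε := fun k hk j =>
      (hdiff k j).trans_lt ((le_abs_self _).trans_lt (h (k + j) (le_add_right hk) k hk))
    refine ⟨n₀, fun n hn k hk => ?_⟩
    rcases le_total k n with h1 | h1
    · obtain ⟨j, rfl⟩ := Nat.exists_eq_add_of_le h1
      exact key k hk j
    · obtain ⟨j, rfl⟩ := Nat.exists_eq_add_of_le h1
      rw [hE.norm_sub_comm (huE _) (huE _)]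
      exact key n hn j
  obtain ⟨z, hz, hlim⟩ := hE.complete u huE hcauchy
  refine ⟨z, hz, fun k => ?_⟩
  -- The positive part of `e k - z` is dominated by `|u n - z|` for every `n > k`, so its norm is
  -- zero. Convergence in norm thus gives the pointwise bound without passing to a subsequence.
  set g : α →ₘ[m] ℝ := (e k - z) ⊔ 0 with hg
  have hga : ∀ᵐ a ∂m, g a = max (e k a - z a) 0 := by
    filter_upwards [AEEqFun.coeFn_sup (e k - z) 0, AEEqFun.coeFn_sub (e k) z,
      AEEqFun.coeFn_zero (α := α) (μ := m) (β := ℝ)] with a h1 h2 h3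
    rw [hg, h1, h2, h3]
    rfl
  have hgL : g ∈ LZero m := by
    refine LZero_ideal (hE.subset_LZero (hE.sub_mem (heE k) hz)) ?_
    filter_upwards [hga, AEEqFun.coeFn_sub (e k) z] with a h1 h2
    rw [h1, h2, Pi.sub_apply, abs_of_nonneg (le_max_right _ _)]
    exact max_le (le_abs_self _) (abs_nonneg _)
  have hgn : ∀ n > k, g ∈ E ∧ N g ≤ N (u n - z) := by
    intro n hn
    refine hE.ideal _ (hE.sub_mem (huE n) hz) g hgL ?_
    filter_upwards [hga, AEEqFun.coeFn_sub (u n) z, hue n, ae_all_iff.2 he] with a h1 h2 h3 h4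
    rw [h1, h2, Pi.sub_apply, abs_of_nonneg (le_max_right _ _)]
    have h5 : e k a ≤ u n a := by
      rw [h3]
      exact Finset.single_le_sum (f := fun i => e i a) (fun i _ => h4 i) (Finset.mem_range.2 hn)
    exact max_le ((sub_le_sub_right h5 _).trans (le_abs_self _)) (abs_nonneg _)
  have hgE : g ∈ E := (hgn (k + 1) (Nat.lt_succ_self k)).1
  have hg0 : g = 0 := by
    refine (hE.norm_eq_zero_iff g hgE).1 (le_antisymm ?_ (hE.norm_nonneg g hgE))
    refine ge_of_tendsto hlim ?_
    filter_upwards [eventually_gt_atTop k] with n hn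
    exact (hgn n hn).2
  rw [hg0] at hga
  filter_upwards [hga, AEEqFun.coeFn_zero (α := α) (μ := m) (β := ℝ)] with a h1 h2
  rw [h2, Pi.zero_apply] at h1
  linarith [le_max_left (e k a - z a) 0]

end IsSymmetricBanach

end Series

/-! ### The Hilbert transform of an indicator function -/

/-- The two sides contribute `log (s / ε)` and `log (ε / (u - s))`; `ε` cancels, so the truncated
integrals are constant for small `ε`. -/
theorem setIntegral_far_indicator {s u ε : ℝ} (hε : 0 < ε) (hs : ε < s) (hu : ε < u - s) :
    ∫ η in {η : ℝ | ε < |s - η|}, (Ioo 0 u).indicator (fun _ => (1 : ℝ)) η / (s - η) =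
      Real.log (s / (u - s)) := by
  have hset : Ioo 0 u ∩ {η : ℝ | ε < |s - η|} = Ioo 0 (s - ε) ∪ Ioo (s + ε) u := by
    ext η
    simp only [mem_inter_iff, mem_Ioo, mem_ofPred_eq, mem_union, lt_abs]
    constructor
    · rintro ⟨⟨h1, h2⟩, h3 | h3⟩
      · exact Or.inl ⟨h1, by linarith⟩
      · exact Or.inr ⟨by linarith, h2⟩
    · rintro (⟨h1, h2⟩ | ⟨h1, h2⟩)
      · exact ⟨⟨h1, by linarith⟩, Or.inl (by linarith)⟩
      · exact ⟨⟨by linarith, h2⟩, Or.inr (by linarith)⟩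
  have hcont : ∀ a b : ℝ, (∀ η ∈ Icc a b, s - η ≠ 0) →
      IntegrableOn (fun η : ℝ => (s - η)⁻¹) (Ioo a b) := fun a b h =>
    ((ContinuousOn.inv₀ (by fun_prop) h).integrableOn_Icc).mono_set Ioo_subset_Icc_self
  have h1 : ∫ η in Ioo 0 (s - ε), (s - η)⁻¹ = Real.log (s / ε) := by
    rw [← integral_Ioc_eq_integral_Ioo, ← intervalIntegral.integral_of_le (by linarith),
      intervalIntegral.integral_comp_sub_left (fun t : ℝ => t⁻¹) s, sub_sub_cancel, sub_zero,
      integral_inv_of_pos hε (by linarith)]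
  have h2 : ∫ η in Ioo (s + ε) u, (s - η)⁻¹ = Real.log (-ε / (s - u)) := by
    rw [← integral_Ioc_eq_integral_Ioo, ← intervalIntegral.integral_of_le (by linarith),
      intervalIntegral.integral_comp_sub_left (fun t : ℝ => t⁻¹) s,
      show s - (s + ε) = -ε by ring, integral_inv_of_neg (by linarith) (by linarith)]
  have heq : (fun η : ℝ => (Ioo 0 u).indicator (fun _ => (1 : ℝ)) η / (s - η)) =
      (Ioo 0 u).indicator fun η => (s - η)⁻¹ := by
    ext η
    by_cases h : η ∈ Ioo 0 u <;> simp [h]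
  rw [heq, integral_indicator measurableSet_Ioo, Measure.restrict_restrict measurableSet_Ioo, hset,
    setIntegral_union _ measurableSet_Ioo (hcont _ _ _) (hcont _ _ _), h1, h2, neg_div,
    ← div_neg, neg_sub, ← Real.log_mul (div_pos (hε.trans hs) hε).ne'
      (div_pos hε (hε.trans hu)).ne']
  · congr 1
    field_simp
  · refine disjoint_left.2 fun η h3 h4 => ?_
    linarith [h3.2, h4.1]
  · intro η h h0
    linarith [h.2]
  · intro η h h0
    linarith [h.1]

theorem IsHilbertTransform.indicatorClass_apply {u : ℝ} {y : ℝ →ₘ[volume] ℝ}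
    (h : IsHilbertTransform (indicatorClass volume (measurableSet_Ioo (a := 0) (b := u))) y) :
    ∀ᵐ s : ℝ, s ∈ Ioo 0 u → y s = 1 / Real.pi * Real.log (s / (u - s)) := by
  filter_upwards [h] with s hs hsu
  refine tendsto_nhds_unique hs.2 (tendsto_const_nhds.congr' ?_)
  filter_upwards [Ioo_mem_nhdsGT (lt_min hsu.1 (sub_pos.2 hsu.2))] with ε hε
  rw [← setIntegral_far_indicator hε.1 (hε.2.trans_le (min_le_left _ _))
    (hε.2.trans_le (min_le_right _ _))]
  congr 1
  refine integral_congr_ae (ae_restrict_of_ae ?_)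
  filter_upwards [coeFn_indicatorClass (m := volume) (measurableSet_Ioo (a := 0) (b := u))]
    with η hη
  rw [hη]

theorem one_add_log_le {w : ℝ} (hw : 4 ≤ w) : 1 + Real.log w ≤ 4 * Real.log (w - 1) := by
  have h1 : 1 ≤ Real.log w := by
    rw [Real.le_log_iff_exp_le (by linarith)]
    linarith [Real.exp_one_lt_d9]
  have h2 : Real.log w ≤ 2 * Real.log (w - 1) := by
    rw [← Real.log_rpow (by linarith)]
    refine Real.log_le_log (by linarith) ?_
    norm_cast
    nlinarith
  linarith

/-- Near the left end, the Hilbert transform of the indicator function of an interval is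
logarithmically large. -/
theorem le_abs_hilbert_indicator {v w s : ℝ} (hw : 4 ≤ w) (hs : s ∈ Ioo 0 v) :
    1 ≤ 16 / (1 + Real.log w) * |1 / Real.pi * Real.log (s / (v * w - s))| := by
  have hl := Real.log_nonneg (show (1 : ℝ) ≤ w by linarith)
  have hv : 0 < v := hs.1.trans hs.2
  have hvw : v * 4 ≤ v * w := mul_le_mul_of_nonneg_left hw hv.le
  have h1 : Real.log (w - 1) ≤ -Real.log (s / (v * w - s)) := by
    rw [← Real.log_inv, inv_div]
    refine Real.log_le_log (by linarith) ?_
    rw [le_div_iff₀ hs.1]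
    nlinarith [hs.2]
  have h2 : (1 + Real.log w) / 4 ≤ |Real.log (s / (v * w - s))| :=
    (by linarith [one_add_log_le hw] : _ ≤ Real.log (w - 1)).trans (h1.trans (neg_le_abs _))
  -- The constant `16` is the product of this `4` and the `4` in `one_add_log_le`.
  have h3 : (1 : ℝ) / 4 ≤ 1 / Real.pi :=
    one_div_le_one_div_of_le Real.pi_pos Real.pi_le_four
  rw [abs_mul, abs_of_pos (one_div_pos.2 Real.pi_pos)]
  calc (1 : ℝ) = 16 / (1 + Real.log w) * (1 / 4 * ((1 + Real.log w) / 4)) := by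
        field_simp
        norm_num
    _ ≤ _ := by gcongr

/-! ### Optimality -/

section Optimal

variable {φ : OmegaFn} {G : Set (ℝ →ₘ[volume] ℝ)} {NG : (ℝ →ₘ[volume] ℝ) → ℝ} {C : ℝ}

/-- Test the operator on the indicator of `(0, vw)`, whose norm is `φ(vw)`. On `(0, v)` its
transform, multiplied by `16 / (1 + log w)`, is at least `1` in modulus, and the ideal property does
the rest. -/
theorem indicator_mem_of_four_le (hφ : ∀ t, 0 < t → 0 < φ t) (hG : IsSymmetricBanach volume G NG)
    (hC : ∀ x ∈ lorentzSpace φ volume, ∃ y ∈ G, IsHilbertTransform x y ∧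
      NG y ≤ C * lorentzNorm φ x) {v w : ℝ} (hv : 0 < v) (hw : 4 ≤ w) :
    indicatorClass volume (measurableSet_Ioo (a := 0) (b := v)) ∈ G ∧
      NG (indicatorClass volume (measurableSet_Ioo (a := 0) (b := v))) ≤
        16 * |C| * (φ (v * w) / (1 + Real.log w)) := by
  have hvw : 0 ≤ v * w := by nlinarith
  have hl := Real.log_nonneg (show (1 : ℝ) ≤ w by linarith)
  have hL : lorentzFunctional φ volume
      (modulus (indicatorClass volume (measurableSet_Ioo (a := 0) (b := v * w)))) =
      ENNReal.ofReal (φ (v * w)) := by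
    rw [lorentzFunctional_indicatorClass, Real.volume_Ioo, sub_zero, φ.ext_ofReal hvw]
  obtain ⟨y, hy, hHy, hNy⟩ := hC (indicatorClass volume (measurableSet_Ioo (a := 0) (b := v * w)))
    ((mem_lorentzSpace_iff hφ).2 (hL ▸ ENNReal.ofReal_lt_top))
  rw [lorentzNorm, lorentzENorm_eq, hL, ENNReal.toReal_ofReal (φ.nonneg _ hvw)] at hNy
  have hid := hG.ideal _ (hG.smul_mem (16 / (1 + Real.log w)) y hy) _
    (indicatorClass_mem_LZero (m := volume) (measurableSet_Ioo (a := 0) (b := v))) (by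
      filter_upwards [hHy.indicatorClass_apply, AEEqFun.coeFn_smul (16 / (1 + Real.log w)) y,
        coeFn_indicatorClass (m := volume) (measurableSet_Ioo (a := 0) (b := v))] with s h1 h2 h3
      rw [h3, h2]
      by_cases hs : s ∈ Ioo 0 v
      · have hsw : s ∈ Ioo 0 (v * w) := ⟨hs.1, hs.2.trans_le (by nlinarith)⟩
        rw [indicator_of_mem hs, Pi.smul_apply, smul_eq_mul, h1 hsw, abs_one, abs_mul,
          abs_of_nonneg (by positivity : 0 ≤ 16 / (1 + Real.log w))]
        exact le_abs_hilbert_indicator hw hs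
      · rw [indicator_of_notMem hs, abs_zero]
        exact abs_nonneg _)
  refine ⟨hid.1, hid.2.trans ?_⟩
  rw [hG.norm_smul _ y hy, abs_of_nonneg (by positivity : 0 ≤ 16 / (1 + Real.log w))]
  have h4 : NG y ≤ |C| * φ (v * w) :=
    hNy.trans (mul_le_mul_of_nonneg_right (le_abs_self C) (φ.nonneg _ hvw))
  calc 16 / (1 + Real.log w) * NG y ≤ 16 / (1 + Real.log w) * (|C| * φ (v * w)) := by gcongr
    _ = _ := by ring

/-- For `1 < w ≤ 4` the estimate at `4` is used: `φ(4v) ≤ 4 φ(v) ≤ 4 φ(vw)`, whence `64 = 4 · 16`.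
-/
theorem indicator_norm_le_psi (hφ : ∀ t, 0 < t → 0 < φ t) (hG : IsSymmetricBanach volume G NG)
    (hC : ∀ x ∈ lorentzSpace φ volume, ∃ y ∈ G, IsHilbertTransform x y ∧
      NG y ≤ C * lorentzNorm φ x) {v : ℝ} (hv : 0 < v) :
    NG (indicatorClass volume (measurableSet_Ioo (a := 0) (b := v))) ≤ 64 * |C| * φ.psi v := by
  have : Nonempty (Ioi (1 : ℝ)) := ⟨⟨2, by norm_num⟩⟩
  change _ ≤ 64 * |C| * ⨅ w : Ioi (1 : ℝ), φ (v * w) / (1 + Real.log w)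
  rw [Real.mul_iInf_of_nonneg (by positivity)]
  refine le_ciInf fun ⟨w, hw⟩ => ?_
  have hw1 : 1 < w := hw
  have hl := Real.log_pos hw1
  have hφw : 0 ≤ φ (v * w) := φ.nonneg _ (by positivity)
  rcases le_total 4 w with h4 | h4
  · refine (indicator_mem_of_four_le hφ hG hC hv h4).2.trans ?_
    gcongr
    norm_num
  · refine (indicator_mem_of_four_le hφ hG hC hv le_rfl).2.trans ?_
    have h1 : φ (v * 4) ≤ 4 * φ (v * w) := by
      rw [mul_comm]
      refine (φ.map_mul_le (by norm_num) hv.le).trans ?_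
      gcongr
      exact φ.mono (mem_Ici.2 hv.le) (mem_Ici.2 (by positivity)) (by nlinarith)
    calc 16 * |C| * (φ (v * 4) / (1 + Real.log 4))
        ≤ 16 * |C| * (4 * φ (v * w) / (1 + Real.log w)) := by gcongr
      _ = _ := by
        simp only
        ring

/-- By symmetry of the norm only the measure of the set matters, so it may be replaced by an
interval. -/
theorem indicatorClass_mem_and_norm_le (hφ : ∀ t, 0 < t → 0 < φ t)
    (hG : IsSymmetricBanach volume G NG)
    (hC : ∀ x ∈ lorentzSpace φ volume, ∃ y ∈ G, IsHilbertTransform x y ∧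
      NG y ≤ C * lorentzNorm φ x) {E : Set ℝ} (hE : MeasurableSet E) (hEfin : volume E ≠ ∞) :
    indicatorClass volume hE ∈ G ∧
      ENNReal.ofReal (NG (indicatorClass volume hE)) ≤
        ENNReal.ofReal (64 * |C|) * φ.psi.ext (volume E) := by
  rcases eq_or_ne (volume E) 0 with h0 | h0
  · rw [indicatorClass_eq_zero hE h0, (hG.norm_eq_zero_iff 0 hG.zero_mem).2 rfl]
    exact ⟨hG.zero_mem, by simp⟩
  · set v := (volume E).toReal with hvdef
    have hv : 0 < v := ENNReal.toReal_pos h0 hEfin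
    have hvE : volume E = ENNReal.ofReal v := (ENNReal.ofReal_toReal hEfin).symm
    have h1 := hG.symmetric _ (indicator_mem_of_four_le hφ hG hC hv le_rfl).1 _
      (indicatorClass_mem_LZero hE) fun t _ =>
        decRearr_indicatorClass_congr hE measurableSet_Ioo (by
          rw [hvE, Real.volume_Ioo, sub_zero]) t
    refine ⟨h1.1, ?_⟩
    rw [h1.2, hvE, φ.psi.ext_ofReal hv.le, ← ENNReal.ofReal_mul (by positivity)]
    exact ENNReal.ofReal_le_ofReal (indicator_norm_le_psi hφ hG hC hv)

/-- The vanishing part of the Lorentz space of `ψ` is contained in every symmetric range. -/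
theorem lorentzSpaceVanishing_psi_subset (hφ : ∀ t, 0 < t → 0 < φ t)
    (hψ : ∀ t, 0 < t → 0 < φ.psi t) (hG : IsSymmetricBanach volume G NG)
    (hH : HilbertBounded (lorentzSpace φ volume) (lorentzNorm φ) G NG) :
    lorentzSpaceVanishing φ.psi volume ⊆ G := by
  obtain ⟨C, hC⟩ := hH
  intro x hxV
  obtain ⟨hx, hD⟩ := (mem_lorentzSpaceVanishing_iff hψ).1 hxV
  have hDfin : ∀ n : ℤ, volume {η | (2 : ℝ) ^ n < |x η|} ≠ ∞ := fun n => by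
    rw [← distrib_modulus x (by positivity)]
    exact (hD _ (by positivity)).ne
  -- Where `2^n < |x| ≤ 2^(n+1)`, the single term `e n` already dominates `|x|`, so any common upper
  -- bound of the terms does too. The level sets have finite measure because `x` is in the vanishing
  -- part, which is what puts each term in `G`.
  set e : ℤ → ℝ →ₘ[volume] ℝ := fun n =>
    (2 : ℝ) ^ (n + 1) • indicatorClass volume (measurableSet_lt_abs x ((2 : ℝ) ^ n)) with he
  have hmem : ∀ n, e n ∈ G := fun n => hG.smul_mem _ _
    (indicatorClass_mem_and_norm_le hφ hG hC (measurableSet_lt_abs x _) (hDfin n)).1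
  have hcoe : ∀ n, ∀ᵐ a, e n a =
      (2 : ℝ) ^ (n + 1) * {η | (2 : ℝ) ^ n < |x η|}.indicator (fun _ => (1 : ℝ)) a := fun n => by
    filter_upwards [AEEqFun.coeFn_smul ((2 : ℝ) ^ (n + 1))
      (indicatorClass volume (measurableSet_lt_abs x ((2 : ℝ) ^ n))),
      coeFn_indicatorClass (m := volume) (measurableSet_lt_abs x ((2 : ℝ) ^ n))] with a h1 h2
    rw [he, h1, Pi.smul_apply, h2, smul_eq_mul]
  have hnorm : ∀ n, ENNReal.ofReal (NG (e n)) ≤ ENNReal.ofReal (128 * |C|) *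
      (ENNReal.ofReal ((2 : ℝ) ^ n) * φ.psi.ext (distrib volume (modulus x) ((2 : ℝ) ^ n))) := by
    intro n
    obtain ⟨h1, h2⟩ :=
      indicatorClass_mem_and_norm_le hφ hG hC (measurableSet_lt_abs x ((2 : ℝ) ^ n)) (hDfin n)
    rw [he, hG.norm_smul _ _ h1, abs_of_pos (by positivity), ENNReal.ofReal_mul (by positivity),
      distrib_modulus x (by positivity)]
    refine (mul_le_mul_right h2 _).trans_eq ?_
    rw [← mul_assoc, ← mul_assoc, ← ENNReal.ofReal_mul (by positivity),
      ← ENNReal.ofReal_mul (by positivity), zpow_add_one₀ two_ne_zero]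
    congr 2
    ring
  have hsum : Summable fun n => NG (e n) := by
    have h1 : ∑' n, ENNReal.ofReal (NG (e n)) ≠ ∞ := by
      refine ne_top_of_le_ne_top ?_ (ENNReal.tsum_le_tsum hnorm)
      rw [ENNReal.tsum_mul_left]
      exact (ENNReal.mul_lt_top ENNReal.ofReal_lt_top
        ((tsum_zpow_mul_ext_le φ.psi volume _).trans_lt
          (ENNReal.mul_lt_top (by norm_num) hx))).ne
    exact (ENNReal.summable_toReal h1).congr fun n =>
      ENNReal.toReal_ofReal (hG.norm_nonneg _ (hmem n))
  have he0 : ∀ n, ∀ᵐ a, 0 ≤ e n a := fun n => by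
    filter_upwards [hcoe n] with a ha
    rw [ha]
    exact mul_nonneg (by positivity) (indicator_nonneg (fun _ _ => zero_le_one) _)
  clear_value e
  have hsum' : Summable fun i => NG (e (Equiv.intEquivNat.symm i)) :=
    (Equiv.summable_iff (f := fun n => NG (e n)) Equiv.intEquivNat.symm).2 hsum
  obtain ⟨z, hz, hzle⟩ := hG.exists_ge_of_summable (fun i => hmem (Equiv.intEquivNat.symm i))
    (fun i => he0 _) hsum'
  refine (hG.ideal z hz x hxV.1.1 ?_).1
  filter_upwards [ae_all_iff.2 hcoe, ae_all_iff.2 hzle] with a h1 h2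
  rcases eq_or_ne (x a) 0 with h0 | h0
  · rw [h0, abs_zero]
    exact abs_nonneg _
  · obtain ⟨n, hn⟩ := exists_mem_Ioc_zpow (abs_pos.2 h0) one_lt_two
    have h3 := h2 (Equiv.intEquivNat n)
    rw [Equiv.symm_apply_apply, h1,
      indicator_of_mem (show a ∈ {η | (2 : ℝ) ^ n < |x η|} from hn.1), mul_one] at h3
    exact hn.2.trans (h3.trans (le_abs_self _))

end Optimal

/-! ### The main theorem -/

/-- The smaller target is the decisive one: it is the least range in general, and boundedness into
all of `Λ_ψ` follows by inclusion. -/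
theorem hilbertBounded_lorentzSpaceVanishing {φ ψ : OmegaFn} (hφ : ∀ t, 0 < t → 0 < φ t)
    (hψ : ∀ t, 0 < t → 0 < ψ t) {C : ℝ} (hC : 0 < C)
    (hlog : ∀ t, 0 ≤ t → Real.log (1 + t) ≤ C * φ t) {c : ℝ}
    (hcrit : ∀ u : ℝ, 0 < u →
      (∫⁻ t in Ioo 0 u, ENNReal.ofReal (ψ t / t)) +
        ENNReal.ofReal u * (∫⁻ t in Ioi u, ENNReal.ofReal (ψ t / t ^ 2)) ≤
      ENNReal.ofReal (c * φ u)) :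
    HilbertBounded (lorentzSpace φ volume) (lorentzNorm φ)
      (lorentzSpaceVanishing ψ volume) (lorentzNorm ψ) := by
  refine ⟨7680 * |c|, fun x hx => ?_⟩
  have hx' := (mem_lorentzSpace_iff hφ).1 hx
  obtain ⟨y, hy, hyL, hyd⟩ := exists_isHilbertTransform hψ hC hlog hcrit hx'
  have htop := ENNReal.mul_lt_top (ENNReal.ofReal_lt_top (r := 7680 * |c|)) hx'
  refine ⟨y, (mem_lorentzSpaceVanishing_iff hψ).2 ⟨hyL.trans_lt htop, hyd⟩, hy, ?_⟩
  rw [lorentzNorm, lorentzNorm, lorentzENorm_eq, lorentzENorm_eq]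
  refine (ENNReal.toReal_mono htop.ne hyL).trans_eq ?_
  rw [ENNReal.toReal_mul, ENNReal.toReal_ofReal (by positivity)]

end

theorem mainTheorem3 (φ : OmegaFn)
    (hlim : Tendsto (fun t : ℝ => φ.psi t / t) atTop (𝓝 0))
    (hlog : lorentzSpace φ (volume.restrict (Ioi (0 : ℝ))) ⊆
      lorentzSpace OmegaFn.log (volume.restrict (Ioi (0 : ℝ))))
    (hcrit : ∃ c : ℝ, ∀ u : ℝ, 0 < u →
      (∫⁻ t in Ioo 0 u, ENNReal.ofReal (φ.psi t / t)) +
        ENNReal.ofReal u * (∫⁻ t in Ioi u, ENNReal.ofReal (φ.psi t / t ^ 2)) ≤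
      ENNReal.ofReal (c * φ u)) :
    IsSymmetricBanach (volume : Measure ℝ) (lorentzSpace φ.psi (volume : Measure ℝ)) (lorentzNorm φ.psi) ∧
    HilbertBounded (lorentzSpace φ (volume : Measure ℝ)) (lorentzNorm φ)
      (lorentzSpace φ.psi (volume : Measure ℝ)) (lorentzNorm φ.psi) ∧
    IsOptimalSymmetricRange (lorentzSpace φ (volume : Measure ℝ)) (lorentzNorm φ)
      (lorentzSpaceVanishing φ.psi (volume : Measure ℝ)) (lorentzNorm φ.psi) ∧
    (Tendsto φ.psi atTop atTop →
      IsOptimalSymmetricRange (lorentzSpace φ (volume : Measure ℝ)) (lorentzNorm φ)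
        (lorentzSpace φ.psi (volume : Measure ℝ)) (lorentzNorm φ.psi)) := by
  obtain ⟨C, hC, hlogC⟩ := OmegaFn.exists_log_le_mul hlog
  obtain ⟨c, hc⟩ := hcrit
  have hφ : ∀ t, 0 < t → 0 < φ t := fun t ht => by
    have h1 := Real.log_pos (show 1 < 1 + t by linarith)
    exact (mul_pos_iff_of_pos_left hC).1 (h1.trans_le (hlogC t ht.le))
  have hψ : ∀ t, 0 < t → 0 < φ.psi t := OmegaFn.psi_pos_of_log_le hC hlogC
  have hbdd := hilbertBounded_lorentzSpaceVanishing hφ hψ hC hlogC hc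
  have hopt : IsOptimalSymmetricRange (lorentzSpace φ volume) (lorentzNorm φ)
      (lorentzSpaceVanishing φ.psi volume) (lorentzNorm φ.psi) :=
    ⟨isSymmetricBanach_lorentzSpaceVanishing hψ, hbdd, fun G NG hG hH =>
      lorentzSpaceVanishing_psi_subset hφ hψ hG hH⟩
  refine ⟨isSymmetricBanach_lorentzSpace hψ, ?_, hopt, fun hψtop => ?_⟩
  · obtain ⟨K, hK⟩ := hbdd
    refine ⟨K, fun x hx => ?_⟩
    obtain ⟨y, hy, h⟩ := hK x hx
    exact ⟨y, hy.1, h⟩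
  · rwa [lorentzSpaceVanishing_eq hψ hψtop] at hopt
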